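/- Let $X$ be a connected $2$-dimensional topological manifold (Hausdorff, second countable), possibly with boundary $\partial X$, and let $\Delta$ be a one-dimensional foliation on $X$ such that * every leaf of $\Delta$ is a closed subset of $X$; * every connected component of $\partial X$ is a leaf of $\Delta$; * for every leaf $\omega$, setting $J=[0,1)$ if $\omega\subset\partial X$ and $J=(-1,1)$ otherwise, there are an open neighborhood $U$ of $\omega$ and a homeomorphism $\psi:\mathbb R\times J\to U$ such that $\psi(\mathbb R\times 0)=\omega$ and $\psi(\mathbb R\times t)$ is a leaf of $\Delta$ for every $t\in J$. Let $Y=X/\Delta$ be the space of leaves with the quotient topology. A leaf is called special if the corresponding point $y\in Y$ satisfies $\bigcap_{V}\overline V\neq\{y\}$, where $V$ runs over all neighborhoods of $y$ in $Y$. Suppose that the family $\Sigma$ of all special leaves is locally finite in $X$, and let $Q$ be a connected component of $X\setminus(\bigcup\Sigma\cup\partial X)$. A homeomorphism is called foliated if it maps leaves onto leaves; subsets of $X$ that are unions of leaves are foliated by the leaves they contain. A model strip is a set $S\subset\mathbb R^2$ such that for some $a<b$ we have $\mathbb R\times(a,b)\subset S\subset\mathbb R\times[a,b]$ and $S\cap(\mathbb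 R\times\{a,b\})$ is a disjoint union of (possibly none, possibly unbounded) open intervals of the lines $\mathbb R\times a$ and $\mathbb R\times b$; its leaves are the lines $\mathbb R\times t$, $a<t<b$, and these boundary intervals. The standard cylinder (resp. the standard Möbius band) is the quotient of $\mathbb R\times[-1,1]$ by the identifications $(t,-1)\sim(t,1)$ (resp. $(t,-1)\sim(-t,1)$), $t\in\mathbb R$, foliated by the images of the lines $\mathbb R\times t$. Then: 1. $Q$ is foliated homeomorphic to the standard cylinder, to the standard Möbius band, or to the open model strip $\mathbb R\times(-1,1)$. In the first two cases $Q=X$. 2. If $\varphi:\mathbb R\times(-1,1)\to Q$ is any foliated homeomorphism, then each of the closures in $X$ of $\varphi(\mathbb R\times(-1,0])$ and of $\varphi(\mathbb R\times[0,1))$ is a union of leaves and is foliated homeomorphic to some model strip. -/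

import Mathlib

open Set Topology
open scoped Manifold

namespace StripFoliation

/-! A partition of a space into leaves is a `Setoid`; its leaves are the classes `Δ.classes`, and
the leaf space is `Quotient Δ` with the quotient topology. -/

section ClassF

variable {X : Type*} [TopologicalSpace X]

/-- `ω` has an open neighbourhood `U` with a homeomorphism `φ : ℝ × J → U` such that
`φ (ℝ × 0) = ω` and every `φ (ℝ × t)` is a leaf. -/
def HasTrivialNhd (Δ : Setoid X) (ω : Set X) (J : Set ℝ) : Prop :=
  ∃ U : Set X, IsOpen U ∧ ω ⊆ U ∧ ∃ φ : (ℝ × J) ≃ₜ U,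
    (fun p : ℝ × J => (φ p : X)) '' {p | (p.2 : ℝ) = 0} = ω ∧
    ∀ t : J, range (fun x : ℝ => (φ (x, t) : X)) ∈ Δ.classes

/-- Foliations of class `F` on a surface `X`, possibly with boundary. (A partition with the
property `trivial_interior` and `trivial_boundary` is in particular a one-dimensional foliation:
the trivializations are foliated charts.) -/
structure IsClassF [ChartedSpace (EuclideanHalfSpace 2) X] (Δ : Setoid X) : Prop where
  isClosed_leaf : ∀ ω ∈ Δ.classes, IsClosed ω
  boundary_component : ∀ x ∈ (𝓡∂ 2).boundary X,
    connectedComponentIn ((𝓡∂ 2).boundary X) x ∈ Δ.classes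
  trivial_boundary : ∀ ω ∈ Δ.classes, ω ⊆ (𝓡∂ 2).boundary X → HasTrivialNhd Δ ω (Ico 0 1)
  trivial_interior : ∀ ω ∈ Δ.classes, ¬ ω ⊆ (𝓡∂ 2).boundary X → HasTrivialNhd Δ ω (Ioo (-1) 1)

/-- The intersection of the closures of all neighbourhoods of `y`. -/
def hausdorffClosure {Y : Type*} [TopologicalSpace Y] (y : Y) : Set Y :=
  ⋂ V ∈ 𝓝 y, closure V

/-- `y` is special if the space is not Hausdorff at `y`. -/
def IsSpecialPoint {Y : Type*} [TopologicalSpace Y] (y : Y) : Prop :=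
  hausdorffClosure y ≠ {y}

/-- The family of special leaves: those whose image in the leaf space is a special point. -/
def specialLeaves (Δ : Setoid X) : Set (Set X) :=
  {ω | ∃ y : Quotient Δ, IsSpecialPoint y ∧ ω = (Quotient.mk Δ) ⁻¹' {y}}

/-- `Q` is a connected component of the subspace `F`. -/
def IsComponentOf (F Q : Set X) : Prop :=
  ∃ x ∈ F, Q = connectedComponentIn F x

/-- The homeomorphism `h` from the foliated space `(M, Γ)` onto the subset `A` of `X` is foliated:
it maps leaves of `Γ` onto leaves of `Δ` (which then lie in `A`). -/
def IsFoliated {M : Type*} [TopologicalSpace M] (Γ : Setoid M) (Δ : Setoid X) {A : Set X}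
    (h : M ≃ₜ A) : Prop :=
  ∀ l ∈ Γ.classes, (fun m : M => (h m : X)) '' l ∈ Δ.classes

/-- `A`, with the leaves of `Δ` that it consists of, is foliated homeomorphic to `(M, Γ)`. -/
def FoliatedHomeomorphic {M : Type*} [TopologicalSpace M] (Γ : Setoid M) (Δ : Setoid X)
    (A : Set X) : Prop :=
  ∃ h : M ≃ₜ A, IsFoliated Γ Δ h

end ClassF

section Models

/-- `B` is a disjoint union of (nonempty, possibly unbounded) open intervals. -/
def IsDisjointUnionOfOpenIntervals (B : Set ℝ) : Prop :=
  ∃ I : Set (Set ℝ), I.PairwiseDisjoint id ∧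
    (∀ K ∈ I, K.Nonempty ∧ IsOpen K ∧ K.OrdConnected) ∧ ⋃₀ I = B

/-- Model strips: `ℝ × (a, b) ⊆ S ⊆ ℝ × [a, b]`, and `S` meets the two boundary lines in disjoint
unions of open intervals. -/
def IsModelStrip (S : Set (ℝ × ℝ)) : Prop :=
  ∃ a b : ℝ, a < b ∧ univ ×ˢ Ioo a b ⊆ S ∧ S ⊆ univ ×ˢ Icc a b ∧
    IsDisjointUnionOfOpenIntervals {x | (x, a) ∈ S} ∧
    IsDisjointUnionOfOpenIntervals {x | (x, b) ∈ S}

/-- The foliation of `S` by horizontal lines: two points are in the same leaf if they are joined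
by a horizontal segment inside `S`. For a model strip the leaves are the lines `ℝ × t` with
`a < t < b` and the intervals of the boundary. -/
def canonicalFoliation (S : Set (ℝ × ℝ)) : Setoid S where
  r p q := p.1.2 = q.1.2 ∧ ∀ x ∈ uIcc p.1.1 q.1.1, (x, p.1.2) ∈ S
  iseqv := by
    refine ⟨fun p => ⟨rfl, fun x hx => ?_⟩, fun {p q} h => ⟨h.1.symm, fun x hx => ?_⟩,
      fun {p q r} h k => ⟨h.1.trans k.1, fun x hx => ?_⟩⟩
    · rw [uIcc_self, mem_singleton_iff] at hx
      rw [hx]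
      exact p.2
    · rw [← h.1]
      exact h.2 x (uIcc_comm q.1.1 p.1.1 ▸ hx)
    · rcases uIcc_subset_uIcc_union_uIcc (b := q.1.1) hx with hx | hx
      · exact h.2 x hx
      · rw [h.1]
        exact k.2 x hx

/-- The open model strip `ℝ × (-1, 1)`. -/
def openStrip : Set (ℝ × ℝ) := univ ×ˢ Ioo (-1) 1

/-- The closed model strip `ℝ × [-1, 1]`. -/
def closedStrip : Set (ℝ × ℝ) := univ ×ˢ Icc (-1) 1

/-- The identification `(t, -1) ∼ (f t, 1)` of the boundary lines of `ℝ × [-1, 1]`. -/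
def glue (f : ℝ → ℝ) (p q : closedStrip) : Prop :=
  p.1.2 = -1 ∧ q.1.2 = 1 ∧ q.1.1 = f p.1.1

/-- The quotient space of `ℝ × [-1, 1]` by `(t, -1) ∼ (f t, 1)`. -/
def Glued (f : ℝ → ℝ) : Type := Quot (glue f)

instance (f : ℝ → ℝ) : TopologicalSpace (Glued f) :=
  inferInstanceAs (TopologicalSpace (Quot (glue f)))

/-- The foliation of the quotient induced by the canonical one: its leaves are the images of the
lines `ℝ × t`. -/
def gluedFoliation (f : ℝ → ℝ) : Setoid (Glued f) :=
  (canonicalFoliation closedStrip).map (Quot.mk (glue f))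

/-- The standard cylinder, with boundary lines identified by `(t, -1) ∼ (t, 1)`. -/
abbrev StandardCylinder : Type := Glued (fun t => t)

/-- The foliation of the standard cylinder. -/
abbrev cylinderFoliation : Setoid StandardCylinder := gluedFoliation (fun t => t)

/-- The standard Möbius band, with boundary lines identified by `(t, -1) ∼ (-t, 1)`. -/
abbrev StandardMobius : Type := Glued (fun t => -t)

/-- The foliation of the standard Möbius band. -/
abbrev mobiusFoliation : Setoid StandardMobius := gluedFoliation (fun t => -t)

end Models

end StripFoliation

/-! The regular leaves form an open subset of the leaf space whose points have neighborhoods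
homeomorphic to an interval and are separated from all other points, so each of its components is a
line or a circle: a unit-speed parametrization of the component by `ℝ` is injective or has a
shortest chord, and in the second case it closes up to a circle. The leaves along a curve form a
line bundle, which is trivial over an interval, so that the component is a strip or is glued from a
strip by a homeomorphism of `ℝ`, which can be straightened to `t` or `-t`. A compact set of regular
leaves is clopen, hence a circle is everything.

The closure of a half of a strip adds leaves at its end, each of which is isolated among them
because the half is connected and special leaves are locally finite. Charts around the added leaves,
oriented as the strip, give coordinates on the leaves that are monotone in each other. A weighted
sum of these, normalized to be bounded along the end, embeds the closure into `ℝ × [0, 1]`. -/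

namespace StripFoliation

open Filter MeasureTheory

section LevelMaps

theorem isOpenMap_prodMk_snd {α β T : Type*} [ConditionallyCompleteLinearOrder α]
    [TopologicalSpace α] [OrderTopology α] [DenselyOrdered α] [NoMinOrder α] [NoMaxOrder α]
    [LinearOrder β] [TopologicalSpace β] [OrderClosedTopology β] [TopologicalSpace T]
    {f : α × T → β} (hf : Continuous f) (hmono : ∀ t, StrictMono fun x => f (x, t)) :
    IsOpenMap fun q : α × T => (f q, q.2) := by
  rw [isOpenMap_iff_nhds_le]
  rintro ⟨x, t⟩ W hW
  obtain ⟨A, hA, B, hB, hAB⟩ := mem_nhds_prod_iff.1 (mem_map.1 hW)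
  obtain ⟨a, b, ⟨hax, hxb⟩, hab⟩ := mem_nhds_iff_exists_Ioo_subset.1 hA
  obtain ⟨a₁, haa₁, ha₁x⟩ := exists_between hax
  obtain ⟨a₂, ha₁a₂, ha₂x⟩ := exists_between ha₁x
  obtain ⟨b₁, hxb₁, hb₁b⟩ := exists_between hxb
  obtain ⟨b₂, hxb₂, hb₂b₁⟩ := exists_between hxb₁
  have hleft : ∀ᶠ s in 𝓝 t, f (a₁, s) < f (a₂, t) :=
    (hf.comp (Continuous.prodMk_right a₁)).continuousAt.eventually_lt_const (hmono t ha₁a₂)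
  have hright : ∀ᶠ s in 𝓝 t, f (b₂, t) < f (b₁, s) :=
    (hf.comp (Continuous.prodMk_right b₁)).continuousAt.eventually_const_lt (hmono t hb₂b₁)
  have hval : Ioo (f (a₂, t)) (f (b₂, t)) ∈ 𝓝 (f (x, t)) :=
    Ioo_mem_nhds (hmono t ha₂x) (hmono t hxb₂)
  filter_upwards [prod_mem_nhds hval (inter_mem hB (inter_mem hleft hright))]
  rintro ⟨w, s⟩ ⟨hw, hs, hs₁, hs₂⟩
  obtain ⟨v, hv, rfl⟩ : w ∈ (fun v => f (v, s)) '' Icc a₁ b₁ :=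
    intermediate_value_Icc (ha₁x.trans hxb₁).le (hf.comp (Continuous.prodMk_left s)).continuousOn
      ⟨(hs₁.trans hw.1).le, (hw.2.trans hs₂).le⟩
  exact hAB (mk_mem_prod (hab ⟨haa₁.trans_le hv.1, hv.2.trans_lt hb₁b⟩) hs)

theorem tendsto_atTop_of_strictMono_of_surjective {α β : Type*} [LinearOrder α] [Preorder β]
    {f : α → β} (hf : StrictMono f) (hs : Function.Surjective f) : Tendsto f atTop atTop :=
  (hf.orderIsoOfSurjective f hs).tendsto_atTop

theorem tendsto_atBot_of_strictMono_of_surjective {α β : Type*} [LinearOrder α] [Preorder β]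
    {f : α → β} (hf : StrictMono f) (hs : Function.Surjective f) : Tendsto f atBot atBot :=
  (hf.orderIsoOfSurjective f hs).tendsto_atBot

/-- The inverse of the sigmoid function, used as a homeomorphism from `(0, 1)` onto the line. -/
noncomputable def logit (x : ℝ) : ℝ := -Real.log (x⁻¹ - 1)

theorem logit_sigmoid (x : ℝ) : logit (Real.sigmoid x) = x := by
  simp [logit, Real.sigmoid_def]

theorem sigmoid_logit {x : ℝ} (hx : x ∈ Ioo (0 : ℝ) 1) : Real.sigmoid (logit x) = x := by
  obtain ⟨y, rfl⟩ := Real.range_sigmoid ▸ hx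
  rw [logit_sigmoid]

theorem continuousOn_logit : ContinuousOn logit (Ioo 0 1) := by
  intro x hx
  have hx0 : x ≠ 0 := hx.1.ne'
  have hinv : x⁻¹ - 1 ≠ 0 := (sub_pos.2 ((one_lt_inv₀ hx.1).2 hx.2)).ne'
  apply ContinuousAt.continuousWithinAt
  unfold logit
  fun_prop (disch := assumption)

theorem strictMonoOn_logit : StrictMonoOn logit (Ioo 0 1) := by
  intro x hx y hy hxy
  rw [← sigmoid_logit hx, ← sigmoid_logit hy] at hxy
  exact Real.sigmoid_lt_iff.1 hxy

theorem isPreconnected_of_ordConnected_coe {J : Set ℝ} (hJ : J.OrdConnected) {S : Set J}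
    (hS : S.OrdConnected) : IsPreconnected S := by
  rw [← IsInducing.subtypeVal.isPreconnected_image]
  refine Set.OrdConnected.isPreconnected (ordConnected_iff.2 ?_)
  rintro _ ⟨s, hs, rfl⟩ _ ⟨t, ht, rfl⟩ - r hr
  exact ⟨⟨r, hJ.out s.2 t.2 hr⟩, hS.out hs ht ⟨hr.1, hr.2⟩, rfl⟩

end LevelMaps

theorem image_uIoo_of_continuousOn_of_injOn {α β : Type*} [ConditionallyCompleteLinearOrder α]
    [TopologicalSpace α] [OrderTopology α] [DenselyOrdered α] [LinearOrder β] [TopologicalSpace β]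
    [OrderClosedTopology β] {f : α → β} {u v : α} (hf : ContinuousOn f (uIcc u v))
    (hi : InjOn f (uIcc u v)) : f '' uIoo u v = uIoo (f u) (f v) := by
  wlog huv : u ≤ v generalizing u v
  · rw [uIoo_comm u v, uIoo_comm (f u) (f v)]
    exact this (uIcc_comm u v ▸ hf) (uIcc_comm u v ▸ hi) (le_of_not_ge huv)
  rw [uIcc_of_le huv] at hf hi
  have hu := left_mem_Icc.2 huv
  have hv := right_mem_Icc.2 huv
  rw [uIoo_of_le huv]
  rcases hf.strictMonoOn_of_injOn_Icc' huv hi with hm | hm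
  · rw [uIoo_of_le (hm.monotoneOn hu hv huv)]
    refine Subset.antisymm ?_ (intermediate_value_Ioo huv hf)
    rintro _ ⟨x, hx, rfl⟩
    exact ⟨hm hu (Ioo_subset_Icc_self hx) hx.1, hm (Ioo_subset_Icc_self hx) hv hx.2⟩
  · rw [uIoo_of_ge (hm.antitoneOn hu hv huv)]
    refine Subset.antisymm ?_ (intermediate_value_Ioo' huv hf)
    rintro _ ⟨x, hx, rfl⟩
    exact ⟨hm (Ioo_subset_Icc_self hx) hv hx.2, hm hu (Ioo_subset_Icc_self hx) hx.1⟩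

theorem exists_eq_add_mul_sub_of_dist_eq {g : ℝ → ℝ} {a b s : ℝ} (hs : s ∈ Ioo a b)
    (hg : ∀ u ∈ Ioo a b, ∀ v ∈ Ioo a b, dist (g u) (g v) = dist u v) :
    ∃ σ : ℝ, (σ = 1 ∨ σ = -1) ∧ ∀ v ∈ Ioo a b, g v = g s + σ * (v - s) := by
  have hcont : ContinuousOn g (Ioo a b) :=
    (LipschitzOnWith.of_dist_le_mul (K := 1) fun u hu v hv => by simp [hg u hu v hv]).continuousOn
  have hinj : InjOn g (Ioo a b) := fun u hu v hv huv =>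
    dist_eq_zero.1 (by rw [← hg u hu v hv, huv, dist_self])
  have hdist : ∀ v ∈ Ioo a b, |g v - g s| = |v - s| := fun v hv => hg v hv s hs
  rcases hcont.strictMonoOn_of_injOn_Ioo (hs.1.trans hs.2) hinj with hm | hm
  · refine ⟨1, .inl rfl, fun v hv => ?_⟩
    have habs := hdist v hv
    rcases le_total s v with hsv | hvs
    · rw [abs_of_nonneg (sub_nonneg.2 (hm.monotoneOn hs hv hsv)),
        abs_of_nonneg (sub_nonneg.2 hsv)] at habs
      linarith
    · rw [abs_of_nonpos (sub_nonpos.2 (hm.monotoneOn hv hs hvs)),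
        abs_of_nonpos (sub_nonpos.2 hvs)] at habs
      linarith
  · refine ⟨-1, .inr rfl, fun v hv => ?_⟩
    have habs := hdist v hv
    rcases le_total s v with hsv | hvs
    · rw [abs_of_nonpos (sub_nonpos.2 (hm.antitoneOn hs hv hsv)),
        abs_of_nonneg (sub_nonneg.2 hsv)] at habs
      linarith
    · rw [abs_of_nonneg (sub_nonneg.2 (hm.antitoneOn hv hs hvs)),
        abs_of_nonpos (sub_nonpos.2 hvs)] at habs
      linarith

theorem isometry_add_mul_sub {s t σ : ℝ} (hσ : σ = 1 ∨ σ = -1) :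
    Isometry fun y => t + σ * (y - s) := by
  refine Isometry.of_dist_eq fun x y => ?_
  have habs : |σ| = 1 := by rcases hσ with rfl | rfl <;> simp
  rw [dist_add_left, Real.dist_eq, ← mul_sub, abs_mul, habs, one_mul, sub_sub_sub_cancel_right,
    Real.dist_eq]

section UnitSpeed

variable {Z : Type*} [TopologicalSpace Z] [MeasurableSpace Z] {μ : Measure Z}

/-- On `W` the curve `γ` is an embedded arc parametrized by its `μ`-length. -/
structure IsUnitSpeedOn (μ : Measure Z) (γ : ℝ → Z) (W : Set ℝ) : Prop where
  continuousOn : ContinuousOn γ W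
  injOn : InjOn γ W
  measure_image : ∀ u v, uIcc u v ⊆ W → μ (γ '' uIoo u v) = ENNReal.ofReal (dist u v)

/-- Near `s` the curve `γ` is an embedded arc parametrized by its `μ`-length. -/
def IsUnitSpeedAt (μ : Measure Z) (γ : ℝ → Z) (s : ℝ) : Prop :=
  ∃ W ∈ 𝓝 s, IsUnitSpeedOn μ γ W

theorem IsUnitSpeedOn.mono {γ : ℝ → Z} {W W' : Set ℝ} (h : IsUnitSpeedOn μ γ W) (hW : W' ⊆ W) :
    IsUnitSpeedOn μ γ W' :=
  ⟨h.continuousOn.mono hW, h.injOn.mono hW, fun u v huv => h.measure_image u v (huv.trans hW)⟩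

theorem IsUnitSpeedAt.continuousAt {γ : ℝ → Z} {s : ℝ} (h : IsUnitSpeedAt μ γ s) :
    ContinuousAt γ s := by
  obtain ⟨W, hW, h⟩ := h
  exact h.continuousOn.continuousAt hW

theorem IsUnitSpeedAt.congr {γ γ' : ℝ → Z} {s : ℝ} (h : IsUnitSpeedAt μ γ s)
    (he : γ =ᶠ[𝓝 s] γ') : IsUnitSpeedAt μ γ' s := by
  obtain ⟨W, hW, h⟩ := h
  have h' := h.mono (inter_subset_left (t := {x | γ x = γ' x}))
  have heq : EqOn γ γ' (W ∩ {x | γ x = γ' x}) := fun x hx => hx.2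
  refine ⟨_, inter_mem hW he, h'.continuousOn.congr heq.symm, h'.injOn.congr heq,
    fun u v huv => ?_⟩
  rw [← h'.measure_image u v huv]
  exact congrArg _ (image_congr fun x hx => (heq (huv (uIoo_subset_uIcc_self hx))).symm)

theorem IsUnitSpeedAt.comp_isometry {γ : ℝ → Z} {φ : ℝ → ℝ} (hφ : Isometry φ) {x : ℝ}
    (h : IsUnitSpeedAt μ γ (φ x)) : IsUnitSpeedAt μ (fun y => γ (φ y)) x := by
  obtain ⟨W, hW, h⟩ := h
  have hcont := hφ.continuous
  refine ⟨_, hcont.continuousAt hW, h.continuousOn.comp hcont.continuousOn (mapsTo_preimage _ _),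
    h.injOn.comp hφ.injective.injOn (mapsTo_preimage _ _), fun u v huv => ?_⟩
  have hsub : uIcc (φ u) (φ v) ⊆ W :=
    (intermediate_value_uIcc hcont.continuousOn).trans (image_subset_iff.2 huv)
  rw [← hφ.dist_eq u v, ← h.measure_image _ _ hsub,
    ← image_uIoo_of_continuousOn_of_injOn hcont.continuousOn hφ.injective.injOn, image_image]

/-- The `μ`-length coordinate of a chart. -/
noncomputable def chartLength (μ : Measure Z) (c : ℝ → Z) (x : ℝ) : ℝ :=
  ∫ _ in (0 : ℝ)..x, (1 : ℝ) ∂(μ.comap c)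

variable [BorelSpace Z] [NullSingletonClass μ] {c : ℝ → Z}

theorem nullSingletonClass_comap (hc : IsOpenEmbedding c) : NullSingletonClass (μ.comap c) := by
  refine ⟨fun x => ?_⟩
  rw [hc.measurableEmbedding.comap_apply, image_singleton]
  exact measure_singleton _

variable [IsFiniteMeasure μ]

theorem continuous_chartLength (hc : IsOpenEmbedding c) : Continuous (chartLength μ c) := by
  have := nullSingletonClass_comap (μ := μ) hc
  exact intervalIntegral.continuous_primitive (fun a b => intervalIntegrable_const) 0

theorem chartLength_sub (hc : IsOpenEmbedding c) {a b : ℝ} (hab : a ≤ b) :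
    chartLength μ c b - chartLength μ c a = μ.real (c '' Ioo a b) := by
  have := nullSingletonClass_comap (μ := μ) hc
  rw [chartLength, chartLength, intervalIntegral.integral_interval_sub_left
    intervalIntegrable_const intervalIntegrable_const, intervalIntegral.integral_const',
    Ioc_eq_empty hab.not_gt, measureReal_empty, sub_zero, smul_eq_mul, mul_one,
    ← measureReal_congr (Ioo_ae_eq_Ioc (α := ℝ)), measureReal_def,
    hc.measurableEmbedding.comap_apply, measureReal_def]

theorem measure_image_uIoo (hc : IsOpenEmbedding c) (a b : ℝ) :
    μ (c '' uIoo a b) = ENNReal.ofReal (dist (chartLength μ c a) (chartLength μ c b)) := by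
  wlog hab : a ≤ b generalizing a b
  · rw [uIoo_comm, dist_comm]
    exact this b a (le_of_not_ge hab)
  rw [uIoo_of_le hab, dist_comm, Real.dist_eq, chartLength_sub hc hab,
    abs_of_nonneg measureReal_nonneg, ofReal_measureReal]

theorem isUnitSpeedAt_of_dist_chartLength (hc : IsOpenEmbedding c) {f : ℝ → ℝ} {s : ℝ} {W : Set ℝ}
    (hW : W ∈ 𝓝 s) (hf : ContinuousOn f W)
    (hd : ∀ u ∈ W, ∀ v ∈ W, dist (chartLength μ c (f u)) (chartLength μ c (f v)) = dist u v) :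
    IsUnitSpeedAt μ (fun v => c (f v)) s := by
  have hinj : InjOn f W := fun u hu v hv huv =>
    dist_eq_zero.1 (by rw [← hd u hu v hv, huv, dist_self])
  refine ⟨W, hW, hc.continuous.comp_continuousOn hf, hc.injective.comp_injOn hinj,
    fun u v huv => ?_⟩
  rw [← image_image c f, image_uIoo_of_continuousOn_of_injOn (hf.mono huv) (hinj.mono huv),
    measure_image_uIoo hc, hd u (huv left_mem_uIcc) v (huv right_mem_uIcc)]

variable [μ.IsOpenPosMeasure]

theorem strictMono_chartLength (hc : IsOpenEmbedding c) : StrictMono (chartLength μ c) := by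
  intro a b hab
  have hpos : 0 < μ.real (c '' Ioo a b) := ENNReal.toReal_pos
    ((hc.isOpenMap _ isOpen_Ioo).measure_pos μ ((nonempty_Ioo.2 hab).image c)).ne'
    (measure_ne_top _ _)
  rw [← chartLength_sub hc hab.le] at hpos
  exact sub_pos.1 hpos

theorem isOpenEmbedding_chartLength (hc : IsOpenEmbedding c) :
    IsOpenEmbedding (chartLength μ c) := by
  have hmono : StrictMono (chartLength μ c) := strictMono_chartLength hc
  have hrange := (isPreconnected_range (continuous_chartLength (μ := μ) hc)).ordConnected
  refine ⟨hmono.isEmbedding_of_ordConnected hrange, isOpen_iff_mem_nhds.2 ?_⟩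
  rintro _ ⟨y, rfl⟩
  exact mem_of_superset (Icc_mem_nhds (hmono (sub_one_lt y)) (hmono (lt_add_one y)))
    (hrange.out ⟨_, rfl⟩ ⟨_, rfl⟩)

omit [μ.IsOpenPosMeasure] in
theorem IsUnitSpeedAt.exists_lift (hc : IsOpenEmbedding c) {γ : ℝ → Z} {s x : ℝ}
    (h : IsUnitSpeedAt μ γ s) (hx : c x = γ s) :
    ∃ σ : ℝ, (σ = 1 ∨ σ = -1) ∧ ∃ f : ℝ → ℝ, ∀ᶠ v in 𝓝 s, c (f v) = γ v ∧
      chartLength μ c (f v) = chartLength μ c x + σ * (v - s) := by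
  have hrange : γ ⁻¹' range c ∈ 𝓝 s :=
    h.continuousAt (hc.isOpen_range.mem_nhds ⟨x, hx⟩)
  obtain ⟨W, hW, h⟩ := h
  obtain ⟨a, b, hs, hsub⟩ := mem_nhds_iff_exists_Ioo_subset.1 (inter_mem hW hrange)
  obtain ⟨hcont, hinj, hμ⟩ := h.mono (hsub.trans inter_subset_left)
  replace hsub : Ioo a b ⊆ γ ⁻¹' range c := hsub.trans inter_subset_right
  let e := hc.toOpenPartialHomeomorph c
  have hcf : ∀ v ∈ Ioo a b, c (e.symm (γ v)) = γ v := fun v hv =>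
    hc.toOpenPartialHomeomorph_right_inv c (hsub hv)
  have hfs : e.symm (γ s) = x := hc.injective ((hcf s hs).trans hx.symm)
  have hf : ContinuousOn (fun v => e.symm (γ v)) (Ioo a b) :=
    e.continuousOn_symm.comp hcont fun v hv => by simpa [e] using hsub hv
  have hfi : InjOn (fun v => e.symm (γ v)) (Ioo a b) := fun u hu v hv huv =>
    hinj hu hv (by rw [← hcf u hu, ← hcf v hv]; exact congrArg c huv)
  have hdist : ∀ u ∈ Ioo a b, ∀ v ∈ Ioo a b,
      dist (chartLength μ c (e.symm (γ u))) (chartLength μ c (e.symm (γ v))) = dist u v := by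
    intro u hu v hv
    have huv : uIcc u v ⊆ Ioo a b := ordConnected_Ioo.uIcc_subset hu hv
    have himage : γ '' uIoo u v = c '' uIoo (e.symm (γ u)) (e.symm (γ v)) := by
      rw [← image_uIoo_of_continuousOn_of_injOn (hf.mono huv) (hfi.mono huv), image_image]
      exact image_congr fun w hw => (hcf w (huv (uIoo_subset_uIcc_self hw))).symm
    have hlen := hμ u v huv
    rw [himage, measure_image_uIoo hc] at hlen
    exact (ENNReal.ofReal_eq_ofReal_iff dist_nonneg dist_nonneg).1 hlen
  obtain ⟨σ, hσ, hlift⟩ := exists_eq_add_mul_sub_of_dist_eq hs hdist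
  refine ⟨σ, hσ, fun v => e.symm (γ v), ?_⟩
  filter_upwards [Ioo_mem_nhds hs.1 hs.2] with v hv
  exact ⟨hcf v hv, by rw [hlift v hv, hfs]⟩

theorem IsUnitSpeedAt.eventuallyEq (hc : IsOpenEmbedding c) {γ₁ γ₂ : ℝ → Z} {s t : ℝ}
    (h₁ : IsUnitSpeedAt μ γ₁ s) (h₂ : IsUnitSpeedAt μ γ₂ t) (h : γ₁ s = γ₂ t)
    (hs : γ₁ s ∈ range c) :
    ∃ σ : ℝ, (σ = 1 ∨ σ = -1) ∧ ∀ᶠ v in 𝓝 s, γ₁ v = γ₂ (t + σ * (v - s)) := by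
  obtain ⟨x, hx⟩ := hs
  obtain ⟨σ₁, hσ₁, f₁, hf₁⟩ := h₁.exists_lift hc hx
  obtain ⟨σ₂, hσ₂, f₂, hf₂⟩ := h₂.exists_lift hc (hx.trans h)
  have hcont : Tendsto (fun v => t + σ₁ * σ₂ * (v - s)) (𝓝 s) (𝓝 t) := by
    have : Continuous fun v => t + σ₁ * σ₂ * (v - s) := by fun_prop
    simpa using this.tendsto s
  refine ⟨σ₁ * σ₂, ?_, ?_⟩
  · rcases hσ₁ with rfl | rfl <;> rcases hσ₂ with rfl | rfl <;> simp
  · filter_upwards [hf₁, hcont.eventually hf₂] with v hv hw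
    rw [← hv.1, ← hw.1]
    congr 1
    apply (strictMono_chartLength (μ := μ) hc).injective
    rw [hv.2, hw.2]
    rcases hσ₂ with rfl | rfl <;> ring

theorem exists_unitSpeed (hc : IsOpenEmbedding c) (x : ℝ) : ∃ g : ℝ → Z, ∃ r > 0, g 0 = c x ∧
    (∀ s ∈ Ioo (-r) r, IsUnitSpeedAt μ g s) ∧ ∀ W ∈ 𝓝 (0 : ℝ), g '' W ∈ 𝓝 (c x) := by
  have hN : IsOpenEmbedding (chartLength μ c) := isOpenEmbedding_chartLength hc
  let e := hN.toOpenPartialHomeomorph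
  have hleft : ∀ y, e.symm (chartLength μ c y) = y := fun y =>
    hN.toOpenPartialHomeomorph_left_inv _
  let D : Set ℝ := {v | chartLength μ c x + v ∈ range (chartLength μ c)}
  have hright : ∀ v ∈ D, chartLength μ c (e.symm (chartLength μ c x + v)) = chartLength μ c x + v :=
    fun v hv => hN.toOpenPartialHomeomorph_right_inv _ hv
  have hD : IsOpen D := hN.isOpen_range.preimage (by fun_prop)
  obtain ⟨r, hr, hrD⟩ := Metric.mem_nhds_iff.1 (hD.mem_nhds (show (0 : ℝ) ∈ D from ⟨x, by simp⟩))
  rw [Real.ball_eq_Ioo, zero_sub, zero_add] at hrD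
  refine ⟨fun v => c (e.symm (chartLength μ c x + v)), r, hr, by simp [hleft], fun s hs => ?_,
    fun W hW => ?_⟩
  · refine isUnitSpeedAt_of_dist_chartLength hc (hD.mem_nhds (hrD hs)) ?_ fun u hu v hv => ?_
    · exact e.continuousOn_symm.comp (by fun_prop) fun v hv => by simpa [e, D] using hv
    · rw [hright u hu, hright v hv, dist_add_left]
  · have hnear : {y | chartLength μ c y - chartLength μ c x ∈ W} ∈ 𝓝 x :=
      ((continuous_chartLength hc).sub continuous_const).continuousAt (by simpa using hW)
    refine mem_of_superset (hc.isOpenMap.image_mem_nhds hnear) ?_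
    rintro _ ⟨y, hy, rfl⟩
    exact ⟨_, hy, by simp [hleft]⟩

end UnitSpeed

section OneManifolds

theorem exists_isOpenEmbedding_range_eq_Ioo {a b : ℝ} (hab : a < b) :
    ∃ k : ℝ → ℝ, IsOpenEmbedding k ∧ range k = Ioo a b := by
  let e := OpenPartialHomeomorph.univBall (E := ℝ) ((a + b) / 2) ((b - a) / 2)
  have hr : 0 < (b - a) / 2 := by linarith
  refine ⟨e, e.isOpenEmbedding (OpenPartialHomeomorph.univBall_source _ _), ?_⟩
  rw [← image_univ, ← OpenPartialHomeomorph.univBall_source ((a + b) / 2) ((b - a) / 2),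
    e.image_source_eq_target, OpenPartialHomeomorph.univBall_target _ hr, Real.ball_eq_Ioo]
  congr 1 <;> ring

theorem eq_Ioo_csInf_csSup_of_isOpen {D : Set ℝ} (ho : IsOpen D) (hD : IsConnected D)
    (hb : BddBelow D) (ha : BddAbove D) : D = Ioo (sInf D) (sSup D) := by
  refine Subset.antisymm (fun x hx => ?_) (hD.Ioo_csInf_csSup_subset hb ha)
  obtain ⟨l, u, hlu, hsub⟩ := mem_nhds_iff_exists_Ioo_subset.1 (ho.mem_nhds hx)
  obtain ⟨y, hly, hyx⟩ := exists_between hlu.1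
  obtain ⟨z, hxz, hzu⟩ := exists_between hlu.2
  exact ⟨(csInf_le hb (hsub ⟨hly, hyx.trans hlu.2⟩)).trans_lt hyx,
    hxz.trans_le (le_csSup ha (hsub ⟨hlu.1.trans hxz, hzu⟩))⟩

theorem isOpenEmbedding_sigmoid : IsOpenEmbedding Real.sigmoid := by
  have hrange : range Real.sigmoid = Ioo 0 1 := Real.range_sigmoid
  exact ⟨Real.sigmoid_strictMono.isEmbedding_of_ordConnected (hrange ▸ ordConnected_Ioo),
    hrange ▸ isOpen_Ioo⟩

theorem exists_isOpenEmbedding_range_eq {D : Set ℝ} (ho : IsOpen D) (hD : IsConnected D) :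
    ∃ k : ℝ → ℝ, IsOpenEmbedding k ∧ range k = D := by
  have hsub : Real.sigmoid '' D ⊆ Ioo 0 1 := Real.range_sigmoid ▸ image_subset_range _ _
  have hIoo := eq_Ioo_csInf_csSup_of_isOpen (isOpenEmbedding_sigmoid.isOpenMap _ ho)
    (hD.image _ continuous_sigmoid.continuousOn) (bddBelow_Ioo.mono hsub) (bddAbove_Ioo.mono hsub)
  have hlt := nonempty_Ioo.1 (hIoo ▸ hD.nonempty.image Real.sigmoid)
  obtain ⟨k, hk, hrange⟩ := exists_isOpenEmbedding_range_eq_Ioo hlt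
  rw [← hIoo] at hrange
  have hlift : Real.sigmoid ∘ logit ∘ k = k :=
    funext fun x => sigmoid_logit (hsub (hrange ▸ mem_range_self x))
  refine ⟨logit ∘ k, .of_comp _ isOpenEmbedding_sigmoid (hlift.symm ▸ hk), ?_⟩
  rw [range_comp, hrange, image_image]
  simp only [logit_sigmoid, image_id']

/-- A one-manifold without boundary, as far as charts are concerned: every point lies in an open
copy of the line. -/
def HasLineCharts (Z : Type*) [TopologicalSpace Z] : Prop :=
  ∀ z : Z, ∃ c : ℝ → Z, IsOpenEmbedding c ∧ z ∈ range c

theorem HasLineCharts.exists_isFiniteMeasure {Z : Type*} [TopologicalSpace Z] [T1Space Z]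
    [SecondCountableTopology Z] [MeasurableSpace Z] [BorelSpace Z] (h : HasLineCharts Z) :
    ∃ μ : Measure Z, IsFiniteMeasure μ ∧ NullSingletonClass μ ∧ μ.IsOpenPosMeasure := by
  choose c hc hz using h
  obtain ⟨S, hS, hSu⟩ := TopologicalSpace.countable_cover_nhds
    fun z => (hc z).isOpen_range.mem_nhds (hz z)
  have := hS.to_subtype
  obtain ⟨w, hw, hws⟩ := ENNReal.exists_pos_sum_of_countable' one_ne_zero S
  let ν : Measure ℝ := (volume : Measure ℝ).toFinite
  have hmap : ∀ z (A : Set Z), MeasurableSet A → ν.map (c z) A = ν (c z ⁻¹' A) := fun z A hA =>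
    Measure.map_apply (hc z).continuous.measurable hA
  refine ⟨Measure.sum fun z : S => w z • ν.map (c z), ⟨?_⟩, ⟨fun z => ?_⟩, ⟨fun U hU hne h0 => ?_⟩⟩
  · rw [Measure.sum_apply _ MeasurableSet.univ]
    simp only [Measure.smul_apply, smul_eq_mul, hmap _ _ MeasurableSet.univ, preimage_univ]
    rw [ENNReal.tsum_mul_right]
    exact ENNReal.mul_lt_top (hws.trans ENNReal.one_lt_top) (measure_lt_top _ _)
  · rw [Measure.sum_apply _ (measurableSet_singleton z), ENNReal.tsum_eq_zero]
    intro y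
    have hnull : ν (c y ⁻¹' {z}) = 0 := toFinite_absolutelyContinuous _
      ((subsingleton_singleton.preimage (hc y).injective).measure_zero _)
    rw [Measure.smul_apply, hmap _ _ (measurableSet_singleton z), hnull, smul_zero]
  · rw [Measure.sum_apply _ hU.measurableSet, ENNReal.tsum_eq_zero] at h0
    obtain ⟨z, hzU⟩ := hne
    obtain ⟨y, hyS, x, rfl⟩ := mem_iUnion₂.1 (hSu ▸ mem_univ z)
    have hν := h0 ⟨y, hyS⟩
    rw [Measure.smul_apply, smul_eq_mul, hmap _ _ hU.measurableSet, mul_eq_zero] at hν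
    have hvol : volume (c y ⁻¹' U) = 0 :=
      absolutelyContinuous_toFinite _ (hν.resolve_left (hw _).ne')
    exact ((hU.preimage (hc y).continuous).measure_pos volume ⟨x, hzU⟩).ne' hvol

section Classification

variable {Z : Type*} [TopologicalSpace Z] [MeasurableSpace Z] [BorelSpace Z]
  {μ : Measure Z} [IsFiniteMeasure μ] [NullSingletonClass μ] [μ.IsOpenPosMeasure]

theorem IsUnitSpeedAt.eventuallyEq_of_isPreconnected [T2Space Z] (hch : HasLineCharts Z)
    {γ₁ γ₂ : ℝ → Z} {I : Set ℝ} (hI : IsPreconnected I)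
    (h₁ : ∀ s ∈ I, IsUnitSpeedAt μ γ₁ s) (h₂ : ∀ s ∈ I, IsUnitSpeedAt μ γ₂ s)
    {s : ℝ} (hs : s ∈ I) (he : γ₁ =ᶠ[𝓝 s] γ₂) : ∀ x ∈ I, γ₁ =ᶠ[𝓝 x] γ₂ := by
  refine hI.subset_of_closure_inter_subset (u := {x | γ₁ =ᶠ[𝓝 x] γ₂})
    isOpen_setOfPred_eventually_nhds ⟨s, hs, he⟩ ?_
  rintro x ⟨hxW, hxI⟩
  have hfreq := mem_closure_iff_frequently.1 hxW
  have hx : γ₁ x = γ₂ x :=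
    tendsto_nhds_unique_of_frequently_eq (h₁ x hxI).continuousAt (h₂ x hxI).continuousAt
      (hfreq.mono fun y hy => EventuallyEq.eq_of_nhds hy)
  obtain ⟨c, hc, hcx⟩ := hch (γ₁ x)
  obtain ⟨σ, rfl | rfl, hev⟩ := (h₁ x hxI).eventuallyEq hc (h₂ x hxI) hx hcx
  · filter_upwards [hev] with v hv
    rw [hv, one_mul, add_sub_cancel]
  · obtain ⟨V, hV, hV₂⟩ := h₂ x hxI
    have hreflect : ∀ᶠ v in 𝓝 x, x + -1 * (v - x) ∈ V := by
      have : Continuous fun v => x + -1 * (v - x) := by fun_prop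
      exact this.continuousAt (by simpa using hV)
    obtain ⟨w, hw, hwe, hwV', hwV⟩ := (hfreq.and_eventually (hev.and (hreflect.and hV))).exists
    have hfix : w = x + -1 * (w - x) :=
      hV₂.injOn hwV hwV' ((EventuallyEq.eq_of_nhds hw).symm.trans hwe)
    have : w = x := by linarith
    exact this ▸ hw

theorem IsUnitSpeedAt.image_mem_nhds (hch : HasLineCharts Z) {γ : ℝ → Z} {s : ℝ}
    (h : IsUnitSpeedAt μ γ s) {W : Set ℝ} (hW : W ∈ 𝓝 s) : γ '' W ∈ 𝓝 (γ s) := by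
  obtain ⟨c, hc, x, hx⟩ := hch (γ s)
  obtain ⟨g, r, hr, hg0, hg, hgn⟩ := exists_unitSpeed (μ := μ) hc x
  obtain ⟨σ, -, hev⟩ := (hg 0 ⟨neg_lt_zero.2 hr, hr⟩).eventuallyEq hc h (hg0.trans hx) ⟨x, hg0.symm⟩
  have hcont : Tendsto (fun v => s + σ * (v - 0)) (𝓝 0) (𝓝 s) := by
    have : Continuous fun v : ℝ => s + σ * (v - 0) := by fun_prop
    simpa using this.tendsto 0
  rw [← hx]
  refine mem_of_superset (hgn _ (hev.and (hcont hW))) ?_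
  rintro _ ⟨v, ⟨hv, hvW⟩, rfl⟩
  exact ⟨_, hvW, hv.symm⟩

/-- `γ` is a unit speed curve on the open interval `I` with the same germ at `0` as `g`. -/
structure IsUnitSpeedExtension (μ : Measure Z) (g γ : ℝ → Z) (I : Set ℝ) : Prop where
  isOpen : IsOpen I
  isPreconnected : IsPreconnected I
  zero_mem : 0 ∈ I
  isUnitSpeedAt : ∀ s ∈ I, IsUnitSpeedAt μ γ s
  eventuallyEq : γ =ᶠ[𝓝 0] g

theorem IsUnitSpeedExtension.eqOn [T2Space Z] (hch : HasLineCharts Z) {g γ₁ γ₂ : ℝ → Z}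
    {I₁ I₂ : Set ℝ} (h₁ : IsUnitSpeedExtension μ g γ₁ I₁) (h₂ : IsUnitSpeedExtension μ g γ₂ I₂) :
    EqOn γ₁ γ₂ (I₁ ∩ I₂) := fun s hs =>
  (IsUnitSpeedAt.eventuallyEq_of_isPreconnected hch
    (h₁.isPreconnected.ordConnected.inter h₂.isPreconnected.ordConnected).isPreconnected
    (fun x hx => h₁.isUnitSpeedAt x hx.1) (fun x hx => h₂.isUnitSpeedAt x hx.2)
    ⟨h₁.zero_mem, h₂.zero_mem⟩ (h₁.eventuallyEq.trans h₂.eventuallyEq.symm) s hs).eq_of_nhds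

theorem IsUnitSpeedExtension.exists_greatest [T2Space Z] (hch : HasLineCharts Z) {g γ₀ : ℝ → Z}
    {I₀ : Set ℝ} (h₀ : IsUnitSpeedExtension μ g γ₀ I₀) :
    ∃ Γ D, IsUnitSpeedExtension μ g Γ D ∧ ∀ γ I, IsUnitSpeedExtension μ g γ I → I ⊆ D := by
  let D : Set ℝ := ⋃₀ {I | ∃ γ, IsUnitSpeedExtension μ g γ I}
  have hsub : ∀ γ I, IsUnitSpeedExtension μ g γ I → I ⊆ D := fun γ I h =>
    subset_sUnion_of_mem ⟨γ, h⟩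
  have hex : ∀ s ∈ D, ∃ γ I, IsUnitSpeedExtension μ g γ I ∧ s ∈ I := by
    rintro s ⟨I, ⟨γ, hγ⟩, hs⟩
    exact ⟨γ, I, hγ, hs⟩
  have : Nonempty Z := ⟨γ₀ 0⟩
  choose! G J hG hJ using hex
  have hΓ : ∀ γ I, IsUnitSpeedExtension μ g γ I → ∀ s ∈ I, γ =ᶠ[𝓝 s] fun s => G s s := by
    intro γ I h s hs
    filter_upwards [h.isOpen.mem_nhds hs] with x hx
    exact h.eqOn hch (hG x (hsub γ I h hx)) ⟨hx, hJ x (hsub γ I h hx)⟩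
  refine ⟨fun s => G s s, D, ⟨isOpen_sUnion ?_, isPreconnected_sUnion 0 _ ?_ ?_,
    hsub _ _ h₀ h₀.zero_mem, fun s hs => ?_, ?_⟩, hsub⟩
  · rintro I ⟨γ, h⟩
    exact h.isOpen
  · rintro I ⟨γ, h⟩
    exact h.zero_mem
  · rintro I ⟨γ, h⟩
    exact h.isPreconnected
  · exact ((hG s hs).isUnitSpeedAt s (hJ s hs)).congr (hΓ _ _ (hG s hs) s (hJ s hs))
  · exact (hΓ _ _ h₀ 0 h₀.zero_mem).symm.trans h₀.eventuallyEq

omit [BorelSpace Z] [IsFiniteMeasure μ] [NullSingletonClass μ] [μ.IsOpenPosMeasure] in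
theorem IsUnitSpeedExtension.exists_union {g Γ k : ℝ → Z} {D I : Set ℝ} {s : ℝ}
    (h : IsUnitSpeedExtension μ g Γ D) (hI : IsOpen I) (hIc : IsPreconnected I)
    (hk : ∀ y ∈ I, IsUnitSpeedAt μ k y) (hs : s ∈ D) (hsI : s ∈ I) (he : EqOn Γ k (D ∩ I)) :
    ∃ γ, IsUnitSpeedExtension μ g γ (D ∪ I) := by
  classical
  have hD : ∀ y ∈ D, Γ =ᶠ[𝓝 y] D.piecewise Γ k := fun y hy => by
    filter_upwards [h.isOpen.mem_nhds hy] with v hv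
    exact (piecewise_eq_of_mem D _ _ hv).symm
  have hkI : ∀ y ∈ I, k =ᶠ[𝓝 y] D.piecewise Γ k := fun y hy => by
    filter_upwards [hI.mem_nhds hy] with v hv
    by_cases hvD : v ∈ D
    · rw [piecewise_eq_of_mem D _ _ hvD, he ⟨hvD, hv⟩]
    · rw [piecewise_eq_of_notMem D _ _ hvD]
  refine ⟨D.piecewise Γ k, h.isOpen.union hI, h.isPreconnected.union s hs hsI hIc,
    .inl h.zero_mem, ?_, (hD 0 h.zero_mem).symm.trans h.eventuallyEq⟩
  rintro y (hy | hy)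
  · exact (h.isUnitSpeedAt y hy).congr (hD y hy)
  · exact (hk y hy).congr (hkI y hy)

theorem IsUnitSpeedExtension.isClosed_image [T2Space Z] (hch : HasLineCharts Z) {g Γ : ℝ → Z}
    {D : Set ℝ} (h : IsUnitSpeedExtension μ g Γ D)
    (hmax : ∀ γ I, IsUnitSpeedExtension μ g γ I → I ⊆ D) : IsClosed (Γ '' D) := by
  refine isClosed_of_closure_subset fun y hy => ?_
  obtain ⟨c, hc, x, rfl⟩ := hch y
  obtain ⟨f, r, hr, hf0, hf, hfn⟩ := exists_unitSpeed (μ := μ) hc x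
  have h0 : (0 : ℝ) ∈ Ioo (-r) r := ⟨neg_lt_zero.2 hr, hr⟩
  obtain ⟨_, ⟨⟨u, hu, rfl⟩, huc⟩, s, hs, hsu⟩ := mem_closure_iff_nhds.1 hy _
    (inter_mem (hfn _ (Ioo_mem_nhds h0.1 h0.2)) (hc.isOpen_range.mem_nhds ⟨x, rfl⟩))
  obtain ⟨σ, hσ, hev⟩ := (h.isUnitSpeedAt s hs).eventuallyEq hc (hf u hu) hsu (hsu ▸ huc)
  let φ : ℝ → ℝ := fun y => u + σ * (y - s)
  have hφ : Isometry φ := isometry_add_mul_sub hσ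
  have hφφ : ∀ y, φ (s + σ * (y - u)) = y := fun y => by
    rcases hσ with rfl | rfl <;> simp [φ]
  have hsI : s ∈ φ ⁻¹' Ioo (-r) r := by simpa [φ] using hu
  have hIo : IsOpen (φ ⁻¹' Ioo (-r) r) := isOpen_Ioo.preimage hφ.continuous
  have hIc : IsPreconnected (φ ⁻¹' Ioo (-r) r) := by
    refine OrdConnected.isPreconnected ⟨fun a ha b hb y hy => ?_⟩
    obtain ⟨ha₁, ha₂⟩ := ha
    obtain ⟨hb₁, hb₂⟩ := hb
    obtain ⟨hy₁, hy₂⟩ := hy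
    rcases hσ with rfl | rfl <;> constructor <;> simp only [φ] at * <;> linarith
  have hk : ∀ y ∈ φ ⁻¹' Ioo (-r) r, IsUnitSpeedAt μ (f ∘ φ) y := fun y hy =>
    (hf _ hy).comp_isometry hφ
  have heq : EqOn Γ (f ∘ φ) (D ∩ φ ⁻¹' Ioo (-r) r) := fun y hy =>
    (IsUnitSpeedAt.eventuallyEq_of_isPreconnected hch
      (h.isPreconnected.ordConnected.inter hIc.ordConnected).isPreconnected
      (fun y hy => h.isUnitSpeedAt y hy.1) (fun y hy => hk y hy.2) ⟨hs, hsI⟩ hev y hy).eq_of_nhds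
  obtain ⟨γ, hγ⟩ := h.exists_union hIo hIc hk hs hsI heq
  have hzero : s + σ * (0 - u) ∈ φ ⁻¹' Ioo (-r) r := by rwa [mem_preimage, hφφ]
  refine ⟨_, hmax _ _ hγ (.inr hzero), ?_⟩
  rw [heq ⟨hmax _ _ hγ (.inr hzero), hzero⟩, Function.comp_apply, hφφ, hf0]

theorem exists_isUnitSpeedAt_surjOn [T2Space Z] [ConnectedSpace Z] (hch : HasLineCharts Z) :
    ∃ (Γ : ℝ → Z) (D : Set ℝ), IsOpen D ∧ IsConnected D ∧
      (∀ s ∈ D, IsUnitSpeedAt μ Γ s) ∧ SurjOn Γ D univ := by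
  obtain ⟨z⟩ : Nonempty Z := inferInstance
  obtain ⟨c, hc, x, rfl⟩ := hch z
  obtain ⟨g, r, hr, -, hg, -⟩ := exists_unitSpeed (μ := μ) hc x
  have hgI : IsUnitSpeedExtension μ g g (Ioo (-r) r) :=
    ⟨isOpen_Ioo, isPreconnected_Ioo, ⟨neg_lt_zero.2 hr, hr⟩, hg, .rfl⟩
  obtain ⟨Γ, D, h, hmax⟩ := hgI.exists_greatest hch
  refine ⟨Γ, D, h.isOpen, ⟨⟨0, h.zero_mem⟩, h.isPreconnected⟩, h.isUnitSpeedAt, ?_⟩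
  have hopen : IsOpen (Γ '' D) := by
    rw [isOpen_iff_mem_nhds]
    rintro _ ⟨s, hs, rfl⟩
    exact (h.isUnitSpeedAt s hs).image_mem_nhds hch (h.isOpen.mem_nhds hs)
  exact (IsClopen.eq_univ ⟨h.isClosed_image hch hmax, hopen⟩ ⟨Γ 0, 0, h.zero_mem, rfl⟩).ge

omit [BorelSpace Z] [IsFiniteMeasure μ] [NullSingletonClass μ] [μ.IsOpenPosMeasure] in
theorem isCompact_chords [T2Space Z] {Γ : ℝ → Z} {a b : ℝ}
    (hΓ : ∀ s ∈ Icc a b, IsUnitSpeedAt μ Γ s) :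
    IsCompact {q : ℝ × ℝ | q ∈ Icc a b ×ˢ Icc a b ∧ q.1 < q.2 ∧ Γ q.1 = Γ q.2} := by
  have hsquare : IsCompact (Icc a b ×ˢ Icc a b) := isCompact_Icc.prod isCompact_Icc
  refine hsquare.of_isClosed_subset (isClosed_of_closure_subset fun q hq => ?_) fun q hq => hq.1
  have hqI : q ∈ Icc a b ×ˢ Icc a b :=
    hsquare.isClosed.closure_subset_iff.2 (fun q hq => hq.1) hq
  have hfreq := mem_closure_iff_frequently.1 hq
  have hle : q.1 ≤ q.2 :=
    (isClosed_le continuous_fst continuous_snd).closure_subset_iff.2 (fun q hq => hq.2.1.le) hq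
  have heq : Γ q.1 = Γ q.2 := tendsto_nhds_unique_of_frequently_eq
    ((hΓ _ hqI.1).continuousAt.tendsto.comp continuous_fst.continuousAt)
    ((hΓ _ hqI.2).continuousAt.tendsto.comp continuous_snd.continuousAt)
    (hfreq.mono fun x hx => hx.2.2)
  refine ⟨hqI, lt_of_le_of_ne hle fun hdiag => ?_, heq⟩
  obtain ⟨W, hW, hWi⟩ := hΓ _ hqI.1
  have hfst : ∀ᶠ x : ℝ × ℝ in 𝓝 q, x.1 ∈ W := continuous_fst.continuousAt.eventually hW
  have hsnd : ∀ᶠ x : ℝ × ℝ in 𝓝 q, x.2 ∈ W :=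
    continuous_snd.continuousAt.eventually (hdiag ▸ hW)
  obtain ⟨x, hx, hx₁, hx₂⟩ := (hfreq.and_eventually (hfst.and hsnd)).exists
  exact hx.2.1.ne (hWi.injOn hx₁ hx₂ hx.2.2)

omit [BorelSpace Z] [IsFiniteMeasure μ] [NullSingletonClass μ] [μ.IsOpenPosMeasure] in
theorem exists_shortest_chord [T2Space Z] {Γ : ℝ → Z} {D : Set ℝ} (hD : D.OrdConnected)
    (hΓ : ∀ s ∈ D, IsUnitSpeedAt μ Γ s) (hinj : ¬ InjOn Γ D) :
    ∃ s r, s < r ∧ Icc s r ⊆ D ∧ Γ s = Γ r ∧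
      ∀ u ∈ Icc s r, ∀ v ∈ Icc s r, u < v → Γ u = Γ v → r - s ≤ v - u := by
  obtain ⟨a, ha, b, hb, hab, hΓab⟩ : ∃ a ∈ D, ∃ b ∈ D, a < b ∧ Γ a = Γ b := by
    simp only [InjOn, not_forall] at hinj
    obtain ⟨a, ha, b, hb, h, hne⟩ := hinj
    rcases lt_or_gt_of_ne hne with hlt | hlt
    · exact ⟨a, ha, b, hb, hlt, h⟩
    · exact ⟨b, hb, a, ha, hlt, h.symm⟩
  have habD : Icc a b ⊆ D := hD.out ha hb
  obtain ⟨⟨s, r⟩, ⟨hsr, hlt, heq⟩, hmin⟩ :=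
    (isCompact_chords fun s hs => hΓ s (habD hs)).exists_isMinOn
      ⟨(a, b), ⟨left_mem_Icc.2 hab.le, right_mem_Icc.2 hab.le⟩, hab, hΓab⟩
      (f := fun q => q.2 - q.1) (by fun_prop)
  have hsub : Icc s r ⊆ Icc a b := Icc_subset_Icc hsr.1.1 hsr.2.2
  exact ⟨s, r, hlt, hsub.trans habD, heq, fun u hu v hv huv h =>
    isMinOn_iff.1 hmin (u, v) ⟨⟨hsub hu, hsub hv⟩, huv, h⟩⟩

-- Were the two germs at the ends of a shortest chord traversed in opposite directions, nearby
-- points would span a shorter chord.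
theorem eventuallyEq_of_shortest_chord (hch : HasLineCharts Z) {Γ : ℝ → Z} {s r : ℝ} (hlt : s < r)
    (hs : IsUnitSpeedAt μ Γ s) (hr : IsUnitSpeedAt μ Γ r) (heq : Γ s = Γ r)
    (hmin : ∀ u ∈ Icc s r, ∀ v ∈ Icc s r, u < v → Γ u = Γ v → r - s ≤ v - u) :
    ∀ᶠ v in 𝓝 s, Γ v = Γ (r + (v - s)) := by
  obtain ⟨c, hc, hcs⟩ := hch (Γ s)
  obtain ⟨σ, rfl | rfl, hev⟩ := hs.eventuallyEq hc hr heq hcs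
  · simpa only [one_mul] using hev
  · have hleft : ∀ᶠ v in 𝓝[>] s, v < (s + r) / 2 :=
      mem_nhdsWithin_of_mem_nhds (Iio_mem_nhds (by linarith))
    obtain ⟨v, hv, hv₁, hv₂ : s < v⟩ := ((hev.filter_mono nhdsWithin_le_nhds).and
      (hleft.and (eventually_mem_nhdsWithin (a := s) (s := Ioi s)))).exists
    have := hmin v ⟨by linarith, by linarith⟩ (r + -1 * (v - s)) ⟨by linarith, by linarith⟩
      (by linarith) hv
    linarith

theorem image_Icc_eq_univ_of_closed [T2Space Z] [ConnectedSpace Z] (hch : HasLineCharts Z)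
    {Γ : ℝ → Z} {s r : ℝ} (hlt : s < r) (hΓ : ∀ v ∈ Icc s r, IsUnitSpeedAt μ Γ v)
    (heq : Γ s = Γ r) (hev : ∀ᶠ v in 𝓝 s, Γ v = Γ (r + (v - s))) : Γ '' Icc s r = univ := by
  have hcont : ContinuousOn Γ (Icc s r) := fun v hv => (hΓ v hv).continuousAt.continuousWithinAt
  refine IsClopen.eq_univ ⟨(isCompact_Icc.image_of_continuousOn hcont).isClosed, ?_⟩
    ⟨Γ s, s, left_mem_Icc.2 hlt.le, rfl⟩
  have hend : Γ '' Icc s r ∈ 𝓝 (Γ s) := by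
    have hnear : ∀ᶠ v in 𝓝 s, v < r ∧ s < r + (v - s) := by
      refine (eventually_lt_nhds hlt).and ?_
      have : Continuous fun v => r + (v - s) := by fun_prop
      exact this.continuousAt.eventually_const_lt (by simpa using hlt)
    refine mem_of_superset ((hΓ s (left_mem_Icc.2 hlt.le)).image_mem_nhds hch (hev.and hnear)) ?_
    rintro _ ⟨v, ⟨hv, hvr, hsv⟩, rfl⟩
    rcases le_total s v with h | h
    · exact ⟨v, ⟨h, hvr.le⟩, rfl⟩
    · exact ⟨r + (v - s), ⟨hsv.le, by linarith⟩, hv.symm⟩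
  rw [isOpen_iff_mem_nhds]
  rintro _ ⟨v, hv, rfl⟩
  rcases hv.1.eq_or_lt with rfl | hsv
  · exact hend
  rcases hv.2.eq_or_lt with rfl | hvr
  · rwa [← heq]
  · exact (hΓ v hv).image_mem_nhds hch (Icc_mem_nhds hsv hvr)

theorem exists_loop_of_not_injOn [T2Space Z] [ConnectedSpace Z] (hch : HasLineCharts Z)
    {Γ : ℝ → Z} {D : Set ℝ} (hD : D.OrdConnected) (hΓ : ∀ s ∈ D, IsUnitSpeedAt μ Γ s)
    (hinj : ¬ InjOn Γ D) :
    ∃ s r, s < r ∧ ContinuousOn Γ (Icc s r) ∧ Γ s = Γ r ∧ InjOn Γ (Ico s r) ∧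
      Γ '' Icc s r = univ := by
  obtain ⟨s, r, hlt, hsub, heq, hmin⟩ := exists_shortest_chord hD hΓ hinj
  have hend := eventuallyEq_of_shortest_chord hch hlt (hΓ s (hsub (left_mem_Icc.2 hlt.le)))
    (hΓ r (hsub (right_mem_Icc.2 hlt.le))) heq hmin
  refine ⟨s, r, hlt, fun v hv => (hΓ v (hsub hv)).continuousAt.continuousWithinAt, heq,
    fun u hu v hv huv => ?_,
    image_Icc_eq_univ_of_closed hch hlt (fun v hv => hΓ v (hsub hv)) heq hend⟩
  by_contra hne
  rcases lt_or_gt_of_ne hne with h | h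
  · linarith [hmin u ⟨hu.1, hu.2.le⟩ v ⟨hv.1, hv.2.le⟩ h huv, hu.1, hv.2]
  · linarith [hmin v ⟨hv.1, hv.2.le⟩ u ⟨hu.1, hu.2.le⟩ h huv.symm, hv.1, hu.2]

theorem isOpenEmbedding_comp_of_injOn (hch : HasLineCharts Z) {Γ : ℝ → Z} {k : ℝ → ℝ}
    (hk : IsOpenEmbedding k) (hΓ : ∀ s ∈ range k, IsUnitSpeedAt μ Γ s)
    (hinj : InjOn Γ (range k)) : IsOpenEmbedding (Γ ∘ k) := by
  have hcont : ContinuousOn Γ (range k) := fun s hs => (hΓ s hs).continuousAt.continuousWithinAt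
  refine .of_continuous_injective_isOpenMap (hcont.comp_continuous hk.continuous mem_range_self)
    (fun x y hxy => hk.injective (hinj ⟨x, rfl⟩ ⟨y, rfl⟩ hxy)) ?_
  rw [isOpenMap_iff_nhds_le]
  intro x W hW
  refine mem_of_superset
    ((hΓ (k x) ⟨x, rfl⟩).image_mem_nhds hch (hk.isOpenMap.image_mem_nhds hW)) ?_
  rintro _ ⟨_, ⟨y, hy, rfl⟩, rfl⟩
  exact hy

end Classification

/-- A loop with image `S`, parametrized by `[-1, 1]` and injective up to its endpoints. -/
structure IsSimpleLoop {Z : Type*} [TopologicalSpace Z] (γ : ℝ → Z) (S : Set Z) : Prop where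
  continuous : Continuous γ
  eq_endpoints : γ (-1) = γ 1
  injOn : InjOn γ (Ico (-1) 1)
  image_eq : γ '' Icc (-1) 1 = S

theorem exists_isSimpleLoop {Z : Type*} [TopologicalSpace Z] {Γ : ℝ → Z} {s r : ℝ} (hlt : s < r)
    (hΓ : ContinuousOn Γ (Icc s r)) (heq : Γ s = Γ r) (hinj : InjOn Γ (Ico s r))
    (hsurj : Γ '' Icc s r = univ) : ∃ γ : ℝ → Z, IsSimpleLoop γ univ := by
  let G : ℝ → Z := IccExtend hlt.le ((Icc s r).domRestrict Γ)
  have hG : EqOn G Γ (Icc s r) := fun x hx => IccExtend_of_mem hlt.le _ hx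
  have ha : 0 < (r - s) / 2 := by linarith
  let k := affineHomeomorph ((r - s) / 2) ((r + s) / 2) ha.ne'
  have hleft : k (-1) = s := by simp only [k, affineHomeomorph_apply]; ring
  have hright : k 1 = r := by simp only [k, affineHomeomorph_apply]; ring
  have hIcc : k '' Icc (-1) 1 = Icc s r := by
    rw [affineHomeomorph_image_Icc _ _ _ _ ha]
    congr 1
  have hIco : k '' Ico (-1) 1 = Ico s r := by
    rw [affineHomeomorph_image_Ico _ _ _ _ ha]
    congr 1
  refine ⟨G ∘ k, (hΓ.domRestrict.Icc_extend').comp k.continuous, ?_, ?_, ?_⟩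
  · rw [Function.comp_apply, Function.comp_apply, hleft, hright, hG (left_mem_Icc.2 hlt.le),
      hG (right_mem_Icc.2 hlt.le), heq]
  · rw [← (hG.mono Ico_subset_Icc_self).injOn_iff, ← hIco] at hinj
    exact hinj.comp k.injective.injOn (mapsTo_image _ _)
  · rw [image_comp, hIcc, hG.image_eq, hsurj]

theorem IsSimpleLoop.subtypeVal {Z : Type*} [TopologicalSpace Z] {S : Set Z} {γ : ℝ → S}
    (hγ : IsSimpleLoop γ univ) : IsSimpleLoop (fun t => (γ t : Z)) S where
  continuous := continuous_subtype_val.comp hγ.continuous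
  eq_endpoints := congrArg _ hγ.eq_endpoints
  injOn := Subtype.val_injective.comp_injOn hγ.injOn
  image_eq := by
    rw [← image_image Subtype.val γ, hγ.image_eq, image_univ, Subtype.range_coe]

theorem IsSimpleLoop.eq_or_endpoints {Z : Type*} [TopologicalSpace Z] {S : Set Z} {γ : ℝ → Z}
    (hγ : IsSimpleLoop γ S) {s t : ℝ} (hs : s ∈ Icc (-1) 1) (ht : t ∈ Icc (-1) 1)
    (hst : γ s = γ t) : s = t ∨ (s = -1 ∧ t = 1) ∨ (s = 1 ∧ t = -1) := by
  have hm : (-1 : ℝ) ∈ Ico (-1) 1 := ⟨le_rfl, by norm_num⟩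
  rcases hs.2.eq_or_lt with rfl | hs'
  · rcases ht.2.eq_or_lt with rfl | ht'
    · exact .inl rfl
    · exact .inr (.inr ⟨rfl, hγ.injOn ⟨ht.1, ht'⟩ hm (hst.symm.trans hγ.eq_endpoints.symm)⟩)
  · rcases ht.2.eq_or_lt with rfl | ht'
    · exact .inr (.inl ⟨hγ.injOn ⟨hs.1, hs'⟩ hm (hst.trans hγ.eq_endpoints.symm), rfl⟩)
    · exact .inl (hγ.injOn ⟨hs.1, hs'⟩ ⟨ht.1, ht'⟩ hst)

theorem HasLineCharts.exists_line_or_loop {Z : Type*} [TopologicalSpace Z] [T2Space Z]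
    [SecondCountableTopology Z] [ConnectedSpace Z] (hch : HasLineCharts Z) :
    (∃ γ : ℝ → Z, IsOpenEmbedding γ ∧ range γ = univ) ∨ ∃ γ : ℝ → Z, IsSimpleLoop γ univ := by
  borelize Z
  obtain ⟨μ, _, _, _⟩ := hch.exists_isFiniteMeasure
  obtain ⟨Γ, D, hDo, hDc, hΓ, hsurj⟩ := exists_isUnitSpeedAt_surjOn (μ := μ) hch
  by_cases hinj : InjOn Γ D
  · obtain ⟨k, hk, rfl⟩ := exists_isOpenEmbedding_range_eq hDo hDc
    exact .inl ⟨Γ ∘ k, isOpenEmbedding_comp_of_injOn hch hk hΓ hinj, by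
      rw [range_comp]; exact univ_subset_iff.1 hsurj⟩
  · obtain ⟨s, r, hlt, hcont, heq, hi, himage⟩ :=
      exists_loop_of_not_injOn hch hDc.isPreconnected.ordConnected hΓ hinj
    exact .inr (exists_isSimpleLoop hlt hcont heq hi himage)

end OneManifolds

section Leaves

theorem mem_of_mem_classes {X : Type*} {Δ : Setoid X} {l : Set X} (hl : l ∈ Δ.classes)
    {x y : X} (hx : x ∈ l) : y ∈ l ↔ Quotient.mk Δ y = Quotient.mk Δ x := by
  obtain ⟨z, rfl⟩ := hl
  have hx : Δ x z := hx
  rw [Quotient.eq]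
  exact ⟨fun h => Δ.trans h (Δ.symm hx), fun h => Δ.trans h hx⟩

theorem preimage_mk_mem_classes {X : Type*} {Δ : Setoid X} (x : X) :
    Quotient.mk Δ ⁻¹' {Quotient.mk Δ x} ∈ Δ.classes := by
  refine ⟨x, ?_⟩
  ext y
  simp only [mem_preimage, mem_singleton_iff]
  exact Quotient.eq

theorem eq_preimage_mk {X : Type*} {Δ : Setoid X} {l : Set X} (hl : l ∈ Δ.classes)
    {x : X} (hx : x ∈ l) : l = Quotient.mk Δ ⁻¹' {Quotient.mk Δ x} := by
  ext y
  rw [mem_of_mem_classes hl hx]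
  rfl

section Strips

variable {X : Type*} [TopologicalSpace X] {Δ : Setoid X}

/-- An open embedding of a product `ℝ × T` that maps every line `ℝ × t` onto a leaf. -/
structure IsStrip (Δ : Setoid X) {T : Type*} [TopologicalSpace T] (e : ℝ × T → X) : Prop where
  isOpenEmbedding : IsOpenEmbedding e
  leaf : ∀ t, range (fun x => e (x, t)) ∈ Δ.classes

namespace IsStrip

variable {T : Type*} [TopologicalSpace T] {e : ℝ × T → X}

/-- The curve of leaves of a strip, in the leaf space. -/
def base (Δ : Setoid X) (e : ℝ × T → X) (t : T) : Quotient Δ := Quotient.mk Δ (e (0, t))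

theorem mk_apply (he : IsStrip Δ e) (u : ℝ) (t : T) : Quotient.mk Δ (e (u, t)) = base Δ e t :=
  (mem_of_mem_classes (he.leaf t) ⟨0, rfl⟩).1 ⟨u, rfl⟩

theorem mk_eq_base (he : IsStrip Δ e) {x : X} {t : T} (h : Quotient.mk Δ x = base Δ e t) :
    ∃ u, e (u, t) = x :=
  (mem_of_mem_classes (he.leaf t) ⟨0, rfl⟩).2 h

theorem base_injective (he : IsStrip Δ e) : Function.Injective (base Δ e) := by
  intro s t h
  obtain ⟨u, hu⟩ := he.mk_eq_base h
  exact (congrArg Prod.snd (he.isOpenEmbedding.injective hu)).symm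

theorem preimage_image_base (he : IsStrip Δ e) (S : Set T) :
    Quotient.mk Δ ⁻¹' (base Δ e '' S) = e '' (univ ×ˢ S) := by
  ext x
  constructor
  · rintro ⟨t, ht, h⟩
    obtain ⟨u, rfl⟩ := he.mk_eq_base h.symm
    exact ⟨(u, t), ⟨mem_univ _, ht⟩, rfl⟩
  · rintro ⟨⟨u, t⟩, ⟨-, ht⟩, rfl⟩
    exact ⟨t, ht, (he.mk_apply u t).symm⟩

theorem preimage_range_base (he : IsStrip Δ e) :
    Quotient.mk Δ ⁻¹' range (base Δ e) = range e := by
  rw [← image_univ, he.preimage_image_base, univ_prod_univ, image_univ]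

theorem isPreconnected_preimage (he : IsStrip Δ e) {S : Set T} (hS : IsPreconnected S) :
    IsPreconnected (Quotient.mk Δ ⁻¹' (base Δ e '' S)) := by
  rw [he.preimage_image_base]
  exact (isPreconnected_univ.prod hS).image _ he.isOpenEmbedding.continuous.continuousOn

theorem isOpenEmbedding_base (he : IsStrip Δ e) : IsOpenEmbedding (base Δ e) := by
  refine .of_continuous_injective_isOpenMap ?_ he.base_injective fun S hS => ?_
  · exact continuous_quotient_mk'.comp (he.isOpenEmbedding.continuous.comp (by fun_prop))
  · refine isQuotientMap_quotient_mk'.isOpen_preimage.1 ?_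
    change IsOpen (Quotient.mk Δ ⁻¹' (base Δ e '' S))
    rw [he.preimage_image_base]
    exact he.isOpenEmbedding.isOpenMap _ (isOpen_univ.prod hS)

theorem comp (he : IsStrip Δ e) {T' : Type*} [TopologicalSpace T'] {ι : T' → T}
    (hι : IsOpenEmbedding ι) : IsStrip Δ (fun q : ℝ × T' => e (q.1, ι q.2)) :=
  ⟨he.isOpenEmbedding.comp (IsOpenEmbedding.id.prodMap hι), fun t => he.leaf (ι t)⟩

theorem exists_line_subset {J : Set ℝ} {e : ℝ × J → X} (he : IsStrip Δ e) {t : J}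
    (ht : J ∈ 𝓝 (t : ℝ)) {W : Set (Quotient Δ)} (hW : W ∈ 𝓝 (base Δ e t)) :
    ∃ e' : ℝ × ℝ → X, IsStrip Δ e' ∧ base Δ e t ∈ range (base Δ e') ∧ range (base Δ e') ⊆ W := by
  have hnhds : Subtype.val '' (base Δ e ⁻¹' W) ∈ 𝓝 (t : ℝ) := by
    rw [← map_nhds_subtype_coe_eq_nhds t.2 ht]
    exact image_mem_map (he.isOpenEmbedding_base.continuous.continuousAt hW)
  obtain ⟨a, b, hab, hsub⟩ := mem_nhds_iff_exists_Ioo_subset.1 hnhds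
  obtain ⟨k, hk, hrange⟩ := exists_isOpenEmbedding_range_eq_Ioo (hab.1.trans hab.2)
  have hkW : ∀ v, ∃ h : k v ∈ J, base Δ e ⟨k v, h⟩ ∈ W := fun v => by
    obtain ⟨s, hs, hsv⟩ := hsub (hrange ▸ mem_range_self v)
    have hkJ : k v ∈ J := hsv ▸ s.2
    have hks : (⟨k v, hkJ⟩ : J) = s := Subtype.ext hsv.symm
    exact ⟨hkJ, hks ▸ hs⟩
  choose hkJ hkW using hkW
  have hι : IsOpenEmbedding fun v => (⟨k v, hkJ v⟩ : J) := by
    refine ⟨.of_comp (by fun_prop) continuous_subtype_val hk.isEmbedding, ?_⟩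
    have : range (fun v => (⟨k v, hkJ v⟩ : J)) = Subtype.val ⁻¹' range k := by
      ext s
      simp [Subtype.ext_iff]
    exact this ▸ hk.isOpen_range.preimage continuous_subtype_val
  refine ⟨_, he.comp hι, ?_, ?_⟩
  · obtain ⟨v, hv⟩ := hrange.ge hab
    exact ⟨v, congrArg (base Δ e) (Subtype.ext hv)⟩
  · rintro _ ⟨v, rfl⟩
    exact hkW v

end IsStrip

/-- Every point lies in a strip over a subset of the line. -/
def LocallyStrip (Δ : Setoid X) : Prop :=
  ∀ x : X, ∃ (J : Set ℝ) (e : ℝ × J → X), IsStrip Δ e ∧ x ∈ range e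

theorem LocallyStrip.isOpenMap (h : LocallyStrip Δ) : IsOpenMap (Quotient.mk Δ) := by
  intro U hU
  refine isQuotientMap_quotient_mk'.isOpen_preimage.1 (isOpen_iff_mem_nhds.2 ?_)
  rintro x ⟨y, hy, hxy⟩
  obtain ⟨J, e, he, ⟨u, t⟩, rfl⟩ := h y
  have hxy : Quotient.mk Δ x = IsStrip.base Δ e t := by
    rw [← he.mk_apply u t, hxy]
    rfl
  obtain ⟨v, rfl⟩ := he.mk_eq_base hxy
  have hO : IsOpen {s | e (u, s) ∈ U} :=
    hU.preimage (he.isOpenEmbedding.continuous.comp (by fun_prop))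
  refine mem_of_superset ((he.isOpenEmbedding.isOpenMap _ (isOpen_univ.prod hO)).mem_nhds
    ⟨(v, t), ⟨mem_univ _, hy⟩, rfl⟩) ?_
  rintro _ ⟨⟨w, s⟩, ⟨-, hs⟩, rfl⟩
  refine ⟨e (u, s), hs, ?_⟩
  change Quotient.mk Δ _ = Quotient.mk Δ _
  rw [he.mk_apply, he.mk_apply]

theorem LocallyStrip.isPreconnected_leaf (h : LocallyStrip Δ) (y : Quotient Δ) :
    IsPreconnected (Quotient.mk Δ ⁻¹' {y}) := by
  obtain ⟨x, rfl⟩ := Quotient.exists_rep y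
  obtain ⟨J, e, he, ⟨u, t⟩, rfl⟩ := h x
  rw [show Quotient.mk Δ (e (u, t)) = IsStrip.base Δ e t from he.mk_apply u t, ← image_singleton]
  exact he.isPreconnected_preimage isPreconnected_singleton

theorem HasTrivialNhd.exists_strip {ω : Set X} {J : Set ℝ} (h : HasTrivialNhd Δ ω J) :
    ∃ e : ℝ × J → X, IsStrip Δ e ∧ e '' {p | (p.2 : ℝ) = 0} = ω := by
  obtain ⟨U, hU, -, φ, h0, hleaf⟩ := h
  exact ⟨fun p => φ p, ⟨hU.isOpenEmbedding_subtypeVal.comp φ.isOpenEmbedding, hleaf⟩, h0⟩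

end Strips

section NonSpecial

variable {Y : Type*} [TopologicalSpace Y]

theorem disjoint_nhds_of_not_special {y z : Y} (hy : ¬ IsSpecialPoint y) (hyz : y ≠ z) :
    Disjoint (𝓝 y) (𝓝 z) := by
  by_contra hd
  apply hyz
  have hz : z ∈ hausdorffClosure y := by
    refine mem_iInter₂.2 fun V hV => mem_closure_iff_nhds.2 fun W hW => ?_
    by_contra hne
    rw [Set.not_nonempty_iff_eq_empty] at hne
    exact hd (Filter.disjoint_iff.2
      ⟨V, hV, W, hW, by rwa [disjoint_iff_inter_eq_empty, inter_comm]⟩)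
  rw [not_not.1 hy] at hz
  exact hz.symm

theorem isClosed_of_isCompact_not_special {K : Set Y} (hK : IsCompact K)
    (h : ∀ y ∈ K, ¬ IsSpecialPoint y) : IsClosed K := by
  rw [← isOpen_compl_iff, isOpen_iff_mem_nhds]
  intro z hz
  have := hK.disjoint_nhdsSet_left.2 fun y hy => disjoint_nhds_of_not_special (h y hy)
    (fun hyz => hz (hyz ▸ hy) : y ≠ z)
  obtain ⟨V, hV, W, hW, hVW⟩ := Filter.disjoint_iff.1 this
  exact mem_of_superset hW fun w hw hwK => hVW.le_bot ⟨subset_of_mem_nhdsSet hV hwK, hw⟩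

end NonSpecial

theorem ne_of_isLeast_of_isEmbedding {Y : Type*} [TopologicalSpace Y] {S : Set ℝ} {β : S → Y}
    (hβ : IsEmbedding β) {s : S} (hs : IsLeast S s) {ι : ℝ → Y} (hι : Continuous ι)
    (hi : Function.Injective ι) (hsub : range ι ⊆ range β) (v : ℝ) : ι v ≠ β s := by
  intro hv
  let f : ℝ → S := fun u => hβ.toHomeomorph.symm ⟨ι u, hsub ⟨u, rfl⟩⟩
  have hf : Continuous f := hβ.toHomeomorph.symm.continuous.comp (by fun_prop)
  have hβf : ∀ u, β (f u) = ι u := fun u =>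
    congrArg Subtype.val (hβ.toHomeomorph.apply_symm_apply ⟨ι u, hsub ⟨u, rfl⟩⟩)
  have hfi : Function.Injective f := fun u w huw => hi (by rw [← hβf u, ← hβf w, huw])
  have hfv : f v = s := hβ.injective ((hβf v).trans hv)
  have hle : ∀ u, f v ≤ f u := fun u => hfv ▸ hs.2 (f u).2
  rcases hf.strictMono_of_inj hfi with hm | hm
  · exact (hm (sub_one_lt v)).not_ge (hle _)
  · exact (hm (lt_add_one v)).not_ge (hle _)

section ClassF

variable {X : Type*} [TopologicalSpace X] [ChartedSpace (EuclideanHalfSpace 2) X] {Δ : Setoid X}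

theorem IsClassF.leaf_subset_boundary (hΔ : IsClassF Δ) {x : X} (hx : x ∈ (𝓡∂ 2).boundary X) :
    Quotient.mk Δ ⁻¹' {Quotient.mk Δ x} ⊆ (𝓡∂ 2).boundary X := by
  rw [← eq_preimage_mk (hΔ.boundary_component x hx) (mem_connectedComponentIn hx)]
  exact connectedComponentIn_subset _ _

theorem IsClassF.exists_strip_boundary (hΔ : IsClassF Δ) {x : X}
    (hx : x ∈ (𝓡∂ 2).boundary X) : ∃ e : ℝ × Ico (0 : ℝ) 1 → X, IsStrip Δ e ∧
      ∃ t : Ico (0 : ℝ) 1, t.1 = 0 ∧ Quotient.mk Δ x = IsStrip.base Δ e t := by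
  obtain ⟨e, he, h0⟩ := (hΔ.trivial_boundary _ (preimage_mk_mem_classes x)
    (hΔ.leaf_subset_boundary hx)).exists_strip
  obtain ⟨⟨u, t⟩, ht, rfl⟩ : x ∈ e '' {p | (p.2 : ℝ) = 0} := h0 ▸ rfl
  exact ⟨e, he, t, ht, he.mk_apply u t⟩

theorem IsClassF.exists_strip_interior (hΔ : IsClassF Δ) {x : X}
    (hx : x ∉ (𝓡∂ 2).boundary X) : ∃ e : ℝ × Ioo (-1 : ℝ) 1 → X, IsStrip Δ e ∧
      ∃ t : Ioo (-1 : ℝ) 1, t.1 = 0 ∧ Quotient.mk Δ x = IsStrip.base Δ e t := by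
  obtain ⟨e, he, h0⟩ := (hΔ.trivial_interior _ (preimage_mk_mem_classes x)
    fun h => hx (h rfl)).exists_strip
  obtain ⟨⟨u, t⟩, ht, rfl⟩ : x ∈ e '' {p | (p.2 : ℝ) = 0} := h0 ▸ rfl
  exact ⟨e, he, t, ht, he.mk_apply u t⟩

theorem IsClassF.exists_strip (hΔ : IsClassF Δ) (x : X) : ∃ (J : Set ℝ) (e : ℝ × J → X),
    J.OrdConnected ∧ (∀ t ∈ J, t ≠ 0 → J ∈ 𝓝 t) ∧ IsStrip Δ e ∧
      ∃ t : J, t.1 = 0 ∧ Quotient.mk Δ x = IsStrip.base Δ e t := by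
  by_cases hx : x ∈ (𝓡∂ 2).boundary X
  · obtain ⟨e, he, ht⟩ := hΔ.exists_strip_boundary hx
    exact ⟨_, e, ordConnected_Ico, fun t ht h0 => Ico_mem_nhds (lt_of_le_of_ne ht.1 h0.symm) ht.2,
      he, ht⟩
  · obtain ⟨e, he, ht⟩ := hΔ.exists_strip_interior hx
    exact ⟨_, e, ordConnected_Ioo, fun t ht _ => Ioo_mem_nhds ht.1 ht.2, he, ht⟩

theorem IsClassF.locallyStrip (hΔ : IsClassF Δ) : LocallyStrip Δ := by
  intro x
  obtain ⟨J, e, -, -, he, t, -, ht⟩ := hΔ.exists_strip x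
  obtain ⟨u, hu⟩ := he.mk_eq_base ht
  exact ⟨J, e, he, _, hu⟩

theorem IsClassF.notMem_boundary (hΔ : IsClassF Δ) {J : Set ℝ} {e : ℝ × J → X}
    (he : IsStrip Δ e) {t : J} (ht : J ∈ 𝓝 (t : ℝ)) (u : ℝ) : e (u, t) ∉ (𝓡∂ 2).boundary X := by
  intro hb
  obtain ⟨e', he', s, hs, hbase⟩ := hΔ.exists_strip_boundary hb
  rw [he.mk_apply] at hbase
  obtain ⟨ε, hε, ⟨v, hv⟩, hsub⟩ := he.exists_line_subset ht
    (he'.isOpenEmbedding_base.isOpen_range.mem_nhds ⟨s, hbase.symm⟩)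
  exact ne_of_isLeast_of_isEmbedding he'.isOpenEmbedding_base.isEmbedding
    ⟨s.2, fun r hr => hs.le.trans hr.1⟩ hε.isOpenEmbedding_base.continuous hε.base_injective hsub v
    (hv.trans hbase)

variable (Δ) in
/-- The leaves that are neither special nor in the boundary. -/
def regularLeaves : Set (Quotient Δ) :=
  {y | ¬ IsSpecialPoint y ∧ ∀ x, Quotient.mk Δ x = y → x ∉ (𝓡∂ 2).boundary X}

theorem IsClassF.preimage_regularLeaves (hΔ : IsClassF Δ) :
    Quotient.mk Δ ⁻¹' regularLeaves Δ =
      (⋃₀ specialLeaves Δ ∪ (𝓡∂ 2).boundary X)ᶜ := by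
  ext x
  rw [mem_compl_iff, mem_union, not_or]
  constructor
  · rintro ⟨h1, h2⟩
    refine ⟨?_, h2 x rfl⟩
    rintro ⟨_, ⟨y, hy, rfl⟩, hxy⟩
    have hxy : Quotient.mk Δ x = y := hxy
    exact h1 (hxy ▸ hy)
  · rintro ⟨h1, h2⟩
    refine ⟨fun h => h1 ⟨_, ⟨_, h, rfl⟩, rfl⟩, fun z hz hzb => h2 ?_⟩
    exact hΔ.leaf_subset_boundary hzb hz.symm

theorem IsClassF.eventually_regular (hΔ : IsClassF Δ)
    (hfin : LocallyFinite (fun ω : specialLeaves Δ => (ω : Set X))) {J : Set ℝ}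
    {e : ℝ × J → X} (he : IsStrip Δ e) (hJ : ∀ t ∈ J, t ≠ 0 → J ∈ 𝓝 t) (t₀ : J)
    (ht₀ : t₀.1 = 0) : ∀ᶠ t in 𝓝 t₀, t ≠ t₀ → IsStrip.base Δ e t ∈ regularLeaves Δ := by
  obtain ⟨N, hN, hNf⟩ := hfin (e (0, t₀))
  set S : Set J := {t | e (0, t) ∈ N ∧ IsSpecialPoint (IsStrip.base Δ e t)}
  have hSf : S.Finite := by
    refine Set.Finite.of_finite_image (f := fun t => Quotient.mk Δ ⁻¹' {IsStrip.base Δ e t})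
      ((hNf.image Subtype.val).subset ?_) ?_
    · rintro _ ⟨t, ⟨htN, hts⟩, rfl⟩
      refine ⟨⟨_, _, hts, rfl⟩, ⟨e (0, t), rfl, htN⟩, rfl⟩
    · intro s _ t _ hst
      have hst : Quotient.mk Δ ⁻¹' {IsStrip.base Δ e s} =
        Quotient.mk Δ ⁻¹' {IsStrip.base Δ e t} := hst
      have : e (0, s) ∈ Quotient.mk Δ ⁻¹' {IsStrip.base Δ e t} := hst ▸ rfl
      exact he.base_injective this
  have h1 : ∀ᶠ t in 𝓝 t₀, e (0, t) ∈ N := by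
    have : Continuous fun t => e (0, t) := he.isOpenEmbedding.continuous.comp (by fun_prop)
    exact this.continuousAt hN
  have h2 : ∀ᶠ t in 𝓝 t₀, t ∉ S \ {t₀} :=
    (hSf.subset sdiff_subset).isClosed.isOpen_compl.mem_nhds fun h => h.2 rfl
  filter_upwards [h1, h2] with t ht1 ht2 hne
  refine ⟨fun hsp => ht2 ⟨⟨ht1, hsp⟩, hne⟩, fun x hx => ?_⟩
  obtain ⟨u, rfl⟩ := he.mk_eq_base hx
  exact hΔ.notMem_boundary he (hJ t t.2 fun h => hne (Subtype.ext (h.trans ht₀.symm))) u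

theorem IsClassF.exists_sides (hΔ : IsClassF Δ)
    (hfin : LocallyFinite (fun ω : specialLeaves Δ => (ω : Set X))) (y : Quotient Δ)
    {W : Set (Quotient Δ)} (hW : W ∈ 𝓝 y) : ∃ C₁ C₂ : Set (Quotient Δ),
      IsPreconnected (Quotient.mk Δ ⁻¹' C₁) ∧ IsPreconnected (Quotient.mk Δ ⁻¹' C₂) ∧
      C₁ ⊆ W ∩ regularLeaves Δ ∧ C₂ ⊆ W ∩ regularLeaves Δ ∧ {y} ∪ (C₁ ∪ C₂) ∈ 𝓝 y := by
  obtain ⟨x, rfl⟩ := Quotient.exists_rep y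
  obtain ⟨J, e, hJc, hJ, he, t₀, ht₀, hx : Quotient.mk Δ x = _⟩ := hΔ.exists_strip x
  rw [hx] at hW ⊢
  have hb := he.isOpenEmbedding_base
  obtain ⟨δ, hδ, hball⟩ := Metric.mem_nhds_iff.1
    ((hΔ.eventually_regular hfin he hJ t₀ ht₀).and (hb.continuous.continuousAt.eventually hW))
  have hmem : ∀ t : J, t ∈ Metric.ball t₀ δ ↔ -δ < t ∧ (t : ℝ) < δ := fun t => by
    rw [Metric.mem_ball, Subtype.dist_eq, ht₀, Real.dist_eq, sub_zero, abs_lt]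
  have hpre : ∀ a c : ℝ, IsPreconnected {t : J | a < t ∧ (t : ℝ) < c} := fun a c =>
    isPreconnected_of_ordConnected_coe hJc (ordConnected_Ioo.preimage_mono (Subtype.mono_coe _))
  refine ⟨_, _, he.isPreconnected_preimage (hpre (-δ) 0), he.isPreconnected_preimage (hpre 0 δ),
    ?_, ?_, mem_of_superset (hb.isOpenMap.image_mem_nhds (Metric.ball_mem_nhds _ hδ)) ?_⟩
  · rintro _ ⟨t, ⟨hδt, ht⟩, rfl⟩
    have := hball ((hmem t).2 ⟨hδt, ht.trans hδ⟩)
    exact ⟨this.2, this.1 fun h => ht.ne (h ▸ ht₀)⟩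
  · rintro _ ⟨t, ⟨ht, htδ⟩, rfl⟩
    have := hball ((hmem t).2 ⟨by linarith, htδ⟩)
    exact ⟨this.2, this.1 fun h => ht.ne' (h ▸ ht₀)⟩
  · rintro _ ⟨t, ht, rfl⟩
    obtain ⟨hδt, htδ⟩ := (hmem t).1 ht
    rcases lt_trichotomy (t : ℝ) 0 with h | h | h
    · exact .inr (.inl ⟨t, ⟨hδt, h⟩, rfl⟩)
    · exact .inl (congrArg _ (Subtype.ext (h.trans ht₀.symm)))
    · exact .inr (.inr ⟨t, ⟨h, htδ⟩, rfl⟩)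

theorem IsClassF.isOpen_regularLeaves (hΔ : IsClassF Δ)
    (hfin : LocallyFinite (fun ω : specialLeaves Δ => (ω : Set X))) :
    IsOpen (regularLeaves Δ) := by
  rw [isOpen_iff_mem_nhds]
  intro y hy
  obtain ⟨C₁, C₂, -, -, h1, h2, hn⟩ := hΔ.exists_sides hfin y univ_mem
  refine mem_of_superset hn ?_
  rintro z (rfl | hz | hz)
  · exact hy
  · exact (h1 hz).2
  · exact (h2 hz).2

theorem IsClassF.exists_strip_regular (hΔ : IsClassF Δ) {y : Quotient Δ}
    (hy : y ∈ regularLeaves Δ) {W : Set (Quotient Δ)} (hW : W ∈ 𝓝 y) :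
    ∃ e : ℝ × ℝ → X, IsStrip Δ e ∧ y ∈ range (IsStrip.base Δ e) ∧
      range (IsStrip.base Δ e) ⊆ W := by
  obtain ⟨x, rfl⟩ := Quotient.exists_rep y
  obtain ⟨e, he, t, -, hx : Quotient.mk Δ x = _⟩ := hΔ.exists_strip_interior (hy.2 x rfl)
  rw [hx] at hW ⊢
  exact he.exists_line_subset (Ioo_mem_nhds t.2.1 t.2.2) hW

end ClassF

end Leaves

section Flattening

variable {A B J : Type*}

/-- The sum of the sequence `x` with weights `w`. -/
noncomputable def weightedSum (w x : J → ℝ) : ℝ := ∑' j, w j * x j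

section WeightedSum

variable {w : J → ℝ}

theorem norm_weighted_le (hw : ∀ j, 0 < w j) {x : J → ℝ} (hx : ∀ j, x j ∈ Icc (0 : ℝ) 1) (j : J) :
    ‖w j * x j‖ ≤ w j := by
  rw [Real.norm_of_nonneg (mul_nonneg (hw j).le (hx j).1)]
  exact mul_le_of_le_one_right (hw j).le (hx j).2

theorem summable_weighted (hw : ∀ j, 0 < w j) (hs : Summable w) {x : J → ℝ}
    (hx : ∀ j, x j ∈ Icc (0 : ℝ) 1) : Summable fun j => w j * x j :=
  .of_norm_bounded hs (norm_weighted_le hw hx)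

theorem weightedSum_nonneg (hw : ∀ j, 0 < w j) {x : J → ℝ} (hx : ∀ j, 0 ≤ x j) :
    0 ≤ weightedSum w x :=
  tsum_nonneg fun j => mul_nonneg (hw j).le (hx j)

theorem weightedSum_le_weightedSum (hw : ∀ j, 0 < w j) (hs : Summable w) {x y : J → ℝ}
    (hx : ∀ j, x j ∈ Icc (0 : ℝ) 1) (hy : ∀ j, y j ∈ Icc (0 : ℝ) 1) (hxy : ∀ j, x j ≤ y j) :
    weightedSum w x ≤ weightedSum w y :=
  (summable_weighted hw hs hx).tsum_le_tsum
    (fun j => mul_le_mul_of_nonneg_left (hxy j) (hw j).le) (summable_weighted hw hs hy)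

theorem weightedSum_lt_weightedSum (hw : ∀ j, 0 < w j) (hs : Summable w) {x y : J → ℝ}
    (hx : ∀ j, x j ∈ Icc (0 : ℝ) 1) (hy : ∀ j, y j ∈ Icc (0 : ℝ) 1) (hxy : ∀ j, x j ≤ y j)
    {i : J} (hi : x i < y i) : weightedSum w x < weightedSum w y :=
  Summable.tsum_lt_tsum (fun j => mul_le_mul_of_nonneg_left (hxy j) (hw j).le)
    (mul_lt_mul_of_pos_left hi (hw i)) (summable_weighted hw hs hx) (summable_weighted hw hs hy)

theorem continuous_weightedSum [TopologicalSpace A] (hw : ∀ j, 0 < w j) (hs : Summable w)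
    {f : J → A → ℝ} (hf : ∀ j, Continuous (f j)) (hf' : ∀ j a, f j a ∈ Icc (0 : ℝ) 1) :
    Continuous fun a => weightedSum w (f · a) :=
  continuous_tsum (fun j => (hf j).const_mul (w j)) hs
    fun j a => norm_weighted_le hw (fun j => hf' j a) j

theorem tendsto_weightedSum (hw : ∀ j, 0 < w j) (hs : Summable w) {f : J → A → ℝ}
    (hf : ∀ j a, f j a ∈ Icc (0 : ℝ) 1) {l : Filter A} {x : J → ℝ}
    (hx : ∀ j, Tendsto (f j) l (𝓝 (x j))) :
    Tendsto (fun a => weightedSum w (f · a)) l (𝓝 (weightedSum w x)) :=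
  tendsto_tsum_of_dominated_convergence hs (fun j => (hx j).const_mul _)
    (.of_forall fun a j => norm_weighted_le hw (fun j => hf j a) j)

end WeightedSum

variable [TopologicalSpace A] [TopologicalSpace B]

/-- Functions `f j` on `A` with values in `[0, 1]`, bounded by functions `χ j` of the level `τ`.
Around every point `τ` is trivialized by lines along which all `f j` are monotone and one of them
is strictly monotone. Such a family is used to flatten `A` into `ℝ × B`. -/
structure IsFlatteningFamily (τ : A → B) (f : J → A → ℝ) (χ : J → B → ℝ) : Prop where
  continuous_level : Continuous τ
  continuous : ∀ j, Continuous (f j)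
  continuous_bound : ∀ j, Continuous (χ j)
  nonneg : ∀ j a, 0 ≤ f j a
  le_bound : ∀ j a, f j a ≤ χ j (τ a)
  bound_mem : ∀ j b, χ j b ∈ Icc (0 : ℝ) 1
  exists_chart : ∀ a, ∃ (e : OpenPartialHomeomorph A (ℝ × B)) (V : Set B), a ∈ e.source ∧
    e.target = univ ×ˢ V ∧ (∀ x ∈ e.source, (e x).2 = τ x) ∧
    ∀ b ∈ V, (∀ j, Monotone fun u => f j (e.symm (u, b))) ∧
      ∃ j, StrictMono fun u => f j (e.symm (u, b))

/-- The map to `ℝ × B` over `τ` whose first coordinate is the weighted sum of the functions `f j`,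
normalized by its upper bound and transported from `(0, 1)` to the line. -/
noncomputable def flattening (w : J → ℝ) (τ : A → B) (f : J → A → ℝ) (χ : J → B → ℝ) (a : A) :
    ℝ × B :=
  (logit (weightedSum w (f · a) / weightedSum w (χ · (τ a))), τ a)

namespace IsFlatteningFamily

variable {w : J → ℝ} {τ : A → B} {f : J → A → ℝ} {χ : J → B → ℝ}

theorem mem_Icc (h : IsFlatteningFamily τ f χ) (j : J) (a : A) : f j a ∈ Icc (0 : ℝ) 1 :=
  ⟨h.nonneg j a, (h.le_bound j a).trans (h.bound_mem j _).2⟩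

theorem exists_line (h : IsFlatteningFamily τ f χ) (a : A) : ∃ (s : ℝ → A) (u : ℝ), s u = a ∧
    (∀ v, τ (s v) = τ a) ∧ (∀ j, Monotone fun v => f j (s v)) ∧
    ∃ j, StrictMono fun v => f j (s v) := by
  obtain ⟨e, V, ha, ht, he, hm⟩ := h.exists_chart a
  have hea : (e a).2 ∈ V := (ht ▸ e.map_source ha : e a ∈ univ ×ˢ V).2
  refine ⟨fun u => e.symm (u, (e a).2), (e a).1, e.left_inv ha, fun u => ?_, hm _ hea⟩
  have hmem : (u, (e a).2) ∈ e.target := by rw [ht]; exact ⟨mem_univ _, hea⟩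
  rw [← he _ (e.map_target hmem), e.right_inv hmem, he _ ha]

theorem strictMono_weightedSum (h : IsFlatteningFamily τ f χ) (hw : ∀ j, 0 < w j)
    (hs : Summable w) {s : ℝ → A} (hmono : ∀ j, Monotone fun u => f j (s u))
    (hstrict : ∃ j, StrictMono fun u => f j (s u)) :
    StrictMono fun u => weightedSum w (f · (s u)) := by
  obtain ⟨j, hj⟩ := hstrict
  exact fun u v huv => weightedSum_lt_weightedSum hw hs (h.mem_Icc · _) (h.mem_Icc · _)
    (fun i => hmono i huv.le) (hj huv)

theorem weightedSum_pos (h : IsFlatteningFamily τ f χ) (hw : ∀ j, 0 < w j) (hs : Summable w)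
    (a : A) : 0 < weightedSum w (f · a) := by
  obtain ⟨s, u, rfl, -, hmono, hstrict⟩ := h.exists_line a
  exact (weightedSum_nonneg hw (h.nonneg · _)).trans_lt
    (h.strictMono_weightedSum hw hs hmono hstrict (sub_one_lt u))

theorem weightedSum_lt_bound (h : IsFlatteningFamily τ f χ) (hw : ∀ j, 0 < w j)
    (hs : Summable w) (a : A) : weightedSum w (f · a) < weightedSum w (χ · (τ a)) := by
  obtain ⟨s, u, rfl, hτ, hmono, hstrict⟩ := h.exists_line a
  exact (h.strictMono_weightedSum hw hs hmono hstrict (lt_add_one u)).trans_le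
    (weightedSum_le_weightedSum hw hs (h.mem_Icc · _) (h.bound_mem · _)
      fun j => hτ (u + 1) ▸ h.le_bound j _)

theorem bound_pos (h : IsFlatteningFamily τ f χ) (hw : ∀ j, 0 < w j) (hs : Summable w) (a : A) :
    0 < weightedSum w (χ · (τ a)) :=
  (h.weightedSum_pos hw hs a).trans (h.weightedSum_lt_bound hw hs a)

theorem ratio_mem_Ioo (h : IsFlatteningFamily τ f χ) (hw : ∀ j, 0 < w j) (hs : Summable w)
    (a : A) : weightedSum w (f · a) / weightedSum w (χ · (τ a)) ∈ Ioo (0 : ℝ) 1 :=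
  ⟨div_pos (h.weightedSum_pos hw hs a) (h.bound_pos hw hs a),
    (div_lt_one (h.bound_pos hw hs a)).2 (h.weightedSum_lt_bound hw hs a)⟩

theorem continuous_flattening (h : IsFlatteningFamily τ f χ) (hw : ∀ j, 0 < w j)
    (hs : Summable w) : Continuous (flattening w τ f χ) := by
  have hbound : Continuous fun b => weightedSum w (χ · b) :=
    continuous_weightedSum hw hs h.continuous_bound h.bound_mem
  exact (continuousOn_logit.comp_continuous
    ((continuous_weightedSum hw hs h.continuous h.mem_Icc).div (hbound.comp h.continuous_level)
      fun a => (h.bound_pos hw hs a).ne') (h.ratio_mem_Ioo hw hs)).prodMk h.continuous_level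

theorem strictMono_flattening (h : IsFlatteningFamily τ f χ) (hw : ∀ j, 0 < w j)
    (hs : Summable w) {b : B} {s : ℝ → A} (hsb : ∀ u, τ (s u) = b)
    (hmono : ∀ j, Monotone fun u => f j (s u)) (hstrict : ∃ j, StrictMono fun u => f j (s u)) :
    StrictMono fun u => (flattening w τ f χ (s u)).1 := by
  intro u v huv
  refine strictMonoOn_logit (h.ratio_mem_Ioo hw hs _) (h.ratio_mem_Ioo hw hs _) ?_
  rw [hsb, hsb]
  exact div_lt_div_of_pos_right (h.strictMono_weightedSum hw hs hmono hstrict huv)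
    (hsb u ▸ h.bound_pos hw hs (s u))

theorem isOpenMap_flattening (h : IsFlatteningFamily τ f χ) (hw : ∀ j, 0 < w j)
    (hs : Summable w) : IsOpenMap (flattening w τ f χ) := by
  rw [isOpenMap_iff_nhds_le]
  intro a
  obtain ⟨e, V, ha, ht, he, hm⟩ := h.exists_chart a
  have hea : (e a).2 ∈ V := (ht ▸ e.map_source ha : e a ∈ univ ×ˢ V).2
  have hV : IsOpen V := by
    simpa [ht, preimage] using e.open_target.preimage (Continuous.prodMk_right (Y := B) (0 : ℝ))
  let ι : ℝ × V → ℝ × B := Prod.map id Subtype.val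
  have hι : IsOpenEmbedding ι := IsOpenEmbedding.id.prodMap hV.isOpenEmbedding_subtypeVal
  have hιt : ∀ q, ι q ∈ e.target := fun q => by rw [ht]; exact ⟨mem_univ _, q.2.2⟩
  have hτι : ∀ q, τ (e.symm (ι q)) = q.2 := fun q => by
    rw [← he _ (e.map_target (hιt q)), e.right_inv (hιt q)]
    rfl
  have hcont : Continuous fun q => e.symm (ι q) :=
    e.continuousOn_symm.comp_continuous hι.continuous hιt
  have hlevel : IsOpenMap fun q : ℝ × V => ((flattening w τ f χ (e.symm (ι q))).1, q.2) :=
    isOpenMap_prodMk_snd (continuous_fst.comp ((h.continuous_flattening hw hs).comp hcont))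
      fun t => h.strictMono_flattening hw hs (fun u => hτι (u, t)) (hm t t.2).1 (hm t t.2).2
  have hopen : IsOpenMap fun q => flattening w τ f χ (e.symm (ι q)) := by
    convert hι.isOpenMap.comp hlevel using 2 with q
    exact Prod.ext rfl (hτι q)
  have hnhds := hopen.nhds_le ((e a).1, ⟨(e a).2, hea⟩)
  have hιa : ι ((e a).1, ⟨(e a).2, hea⟩) = e a := rfl
  rwa [hιa, e.left_inv ha, ← Function.comp_def (flattening w τ f χ), ← map_map,
    ← Function.comp_def e.symm, ← map_map, hι.map_nhds_eq, hιa, e.symm_map_nhds_eq ha] at hnhds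

theorem exists_flattening_eq (h : IsFlatteningFamily τ f χ) (hw : ∀ j, 0 < w j)
    (hs : Summable w) {b : B} {s : ℝ → A} (hsc : Continuous s) (hsb : ∀ u, τ (s u) = b)
    (hbot : ∀ j, Tendsto (fun u => f j (s u)) atBot (𝓝 0))
    (htop : ∀ j, Tendsto (fun u => f j (s u)) atTop (𝓝 (χ j b))) (x : ℝ) :
    ∃ u, flattening w τ f χ (s u) = (x, b) := by
  have hpos : 0 < weightedSum w (χ · b) := hsb 0 ▸ h.bound_pos hw hs (s 0)
  have hcont : Continuous fun u => weightedSum w (f · (s u)) :=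
    (continuous_weightedSum hw hs h.continuous h.mem_Icc).comp hsc
  have hlim0 : Tendsto (fun u => weightedSum w (f · (s u))) atBot (𝓝 0) := by
    simpa [weightedSum] using tendsto_weightedSum hw hs (fun j u => h.mem_Icc j (s u)) hbot
  have hlim1 := tendsto_weightedSum hw hs (fun j u => h.mem_Icc j (s u)) htop
  obtain ⟨u₁, hu₁⟩ :=
    (hlim0.eventually_lt_const (mul_pos (Real.sigmoid_pos x) hpos)).exists
  obtain ⟨u₂, hu₂⟩ :=
    (hlim1.eventually_const_lt (mul_lt_of_lt_one_left hpos (Real.sigmoid_lt_one x))).exists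
  obtain ⟨u, hu⟩ := mem_range_of_exists_le_of_exists_ge hcont ⟨u₁, hu₁.le⟩ ⟨u₂, hu₂.le⟩
  refine ⟨u, Prod.ext ?_ (hsb u)⟩
  simp only [flattening, hsb, hu, mul_div_assoc, div_self hpos.ne', mul_one, logit_sigmoid]

end IsFlatteningFamily

end Flattening

section LineBundle

theorem strictMono_of_isPreconnected {T : Type*} [TopologicalSpace T] {S : Set T}
    (hS : IsPreconnected S) {g : T → ℝ → ℝ} (hc : ∀ u, ContinuousOn (fun t => g t u) S)
    (hgc : ∀ t ∈ S, Continuous (g t)) (hi : ∀ t ∈ S, Function.Injective (g t)) {t₀ : T}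
    (ht₀ : t₀ ∈ S) (h₀ : StrictMono (g t₀)) : ∀ t ∈ S, StrictMono (g t) := by
  intro t ht
  refine ((hgc t ht).strictMono_of_inj (hi t ht)).resolve_right fun hanti => ?_
  have hdiff : ContinuousOn (fun t => g t 1 - g t 0) S := (hc 1).sub (hc 0)
  obtain ⟨s, hs, hs0⟩ := hS.intermediate_value ht ht₀ hdiff
    ⟨sub_nonpos.2 (hanti zero_lt_one).le, sub_nonneg.2 (h₀ zero_lt_one).le⟩
  exact one_ne_zero (hi s hs (sub_eq_zero.1 hs0))

section CoordChange

variable {B E : Type*} [TopologicalSpace B] [TopologicalSpace E] {π : E → B}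

theorem continuousOn_coordChange_base {F : Type*} [TopologicalSpace F]
    (e₁ e₂ : Bundle.Trivialization F π) (u : F) :
    ContinuousOn (fun b => e₁.coordChange e₂ b u) (e₁.baseSet ∩ e₂.baseSet) := by
  have hsymm : ContinuousOn (fun b => e₁.toOpenPartialHomeomorph.symm (b, u))
      (e₁.baseSet ∩ e₂.baseSet) :=
    e₁.toOpenPartialHomeomorph.continuousOn_symm.comp (by fun_prop) fun b hb => e₁.mem_target.2 hb.1
  refine continuous_snd.comp_continuousOn (e₂.continuousOn_toFun.comp hsymm fun b hb => ?_)
  change e₁.toOpenPartialHomeomorph.symm (b, u) ∈ e₂.source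
  rw [e₂.mem_source, e₁.proj_symm_apply' hb.1]
  exact hb.2

theorem strictMono_coordChange (e₁ e₂ : Bundle.Trivialization ℝ π) {S : Set B}
    (hS : IsPreconnected S) (h₁ : S ⊆ e₁.baseSet) (h₂ : S ⊆ e₂.baseSet) {b₀ : B} (hb₀ : b₀ ∈ S)
    (h : StrictMono (e₁.coordChange e₂ b₀)) : ∀ b ∈ S, StrictMono (e₁.coordChange e₂ b) :=
  strictMono_of_isPreconnected hS
    (fun u => (continuousOn_coordChange_base e₁ e₂ u).mono (subset_inter h₁ h₂))
    (fun _ hb => e₁.continuous_coordChange e₂ (h₁ hb) (h₂ hb))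
    (fun _ hb => (e₁.coordChangeHomeomorph e₂ (h₁ hb) (h₂ hb)).injective) hb₀ h

theorem exists_strictMono_coordChange (e₀ e : Bundle.Trivialization ℝ π) {b : B}
    (h₀ : b ∈ e₀.baseSet) (h : b ∈ e.baseSet) :
    ∃ e' : Bundle.Trivialization ℝ π, e'.baseSet = e.baseSet ∧
      StrictMono (e₀.coordChange e' b) := by
  rcases (e₀.continuous_coordChange e h₀ h).strictMono_of_inj
    (e₀.coordChangeHomeomorph e h₀ h).injective with hm | ha
  · exact ⟨e, rfl, hm⟩
  · exact ⟨e.transFiberHomeomorph (Homeomorph.neg ℝ), rfl, fun x y hxy => neg_lt_neg (ha hxy)⟩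

theorem strictMono_coordChange_symm (e₁ e₂ : Bundle.Trivialization ℝ π) {b : B}
    (h₁ : b ∈ e₁.baseSet) (h₂ : b ∈ e₂.baseSet) (h : StrictMono (e₁.coordChange e₂ b)) :
    StrictMono (e₂.coordChange e₁ b) := fun x y hxy => by
  rwa [← h.lt_iff_lt, e₂.coordChange_coordChange _ _ h₂ h₁, e₂.coordChange_coordChange _ _ h₂ h₁,
    e₂.coordChange_same_apply h₂, e₂.coordChange_same_apply h₂]

theorem strictMono_coordChange_trans (e₁ e₂ e₃ : Bundle.Trivialization ℝ π) {b : B}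
    (h₁ : b ∈ e₁.baseSet) (h₂ : b ∈ e₂.baseSet) (h₁₂ : StrictMono (e₁.coordChange e₂ b))
    (h₂₃ : StrictMono (e₂.coordChange e₃ b)) : StrictMono (e₁.coordChange e₃ b) := fun x y hxy => by
  simpa only [e₁.coordChange_coordChange _ _ h₁ h₂] using h₂₃ (h₁₂ hxy)

end CoordChange

/-- Compatibly oriented trivializations of a bundle of lines, the `j`-th one defined where the
function `χ j` is positive. -/
structure IsOrientedCover {B E J : Type*} [TopologicalSpace B] [TopologicalSpace E] {π : E → B}
    (e : J → Bundle.Trivialization ℝ π) (χ : J → B → ℝ) : Prop where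
  continuous_height : ∀ j, Continuous (χ j)
  height_mem : ∀ j b, χ j b ∈ Icc (0 : ℝ) 1
  exists_pos : ∀ b, ∃ j, 0 < χ j b
  mem_baseSet : ∀ j b, 0 < χ j b → b ∈ (e j).baseSet
  strictMono : ∀ i j b, 0 < χ i b → 0 < χ j b → StrictMono ((e i).coordChange (e j) b)

namespace IsOrientedCover

variable {B E J : Type*} [TopologicalSpace B] [TopologicalSpace E] {π : E → B}
  {e : J → Bundle.Trivialization ℝ π} {χ : J → B → ℝ}

theorem mem_source (h : IsOrientedCover e χ) {j : J} {q : E} (hq : 0 < χ j (π q)) :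
    q ∈ (e j).source :=
  (e j).mem_source.2 (h.mem_baseSet j _ hq)

theorem continuous_proj (h : IsOrientedCover e χ) : Continuous π :=
  continuous_iff_continuousAt.2 fun q =>
    have ⟨_, hj⟩ := h.exists_pos (π q)
    (e _).continuousAt_proj (h.mem_source hj)

/-- The `j`-th fibre coordinate, transported to `(0, 1)` and weighted by `χ j`. Outside of the
trivialization it takes junk values, which the factor `χ j` turns into `0`. -/
noncomputable def coord (e : J → Bundle.Trivialization ℝ π) (χ : J → B → ℝ) (j : J) (q : E) : ℝ :=
  χ j (π q) * Real.sigmoid (e j q).2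

theorem coord_nonneg (h : IsOrientedCover e χ) (j : J) (q : E) : 0 ≤ coord e χ j q :=
  mul_nonneg (h.height_mem j _).1 (Real.sigmoid_nonneg _)

theorem coord_le (h : IsOrientedCover e χ) (j : J) (q : E) : coord e χ j q ≤ χ j (π q) :=
  mul_le_of_le_one_right (h.height_mem j _).1 (Real.sigmoid_le_one _)

theorem continuous_coord (h : IsOrientedCover e χ) (j : J) : Continuous (coord e χ j) := by
  have hχ : Continuous fun q => χ j (π q) := (h.continuous_height j).comp h.continuous_proj
  refine continuous_iff_continuousAt.2 fun q => ?_
  rcases (h.height_mem j (π q)).1.eq_or_lt with hq | hq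
  · have hlim : Tendsto (fun q => χ j (π q)) (𝓝 q) (𝓝 0) := hq ▸ hχ.tendsto q
    have hval : coord e χ j q = 0 := by rw [coord, ← hq, zero_mul]
    rw [ContinuousAt, hval]
    exact squeeze_zero (h.coord_nonneg j) (h.coord_le j) hlim
  · exact hχ.continuousAt.mul (continuous_sigmoid.continuousAt.comp
      (continuous_snd.continuousAt.comp ((e j).continuousAt (h.mem_source hq))))

theorem coord_symm (h : IsOrientedCover e χ) (i : J) {j : J} {b : B} (hj : 0 < χ j b) (u : ℝ) :
    coord e χ i ((e j).toOpenPartialHomeomorph.symm (b, u)) =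
      χ i b * Real.sigmoid ((e j).coordChange (e i) b u) := by
  rw [coord, (e j).proj_symm_apply' (h.mem_baseSet j b hj)]
  rfl

theorem strictMono_coord (h : IsOrientedCover e χ) {i j : J} {b : B} (hi : 0 < χ i b)
    (hj : 0 < χ j b) :
    StrictMono fun u => coord e χ i ((e j).toOpenPartialHomeomorph.symm (b, u)) := by
  simp only [h.coord_symm i hj]
  exact (Real.sigmoid_strictMono.comp (h.strictMono j i b hj hi)).const_mul hi

theorem coord_symm_of_height_eq_zero (h : IsOrientedCover e χ) {i j : J} {b : B} (hi : χ i b = 0)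
    (hj : 0 < χ j b) (u : ℝ) : coord e χ i ((e j).toOpenPartialHomeomorph.symm (b, u)) = 0 := by
  rw [h.coord_symm i hj, hi, zero_mul]

theorem monotone_coord (h : IsOrientedCover e χ) (i : J) {j : J} {b : B} (hj : 0 < χ j b) :
    Monotone fun u => coord e χ i ((e j).toOpenPartialHomeomorph.symm (b, u)) := by
  rcases (h.height_mem i b).1.eq_or_lt with hi | hi
  · simp only [h.coord_symm_of_height_eq_zero hi.symm hj]
    exact monotone_const
  · exact (h.strictMono_coord hi hj).monotone

theorem tendsto_coord_atBot (h : IsOrientedCover e χ) (i : J) {j : J} {b : B} (hj : 0 < χ j b) :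
    Tendsto (fun u => coord e χ i ((e j).toOpenPartialHomeomorph.symm (b, u))) atBot (𝓝 0) := by
  rcases (h.height_mem i b).1.eq_or_lt with hi | hi
  · simp only [h.coord_symm_of_height_eq_zero hi.symm hj]
    exact tendsto_const_nhds
  · simp only [h.coord_symm i hj]
    simpa using (Real.tendsto_sigmoid_atBot.comp (tendsto_atBot_of_strictMono_of_surjective
      (h.strictMono j i b hj hi) ((e j).coordChangeHomeomorph (e i) (h.mem_baseSet j b hj)
        (h.mem_baseSet i b hi)).surjective)).const_mul (χ i b)

theorem tendsto_coord_atTop (h : IsOrientedCover e χ) (i : J) {j : J} {b : B} (hj : 0 < χ j b) :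
    Tendsto (fun u => coord e χ i ((e j).toOpenPartialHomeomorph.symm (b, u))) atTop
      (𝓝 (χ i b)) := by
  rcases (h.height_mem i b).1.eq_or_lt with hi | hi
  · simp only [h.coord_symm_of_height_eq_zero hi.symm hj, ← hi]
    exact tendsto_const_nhds
  · simp only [h.coord_symm i hj]
    simpa using (Real.tendsto_sigmoid_atTop.comp (tendsto_atTop_of_strictMono_of_surjective
      (h.strictMono j i b hj hi) ((e j).coordChangeHomeomorph (e i) (h.mem_baseSet j b hj)
        (h.mem_baseSet i b hi)).surjective)).const_mul (χ i b)

theorem isFlatteningFamily_coord (h : IsOrientedCover e χ) :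
    IsFlatteningFamily π (coord e χ) χ where
  continuous_level := h.continuous_proj
  continuous := h.continuous_coord
  continuous_bound := h.continuous_height
  nonneg := h.coord_nonneg
  le_bound := h.coord_le
  bound_mem := h.height_mem
  exists_chart q := by
    obtain ⟨j, hj⟩ := h.exists_pos (π q)
    have hpos : IsOpen {b | 0 < χ j b} := isOpen_lt continuous_const (h.continuous_height j)
    let e' := (e j).restrOpen {b | 0 < χ j b} hpos
    refine ⟨e'.toOpenPartialHomeomorph.transHomeomorph (Homeomorph.prodComm B ℝ),
      (e j).baseSet ∩ {b | 0 < χ j b}, e'.mem_source.2 ⟨h.mem_baseSet j _ hj, hj⟩, ?_,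
      fun x hx => e'.coe_fst hx,
      fun b hb => ⟨fun i => h.monotone_coord i hb.2, j, h.strictMono_coord hb.2 hb.2⟩⟩
    ext ⟨u, b⟩
    exact e'.mem_target.trans ⟨fun hb => ⟨mem_univ _, hb⟩, fun hb => hb.2⟩

theorem injective_flattening (h : IsOrientedCover e χ) {w : J → ℝ} (hw : ∀ j, 0 < w j)
    (hs : Summable w) : Function.Injective (flattening w π (coord e χ) χ) := by
  intro q q' hqq
  have hπ : π q = π q' := congrArg Prod.snd hqq
  obtain ⟨j, hj⟩ := h.exists_pos (π q)
  have hsymm : (e j).toOpenPartialHomeomorph.symm (π q, (e j q).2) = q :=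
    (e j).symm_apply_mk_proj (h.mem_source hj)
  have hsymm' : (e j).toOpenPartialHomeomorph.symm (π q, (e j q').2) = q' := by
    rw [hπ]
    exact (e j).symm_apply_mk_proj (h.mem_source (hπ ▸ hj))
  have hmono := h.isFlatteningFamily_coord.strictMono_flattening hw hs
    (fun u => (e j).proj_symm_apply' (h.mem_baseSet j _ hj)) (fun i => h.monotone_coord i hj)
    ⟨j, h.strictMono_coord hj hj⟩
  have hcoord : (e j q).2 = (e j q').2 := hmono.injective (by simp only [hsymm, hsymm', hqq])
  rw [← hsymm, ← hsymm', hcoord]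

theorem surjective_flattening (h : IsOrientedCover e χ) {w : J → ℝ} (hw : ∀ j, 0 < w j)
    (hs : Summable w) : Function.Surjective (flattening w π (coord e χ) χ) := by
  rintro ⟨x, b⟩
  obtain ⟨j, hj⟩ := h.exists_pos b
  have hb := h.mem_baseSet j b hj
  obtain ⟨u, hu⟩ := h.isFlatteningFamily_coord.exists_flattening_eq hw hs
    ((e j).toOpenPartialHomeomorph.continuousOn_symm.comp_continuous (by fun_prop)
      fun u => (e j).mem_target.2 hb)
    (fun u => (e j).proj_symm_apply' hb) (h.tendsto_coord_atBot · hj)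
    (h.tendsto_coord_atTop · hj) x
  exact ⟨_, hu⟩

theorem exists_homeomorph (h : IsOrientedCover e χ) [Countable J] :
    ∃ Ψ : E ≃ₜ ℝ × B, ∀ q, (Ψ q).2 = π q := by
  have := Encodable.ofCountable J
  obtain ⟨w, hw, c, hc, -⟩ := posSumOfEncodable one_pos J
  have hs : Summable w := hc.summable
  exact ⟨(Equiv.ofBijective _ ⟨h.injective_flattening hw hs,
    h.surjective_flattening hw hs⟩).toHomeomorphOfContinuousOpen
      (h.isFlatteningFamily_coord.continuous_flattening hw hs)
      (h.isFlatteningFamily_coord.isOpenMap_flattening hw hs), fun q => rfl⟩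

end IsOrientedCover

section RealBase

variable {E : Type*} [TopologicalSpace E] {π : E → ℝ}

theorem exists_trivialization_Icc {F : Type*} [TopologicalSpace F]
    (h : ∀ b, ∃ e : Bundle.Trivialization F π, b ∈ e.baseSet) {a b : ℝ} (hab : a ≤ b) :
    ∃ e : Bundle.Trivialization F π, Icc a b ⊆ e.baseSet := by
  choose e he using h
  obtain ⟨t, ht₀, hmono, ⟨m, hm⟩, ht⟩ := exists_monotone_Icc_subset_open_cover_Icc hab
    (c := fun c => Subtype.val ⁻¹' (e c).baseSet)
    (fun c => (e c).open_baseSet.preimage continuous_subtype_val)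
    fun c _ => mem_iUnion.2 ⟨c, he c⟩
  have hstep : ∀ n, ∃ e' : Bundle.Trivialization F π, Icc a (t n : ℝ) ⊆ e'.baseSet := by
    intro n
    induction n with
    | zero => exact ⟨e a, by simpa [ht₀] using he a⟩
    | succ n ih =>
      obtain ⟨e', he'⟩ := ih
      obtain ⟨c, hc⟩ := ht n
      have hc' : Icc (t n : ℝ) (t (n + 1)) ⊆ (e c).baseSet := fun x hx =>
        hc (a := ⟨x, (t n).2.1.trans hx.1, hx.2.trans (t (n + 1)).2.2⟩) hx
      refine ⟨e'.piecewiseLe (e c) (t n) (he' ⟨(t n).2.1, le_rfl⟩)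
        (hc' ⟨le_rfl, hmono n.le_succ⟩), subset_ite.2 ⟨fun x hx => he' ⟨hx.1.1, hx.2⟩,
        fun x hx => hc' ⟨(not_le.1 hx.2).le, hx.1.2⟩⟩⟩
  simpa [hm m le_rfl] using hstep m

/-- The bump function that is positive exactly on `(-(n + 1), n + 1)`. -/
noncomputable def bump (n : ℕ) (b : ℝ) : ℝ := max 0 (min 1 (n + 1 - |b|))

theorem bump_pos_iff {n : ℕ} {b : ℝ} : 0 < bump n b ↔ b ∈ Ioo (-(n + 1) : ℝ) (n + 1) := by
  simp only [bump, lt_max_iff, lt_irrefl, false_or, lt_min_iff, one_pos, true_and, sub_pos, abs_lt,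
    mem_Ioo]

theorem exists_isOrientedCover (h : ∀ b, ∃ e : Bundle.Trivialization ℝ π, b ∈ e.baseSet) :
    ∃ e : ℕ → Bundle.Trivialization ℝ π, IsOrientedCover e bump := by
  have h0 : ∀ n : ℕ, (0 : ℝ) ∈ Ioo (-(n + 1) : ℝ) (n + 1) := fun n =>
    ⟨by linarith [n.cast_nonneg (α := ℝ)], by positivity⟩
  choose e' he' using fun n : ℕ => exists_trivialization_Icc h ((h0 n).1.trans (h0 n).2).le
  have hmem : ∀ n, (0 : ℝ) ∈ (e' n).baseSet := fun n => he' n (Ioo_subset_Icc_self (h0 n))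
  choose e hbase hmono using fun n => exists_strictMono_coordChange (e' 0) (e' n) (hmem 0) (hmem n)
  replace he' : ∀ n : ℕ, Ioo (-(n + 1) : ℝ) (n + 1) ⊆ (e n).baseSet := fun n =>
    hbase n ▸ Ioo_subset_Icc_self.trans (he' n)
  have hmono₀ : ∀ i j, StrictMono ((e i).coordChange (e j) 0) := fun i j =>
    strictMono_coordChange_trans _ (e' 0) _ (he' i (h0 i)) (hmem 0)
      (strictMono_coordChange_symm _ _ (hmem 0) (he' i (h0 i)) (hmono i)) (hmono j)
  refine ⟨e, ⟨fun n => by unfold bump; fun_prop, fun n b => ⟨le_max_left _ _,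
    max_le zero_le_one (min_le_left _ _)⟩, fun b => ?_, fun n b hb => he' n (bump_pos_iff.1 hb),
    fun i j b hi hj => ?_⟩⟩
  · obtain ⟨n, hn⟩ := exists_nat_gt |b|
    exact ⟨n, bump_pos_iff.2 (abs_lt.1 (by linarith))⟩
  · exact strictMono_coordChange _ _ (ordConnected_Ioo.inter ordConnected_Ioo).isPreconnected
      (inter_subset_left.trans (he' i)) (inter_subset_right.trans (he' j)) ⟨h0 i, h0 j⟩
      (hmono₀ i j) b ⟨bump_pos_iff.1 hi, bump_pos_iff.1 hj⟩

theorem exists_homeomorph_of_locally_trivial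
    (h : ∀ b, ∃ e : Bundle.Trivialization ℝ π, b ∈ e.baseSet) :
    ∃ Ψ : E ≃ₜ ℝ × ℝ, ∀ q, (Ψ q).2 = π q := by
  obtain ⟨e, he⟩ := exists_isOrientedCover h
  exact he.exists_homeomorph

end RealBase

end LineBundle

section Pullback

theorem exists_trivialization_of_isOpenEmbedding {B E F : Type*} [TopologicalSpace B]
    [TopologicalSpace E] [TopologicalSpace F] [Nonempty F] {π : E → B} {V : Set B} (hV : IsOpen V)
    (hVn : V.Nonempty) {κ : V × F → E} (hκ : IsOpenEmbedding κ) (hπ : ∀ q, π (κ q) = q.1)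
    (hrange : range κ = π ⁻¹' V) : ∃ e : Bundle.Trivialization F π, e.baseSet = V := by
  have := hVn.to_subtype
  have hι : IsOpenEmbedding (Prod.map Subtype.val id : V × F → B × F) :=
    hV.isOpenEmbedding_subtypeVal.prodMap .id
  let e := (hκ.toOpenPartialHomeomorph κ).symm.trans (hι.toOpenPartialHomeomorph _)
  refine ⟨⟨e, V, hV, ?_, ?_, ?_⟩, rfl⟩
  · simp [e, hrange]
  · simp [e, range_prodMap, prod_univ]
  · intro q hq
    obtain ⟨q, rfl⟩ : q ∈ range κ := by simpa [e] using hq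
    have hinv : (hκ.toOpenPartialHomeomorph κ).symm (κ q) = q :=
      (hκ.toOpenPartialHomeomorph κ).left_inv (by simp)
    change ((hκ.toOpenPartialHomeomorph κ).symm (κ q)).1.1 = _
    rw [hinv, hπ]

variable {X B : Type*} [TopologicalSpace X] [TopologicalSpace B] {Δ : Setoid X}

/-- The pull-back of the family of leaves along a map `γ` to the leaf space. -/
abbrev LeafPullback (Δ : Setoid X) (γ : B → Quotient Δ) : Type _ :=
  {q : B × X // γ q.1 = Quotient.mk Δ q.2}

theorem IsStrip.exists_trivialization {T : Type*} [TopologicalSpace T] {e : ℝ × T → X}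
    (he : IsStrip Δ e) {γ : B → Quotient Δ} (hγ : Continuous γ)
    (hne : (γ ⁻¹' range (base Δ e)).Nonempty) :
    ∃ e' : Bundle.Trivialization ℝ (fun q : LeafPullback Δ γ => q.1.1),
      e'.baseSet = γ ⁻¹' range (base Δ e) := by
  let β : γ ⁻¹' range (base Δ e) → T := fun s =>
    he.isOpenEmbedding_base.isEmbedding.toHomeomorph.symm ⟨γ s, s.2⟩
  have hβ : ∀ s, base Δ e (β s) = γ s := fun s =>
    congrArg Subtype.val (he.isOpenEmbedding_base.isEmbedding.toHomeomorph.apply_symm_apply _)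
  have hβc : Continuous β := by fun_prop
  let κ : (γ ⁻¹' range (base Δ e)) × ℝ → LeafPullback Δ γ := fun q =>
    ⟨(q.1, e (q.2, β q.1)), ((he.mk_apply _ _).trans (hβ q.1)).symm⟩
  have hgraph : IsEmbedding fun q : (γ ⁻¹' range (base Δ e)) × ℝ => (q.1, (q.2, β q.1)) :=
    Function.LeftInverse.isEmbedding (f := fun p => (p.1, p.2.1)) (fun _ => rfl) (by fun_prop)
      (by fun_prop)
  have hec := he.isOpenEmbedding.continuous
  have hκc : Continuous κ := by fun_prop
  have hκ : IsEmbedding κ := .of_comp hκc continuous_subtype_val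
    ((IsEmbedding.subtypeVal.prodMap he.isOpenEmbedding.isEmbedding).comp hgraph)
  have hopen := he.isOpenEmbedding_base.isOpen_range.preimage hγ
  have hrange : range κ = (fun q : LeafPullback Δ γ => q.1.1) ⁻¹' (γ ⁻¹' range (base Δ e)) := by
    refine Subset.antisymm (range_subset_iff.2 fun q => q.1.2) ?_
    rintro ⟨⟨s, x⟩, hsx⟩ hs
    obtain ⟨u, hu⟩ := he.mk_eq_base (hsx.symm.trans (hβ ⟨s, hs⟩).symm)
    exact ⟨(⟨s, hs⟩, u), Subtype.ext (Prod.ext rfl hu)⟩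
  exact exists_trivialization_of_isOpenEmbedding hopen hne
    ⟨hκ, hrange ▸ hopen.preimage (by fun_prop)⟩ (fun _ => rfl) hrange

theorem LocallyStrip.exists_trivialization (h : LocallyStrip Δ) {γ : B → Quotient Δ}
    (hγ : Continuous γ) (b : B) :
    ∃ e : Bundle.Trivialization ℝ (fun q : LeafPullback Δ γ => q.1.1), b ∈ e.baseSet := by
  obtain ⟨x, hx⟩ := Quotient.exists_rep (γ b)
  obtain ⟨J, e, he, ⟨u, t⟩, rfl⟩ := h x
  have hb : b ∈ γ ⁻¹' range (IsStrip.base Δ e) := ⟨t, (he.mk_apply u t).symm.trans hx⟩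
  obtain ⟨e', he'⟩ := he.exists_trivialization hγ ⟨b, hb⟩
  exact ⟨e', he' ▸ hb⟩

theorem LocallyStrip.exists_pullback_homeomorph (h : LocallyStrip Δ) {γ : ℝ → Quotient Δ}
    (hγ : Continuous γ) : ∃ Θ : (ℝ × ℝ) ≃ₜ LeafPullback Δ γ, ∀ q, (Θ q).1.1 = q.2 := by
  obtain ⟨Ψ, hΨ⟩ := exists_homeomorph_of_locally_trivial (h.exists_trivialization hγ)
  exact ⟨Ψ.symm, fun q => by rw [← hΨ, Ψ.apply_symm_apply]⟩

theorem isOpenEmbedding_snd_leafPullback {γ : B → Quotient Δ} (hγ : IsOpenEmbedding γ) :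
    IsOpenEmbedding fun q : LeafPullback Δ γ => q.1.2 := by
  refine .of_continuous_injective_isOpenMap (by fun_prop) (fun q q' hqq => ?_)
    (isOpenMap_iff_nhds_le.2 ?_)
  · refine Subtype.ext (Prod.ext (hγ.injective ?_) hqq)
    rw [q.2, q'.2]
    exact congrArg _ hqq
  · rintro ⟨⟨s, x⟩, hsx⟩ W hW
    rw [mem_map, nhds_subtype_eq_comap, mem_comap] at hW
    obtain ⟨W', hW', hsub⟩ := hW
    obtain ⟨S, hS, N, hN, hSN⟩ := mem_nhds_prod_iff.1 hW'
    have hleaf : Quotient.mk Δ ⁻¹' (γ '' S) ∈ 𝓝 x := by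
      have himage := hγ.isOpenMap.image_mem_nhds hS
      rw [show γ s = Quotient.mk Δ x from hsx] at himage
      exact continuous_quotient_mk'.continuousAt himage
    filter_upwards [hN, hleaf]
    rintro z hzN ⟨s', hs', hz⟩
    exact @hsub ⟨(s', z), hz⟩ (hSN ⟨hs', hzN⟩)

section Parametrization

variable {γ : ℝ → Quotient Δ} {Θ : (ℝ × ℝ) ≃ₜ LeafPullback Δ γ}

theorem mk_pullback_apply (hΘ : ∀ q, (Θ q).1.1 = q.2) (q : ℝ × ℝ) :
    Quotient.mk Δ (Θ q).1.2 = γ q.2 := by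
  rw [← (Θ q).2, hΘ]

theorem exists_pullback_eq (hΘ : ∀ q, (Θ q).1.1 = q.2) {s : ℝ} {x : X}
    (hx : γ s = Quotient.mk Δ x) : ∃ u, (Θ (u, s)).1.2 = x := by
  obtain ⟨⟨u, s'⟩, hus⟩ := Θ.surjective ⟨(s, x), hx⟩
  obtain rfl : s' = s := by simpa [hus] using (hΘ (u, s')).symm
  exact ⟨u, by rw [hus]⟩

theorem pullback_injective (hΘ : ∀ q, (Θ q).1.1 = q.2) (s : ℝ) :
    Function.Injective fun u => (Θ (u, s)).1.2 := by
  intro u v huv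
  have h : Θ (u, s) = Θ (v, s) :=
    Subtype.ext (Prod.ext ((hΘ (u, s)).trans (hΘ (v, s)).symm) huv)
  exact congrArg Prod.fst (Θ.injective h)

end Parametrization

theorem LocallyStrip.exists_strip_of_isOpenEmbedding (h : LocallyStrip Δ) {γ : ℝ → Quotient Δ}
    (hγ : IsOpenEmbedding γ) : ∃ e : ℝ × ℝ → X, IsStrip Δ e ∧
      range e = Quotient.mk Δ ⁻¹' range γ := by
  obtain ⟨Θ, hΘ⟩ := h.exists_pullback_homeomorph hγ.continuous
  have hmk := mk_pullback_apply hΘ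
  refine ⟨fun q => (Θ q).1.2, ⟨(isOpenEmbedding_snd_leafPullback hγ).comp Θ.isOpenEmbedding,
    fun t => ?_⟩, Subset.antisymm ?_ ?_⟩
  · convert preimage_mk_mem_classes (Δ := Δ) (Θ (0, t)).1.2 using 1
    refine Subset.antisymm (range_subset_iff.2 fun u => ?_) fun x hx => ?_
    · simp only [mem_preimage, mem_singleton_iff, hmk]
    · exact exists_pullback_eq hΘ ((hmk (0, t)).symm.trans (Eq.symm hx))
  · exact range_subset_iff.2 fun q => ⟨q.2, (hmk q).symm⟩
  · rintro x ⟨s, hs⟩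
    obtain ⟨u, hu⟩ := exists_pullback_eq hΘ hs
    exact ⟨_, hu⟩

end Pullback

section Foliated

variable {X : Type*} [TopologicalSpace X] {Δ : Setoid X}

theorem isFoliated_of_iff {M : Type*} [TopologicalSpace M] {Γ : Setoid M} {A : Set X}
    {h : M ≃ₜ A} (hA : ∀ x ∈ A, ∀ y, Quotient.mk Δ y = Quotient.mk Δ x → y ∈ A)
    (hiff : ∀ a b, Γ a b ↔ Quotient.mk Δ (h a : X) = Quotient.mk Δ (h b : X)) :
    IsFoliated Γ Δ h := by
  rintro _ ⟨a, rfl⟩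
  convert preimage_mk_mem_classes (Δ := Δ) (h a : X) using 1
  ext x
  constructor
  · rintro ⟨b, hb, rfl⟩
    exact (hiff b a).1 hb
  · intro (hx : Quotient.mk Δ x = Quotient.mk Δ (h a : X))
    refine ⟨h.symm ⟨x, hA _ (h a).2 x hx⟩, ?_, by simp⟩
    refine (hiff _ a).2 ?_
    simpa using hx

/-- The subset `ℝ × J` of the plane as a product. -/
def stripHomeomorph (J : Set ℝ) : (univ ×ˢ J : Set (ℝ × ℝ)) ≃ₜ ℝ × J where
  toFun p := (p.1.1, ⟨p.1.2, p.2.2⟩)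
  invFun q := ⟨(q.1, q.2), ⟨mem_univ _, q.2.2⟩⟩
  left_inv _ := rfl
  right_inv _ := rfl
  continuous_toFun := by fun_prop
  continuous_invFun := by fun_prop

theorem canonicalFoliation_prod_iff {J : Set ℝ} (p q : (univ ×ˢ J : Set (ℝ × ℝ))) :
    canonicalFoliation (univ ×ˢ J) p q ↔ p.1.2 = q.1.2 :=
  ⟨fun h => h.1, fun h => ⟨h, fun _ _ => ⟨mem_univ _, p.2.2⟩⟩⟩

theorem IsStrip.foliatedHomeomorphic {e : ℝ × Ioo (-1 : ℝ) 1 → X} (he : IsStrip Δ e) :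
    FoliatedHomeomorphic (canonicalFoliation openStrip) Δ (range e) := by
  refine ⟨(stripHomeomorph _).trans he.isOpenEmbedding.isEmbedding.toHomeomorph,
    isFoliated_of_iff ?_ fun p q => ?_⟩
  · rintro _ ⟨⟨u, t⟩, rfl⟩ y hy
    rw [he.mk_apply] at hy
    obtain ⟨v, rfl⟩ := he.mk_eq_base hy
    exact ⟨_, rfl⟩
  · refine (canonicalFoliation_prod_iff (J := Ioo (-1) 1) p q).trans ?_
    change _ ↔ Quotient.mk Δ (e (p.1.1, ⟨p.1.2, p.2.2⟩)) = Quotient.mk Δ (e (q.1.1, ⟨q.1.2, q.2.2⟩))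
    rw [he.mk_apply, he.mk_apply, he.base_injective.eq_iff,
      Subtype.mk.injEq]

theorem IsFoliated.isStrip {Q : Set X} (hQ : IsOpen Q) {φ : openStrip ≃ₜ Q}
    (hφ : IsFoliated (canonicalFoliation openStrip) Δ φ) :
    IsStrip Δ fun q : ℝ × Ioo (-1 : ℝ) 1 => (φ ((stripHomeomorph _).symm q) : X) := by
  refine ⟨hQ.isOpenEmbedding_subtypeVal.comp
    (φ.isOpenEmbedding.comp (stripHomeomorph _).symm.isOpenEmbedding), fun t => ?_⟩
  convert hφ _ ((canonicalFoliation openStrip).mem_classes ((stripHomeomorph _).symm (0, t)))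
    using 1
  ext x
  constructor
  · rintro ⟨u, rfl⟩
    exact ⟨(stripHomeomorph _).symm (u, t), (canonicalFoliation_prod_iff _ _).2 rfl, rfl⟩
  · rintro ⟨p, hp, rfl⟩
    refine ⟨p.1.1, ?_⟩
    have hp : p.1.2 = t := ((canonicalFoliation_prod_iff _ _).1 hp)
    refine congrArg (fun p => (φ p : X)) (Subtype.ext (Prod.ext rfl hp.symm))

end Foliated

section Glue

variable {X : Type*} [TopologicalSpace X] {Δ : Setoid X}

/-- The straight line isotopy from the identity, at time `-1`, to `g`, at time `1`. -/
noncomputable def isotopy (g : ℝ → ℝ) (q : ℝ × Icc (-1 : ℝ) 1) : ℝ :=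
  (1 - q.2) / 2 * q.1 + (1 + q.2) / 2 * g q.1

theorem strictMono_isotopy {g : ℝ → ℝ} (hg : StrictMono g) (t : Icc (-1 : ℝ) 1) :
    StrictMono fun x => isotopy g (x, t) := by
  obtain ⟨t, ht1, ht2⟩ := t
  intro x y hxy
  have hgxy := hg hxy
  have h1 : 0 ≤ (1 - t) / 2 := by linarith
  have h2 : 0 ≤ (1 + t) / 2 := by linarith
  simp only [isotopy]
  rcases h1.eq_or_lt with h | h
  · rw [← h, show (1 + t) / 2 = 1 by linarith]
    linarith
  · nlinarith [mul_lt_mul_of_pos_left hxy h, mul_le_mul_of_nonneg_left hgxy.le h2]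

theorem surjective_isotopy {g : ℝ → ℝ} (hg : Monotone g) (hgc : Continuous g)
    (hs : Function.Surjective g) (t : Icc (-1 : ℝ) 1) :
    Function.Surjective fun x => isotopy g (x, t) := by
  intro y
  obtain ⟨z, rfl⟩ := hs y
  have h1 : 0 ≤ (1 - (t : ℝ)) / 2 := by linarith [t.2.2]
  have h2 : 0 ≤ (1 + (t : ℝ)) / 2 := by linarith [t.2.1]
  refine mem_range_of_exists_le_of_exists_ge (by unfold isotopy; fun_prop)
    ⟨min (g z) z, ?_⟩ ⟨max (g z) z, ?_⟩
  · have h3 := mul_le_mul_of_nonneg_left (min_le_left (g z) z) h1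
    have h4 := mul_le_mul_of_nonneg_left (hg (min_le_right (g z) z)) h2
    simp only [isotopy]
    linarith
  · have h3 := mul_le_mul_of_nonneg_left (le_max_left (g z) z) h1
    have h4 := mul_le_mul_of_nonneg_left (hg (le_max_right (g z) z)) h2
    simp only [isotopy]
    linarith

theorem exists_isotopy_homeomorph {g : ℝ → ℝ} (hg : StrictMono g) (hs : Function.Surjective g) :
    ∃ Λ : (ℝ × Icc (-1 : ℝ) 1) ≃ₜ ℝ × Icc (-1 : ℝ) 1, ∀ q, Λ q = (isotopy g q, q.2) := by
  have hgc : Continuous g := (hg.orderIsoOfSurjective g hs).continuous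
  have hc : Continuous (isotopy g) := by unfold isotopy; fun_prop
  have hbij : Function.Bijective fun q : ℝ × Icc (-1 : ℝ) 1 => (isotopy g q, q.2) := by
    constructor
    · rintro ⟨x, t⟩ ⟨y, s⟩ h
      obtain ⟨h, rfl⟩ := Prod.mk.inj h
      rw [(strictMono_isotopy hg t).injective h]
    · rintro ⟨y, t⟩
      obtain ⟨x, hx⟩ := surjective_isotopy hg.monotone hgc hs t y
      exact ⟨(x, t), Prod.ext hx rfl⟩
  exact ⟨(Equiv.ofBijective _ hbij).toHomeomorphOfContinuousOpen (hc.prodMk continuous_snd)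
    (isOpenMap_prodMk_snd hc (strictMono_isotopy hg)), fun q => rfl⟩

theorem IsSimpleLoop.gluedFoliation_iff {γ : ℝ → Quotient Δ} {Z : Set (Quotient Δ)}
    (hγ : IsSimpleLoop γ Z) {ρ : ℝ → ℝ} {p q : closedStrip} :
    gluedFoliation ρ (Quot.mk _ p) (Quot.mk _ q) ↔ γ p.1.2 = γ q.1.2 := by
  have hline : ∀ p q : closedStrip, p.1.2 = q.1.2 →
      gluedFoliation ρ (Quot.mk _ p) (Quot.mk _ q) := fun p q hpq =>
    .rel _ _ ⟨p, q, (canonicalFoliation_prod_iff (J := Icc (-1) 1) p q).2 hpq, rfl, rfl⟩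
  have hcross : ∀ p q : closedStrip, p.1.2 = -1 → q.1.2 = 1 →
      gluedFoliation ρ (Quot.mk _ p) (Quot.mk _ q) := fun p q hp hq => by
    have hsound : (Quot.mk (glue ρ) p : Glued ρ) =
        Quot.mk (glue ρ) ⟨(ρ p.1.1, 1), mem_univ _, by simp⟩ := Quot.sound ⟨hp, rfl, rfl⟩
    rw [hsound]
    exact hline _ _ hq.symm
  constructor
  · let level : Glued ρ → Quotient Δ := Quot.lift (fun p => γ p.1.2) fun p q h => by
      rw [h.1, h.2.1, hγ.eq_endpoints]
    refine fun h => Setoid.eqvGen_le (s := Setoid.ker level) ?_ h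
    rintro _ _ ⟨p, q, hpq, rfl, rfl⟩
    exact congrArg γ hpq.1
  · intro h
    rcases hγ.eq_or_endpoints p.2.2 q.2.2 h with h | ⟨hp, hq⟩ | ⟨hp, hq⟩
    · exact hline p q h
    · exact hcross p q hp hq
    · exact (gluedFoliation ρ).symm (hcross q p hq hp)

/-- A closed parametrization by `ℝ × [-1, 1]` of the leaves of a family `Z`, in which `ℝ × t`
parametrizes the leaf `γ t`. -/
structure IsClosedParametrization {Z : Set (Quotient Δ)} (γ : ℝ → Quotient Δ)
    (P : ℝ × Icc (-1 : ℝ) 1 → Quotient.mk Δ ⁻¹' Z) : Prop where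
  continuous : Continuous P
  isClosedMap : IsClosedMap P
  mk_apply : ∀ q, Quotient.mk Δ (P q : X) = γ q.2
  injective : ∀ t, Function.Injective fun u => P (u, t)
  exists_eq : ∀ x : Quotient.mk Δ ⁻¹' Z, ∀ t : Icc (-1 : ℝ) 1,
    Quotient.mk Δ (x : X) = γ t → ∃ u, P (u, t) = x

namespace IsClosedParametrization

variable {Z : Set (Quotient Δ)} {γ : ℝ → Quotient Δ} {P : ℝ × Icc (-1 : ℝ) 1 → Quotient.mk Δ ⁻¹' Z}

theorem comp_homeomorph (hP : IsClosedParametrization γ P)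
    (Λ : (ℝ × Icc (-1 : ℝ) 1) ≃ₜ ℝ × Icc (-1 : ℝ) 1) (hΛ : ∀ q, (Λ q).2 = q.2) :
    IsClosedParametrization γ (P ∘ Λ) where
  continuous := hP.continuous.comp Λ.continuous
  isClosedMap := hP.isClosedMap.comp Λ.isClosedMap
  mk_apply q := by rw [Function.comp_apply, hP.mk_apply, hΛ]
  injective t u v huv := by
    have hsnd : ∀ w, Λ (w, t) = ((Λ (w, t)).1, t) := fun w => Prod.ext rfl (hΛ _)
    have hfst : P ((Λ (u, t)).1, t) = P ((Λ (v, t)).1, t) := by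
      rw [← hsnd, ← hsnd]
      exact huv
    exact congrArg Prod.fst (Λ.injective
      (Prod.ext (hP.injective t hfst) ((hΛ (u, t)).trans (hΛ (v, t)).symm)))
  exists_eq x t hx := by
    obtain ⟨u, hu⟩ := hP.exists_eq x t hx
    have hsnd : Λ.symm (u, t) = ((Λ.symm (u, t)).1, t) :=
      Prod.ext rfl (by rw [← hΛ, Λ.apply_symm_apply])
    exact ⟨(Λ.symm (u, t)).1, by rw [← hsnd, Function.comp_apply, Λ.apply_symm_apply, hu]⟩

theorem stripHomeomorph_eq_or_glue (hP : IsClosedParametrization γ P) (hγ : IsSimpleLoop γ Z)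
    {ρ : ℝ → ℝ} (hglue : ∀ x, P (x, ⟨-1, by simp⟩) = P (ρ x, ⟨1, by simp⟩)) {p q : closedStrip}
    (h : P (stripHomeomorph _ p) = P (stripHomeomorph _ q)) :
    p = q ∨ glue ρ p q ∨ glue ρ q p := by
  obtain ⟨⟨x, s⟩, _, hs⟩ := p
  obtain ⟨⟨y, t⟩, _, ht⟩ := q
  change P (x, ⟨s, hs⟩) = P (y, ⟨t, ht⟩) at h
  have hst : γ s = γ t := by
    rw [← hP.mk_apply (x, ⟨s, hs⟩), h, hP.mk_apply]
  rcases hγ.eq_or_endpoints hs ht hst with rfl | ⟨rfl, rfl⟩ | ⟨rfl, rfl⟩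
  · obtain rfl := hP.injective _ h
    exact .inl rfl
  · exact .inr (.inl ⟨rfl, rfl, (hP.injective _ ((hglue x).symm.trans h)).symm⟩)
  · exact .inr (.inr ⟨rfl, rfl, hP.injective _ (h.trans (hglue y))⟩)

theorem exists_homeomorph (hP : IsClosedParametrization γ P) (hγ : IsSimpleLoop γ Z)
    {ρ : ℝ → ℝ} (hglue : ∀ x, P (x, ⟨-1, by simp⟩) = P (ρ x, ⟨1, by simp⟩)) :
    ∃ h : Glued ρ ≃ₜ Quotient.mk Δ ⁻¹' Z, ∀ p, h (Quot.mk _ p) = P (stripHomeomorph _ p) := by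
  let G : Glued ρ → Quotient.mk Δ ⁻¹' Z := Quot.lift (P ∘ stripHomeomorph _) <| by
    rintro ⟨⟨x, s⟩, _, hs⟩ ⟨⟨y, t⟩, _, ht⟩ ⟨hp, hq, hxy⟩
    obtain rfl : s = -1 := hp
    obtain rfl : t = 1 := hq
    obtain rfl : y = ρ x := hxy
    exact hglue x
  have hGc : Continuous G :=
    continuous_quot_lift _ (hP.continuous.comp (stripHomeomorph _).continuous)
  have hbij : Function.Bijective G := by
    constructor
    · rintro ⟨p⟩ ⟨q⟩ hpq
      rcases hP.stripHomeomorph_eq_or_glue hγ hglue hpq with rfl | h | h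
      · rfl
      · exact Quot.sound h
      · exact (Quot.sound h).symm
    · intro x
      obtain ⟨t, ht, htx⟩ := hγ.image_eq.superset x.2
      obtain ⟨u, hu⟩ := hP.exists_eq x ⟨t, ht⟩ htx.symm
      exact ⟨Quot.mk _ ((stripHomeomorph _).symm (u, ⟨t, ht⟩)), hu⟩
  have hGcl : IsClosedMap G := by
    refine IsClosedMap.of_comp_surjective Quot.mk_surjective continuous_quot_mk ?_
    exact hP.isClosedMap.comp (stripHomeomorph _).isClosedMap
  exact ⟨(Equiv.ofBijective G hbij).toHomeomorphOfContinuousClosed hGc hGcl, fun _ => rfl⟩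

theorem foliatedHomeomorphic (hP : IsClosedParametrization γ P) (hγ : IsSimpleLoop γ Z)
    {ρ : ℝ → ℝ} (hglue : ∀ x, P (x, ⟨-1, by simp⟩) = P (ρ x, ⟨1, by simp⟩)) :
    FoliatedHomeomorphic (gluedFoliation ρ) Δ (Quotient.mk Δ ⁻¹' Z) := by
  obtain ⟨h, hh⟩ := hP.exists_homeomorph hγ hglue
  refine ⟨h, isFoliated_of_iff (fun x hx y hxy => ?_) ?_⟩
  · rwa [mem_preimage, hxy]
  · rintro ⟨p⟩ ⟨q⟩
    rw [hh, hh, hP.mk_apply, hP.mk_apply]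
    exact hγ.gluedFoliation_iff

end IsClosedParametrization

section Monodromy

variable {γ : ℝ → Quotient Δ} {Θ : (ℝ × ℝ) ≃ₜ LeafPullback Δ γ}

theorem exists_monodromy (hΘ : ∀ q, (Θ q).1.1 = q.2) (hγ : γ (-1) = γ 1) :
    ∃ f : ℝ → ℝ, Continuous f ∧ Function.Bijective f ∧
      ∀ x, (Θ (f x, 1)).1.2 = (Θ (x, -1)).1.2 := by
  have hmem : ∀ x, γ 1 = Quotient.mk Δ (Θ (x, -1)).1.2 := fun x => by
    rw [mk_pullback_apply hΘ, hγ]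
  let f : ℝ → ℝ := fun x => (Θ.symm ⟨(1, (Θ (x, -1)).1.2), hmem x⟩).1
  have hf : ∀ x, (Θ (f x, 1)).1.2 = (Θ (x, -1)).1.2 := fun x => by
    have hsnd : (Θ.symm ⟨(1, (Θ (x, -1)).1.2), hmem x⟩).2 = 1 := by
      rw [← hΘ, Θ.apply_symm_apply]
    rw [show (f x, (1 : ℝ)) = Θ.symm ⟨(1, (Θ (x, -1)).1.2), hmem x⟩ from Prod.ext rfl hsnd.symm,
      Θ.apply_symm_apply]
  refine ⟨f, continuous_fst.comp (Θ.symm.continuous.comp (Continuous.subtype_mk (by fun_prop) _)),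
    ⟨fun x y hxy => pullback_injective hΘ (-1) ?_, fun y => ?_⟩, hf⟩
  · change (Θ (x, -1)).1.2 = (Θ (y, -1)).1.2
    rw [← hf x, ← hf y, hxy]
  · obtain ⟨x, hx⟩ := exists_pullback_eq hΘ (hγ.trans (mk_pullback_apply hΘ (y, 1)).symm)
    exact ⟨x, pullback_injective hΘ 1 ((hf x).trans hx)⟩

theorem isClosedEmbedding_pullback (hΘ : ∀ q, (Θ q).1.1 = q.2) (hγ : Continuous γ)
    {Z : Set (Quotient Δ)} [T2Space Z] (hZ : MapsTo γ (Icc (-1) 1) Z) :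
    IsClosedEmbedding fun q : ℝ × Icc (-1 : ℝ) 1 => (q.2, (⟨(Θ (q.1, q.2)).1.2, by
      rw [mem_preimage, mk_pullback_apply hΘ]; exact hZ q.2.2⟩ : Quotient.mk Δ ⁻¹' Z)) := by
  refine ⟨.of_comp (by fun_prop) (g := fun p : Icc (-1 : ℝ) 1 × (Quotient.mk Δ ⁻¹' Z) =>
    ((p.1 : ℝ), (p.2 : X))) (by fun_prop) ?_, ?_⟩
  · convert IsEmbedding.subtypeVal.comp
      (Θ.isEmbedding.comp (IsEmbedding.id.prodMap IsEmbedding.subtypeVal)) using 1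
    exact funext fun q => Prod.ext (hΘ (q.1, q.2)).symm rfl
  · let a : Icc (-1 : ℝ) 1 × (Quotient.mk Δ ⁻¹' Z) → Z := fun p => ⟨γ p.1, hZ p.1.2⟩
    let b : Icc (-1 : ℝ) 1 × (Quotient.mk Δ ⁻¹' Z) → Z := fun p => ⟨Quotient.mk Δ (p.2 : X), p.2.2⟩
    have ha : Continuous a := Continuous.subtype_mk (by fun_prop) _
    have hb : Continuous b :=
      Continuous.subtype_mk (continuous_quotient_mk'.comp (by fun_prop)) _
    convert isClosed_eq ha hb using 1
    ext ⟨s, x⟩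
    constructor
    · rintro ⟨q, hq⟩
      rw [← hq]
      exact Subtype.ext (mk_pullback_apply hΘ (q.1, q.2)).symm
    · intro hx
      obtain ⟨u, hu⟩ := exists_pullback_eq hΘ (congrArg Subtype.val hx)
      exact ⟨(u, s), Prod.ext rfl (Subtype.ext hu)⟩

theorem isClosedParametrization_pullback (hΘ : ∀ q, (Θ q).1.1 = q.2) (hγ : Continuous γ)
    {Z : Set (Quotient Δ)} [T2Space Z] (hZ : MapsTo γ (Icc (-1) 1) Z) :
    IsClosedParametrization (Z := Z) γ fun q => ⟨(Θ (q.1, q.2)).1.2, by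
      rw [mem_preimage, mk_pullback_apply hΘ]; exact hZ q.2.2⟩ where
  continuous := by fun_prop
  isClosedMap :=
    isClosedMap_snd_of_compactSpace.comp (isClosedEmbedding_pullback hΘ hγ hZ).isClosedMap
  mk_apply q := mk_pullback_apply hΘ _
  injective t u v h := pullback_injective hΘ t (congrArg Subtype.val h)
  exists_eq x t hx := by
    obtain ⟨u, hu⟩ := exists_pullback_eq hΘ hx.symm
    exact ⟨u, Subtype.ext hu⟩

end Monodromy

theorem LocallyStrip.cylinder_or_mobius (h : LocallyStrip Δ) {γ : ℝ → Quotient Δ}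
    {Z : Set (Quotient Δ)} [T2Space Z] (hγ : IsSimpleLoop γ Z) :
    FoliatedHomeomorphic cylinderFoliation Δ (Quotient.mk Δ ⁻¹' Z) ∨
      FoliatedHomeomorphic mobiusFoliation Δ (Quotient.mk Δ ⁻¹' Z) := by
  obtain ⟨Θ, hΘ⟩ := h.exists_pullback_homeomorph hγ.continuous
  obtain ⟨f, hfc, hfb, hf⟩ := exists_monodromy hΘ hγ.eq_endpoints
  have hZ : MapsTo γ (Icc (-1) 1) Z := mapsTo_iff_image_subset.2 hγ.image_eq.subset
  have hP := isClosedParametrization_pullback hΘ hγ.continuous hZ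
  have glued_of_strictMono : ∀ ρ : ℝ → ℝ, Function.Involutive ρ → StrictMono (f ∘ ρ) →
      FoliatedHomeomorphic (gluedFoliation ρ) Δ (Quotient.mk Δ ⁻¹' Z) := by
    intro ρ hρ hm
    obtain ⟨Λ, hΛ⟩ := exists_isotopy_homeomorph hm (hfb.surjective.comp hρ.surjective)
    refine (hP.comp_homeomorph Λ fun q => by rw [hΛ]).foliatedHomeomorphic hγ fun x => ?_
    refine Subtype.ext ?_
    simpa [hΛ, isotopy, hρ x] using (hf x).symm
  rcases hfc.strictMono_of_inj hfb.injective with hm | hm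
  · exact .inl (glued_of_strictMono (fun t => t) (fun _ => rfl) hm)
  · exact .inr (glued_of_strictMono (fun t => -t) neg_neg fun x y hxy => hm (neg_lt_neg hxy))

end Glue

section Components

variable {X : Type*} [TopologicalSpace X] {Δ : Setoid X}

theorem IsFoliated.mk_eq {M : Type*} [TopologicalSpace M] {Γ : Setoid M} {A : Set X} {h : M ≃ₜ A}
    (hh : IsFoliated Γ Δ h) {a b : M} (hab : Γ a b) :
    Quotient.mk Δ (h a : X) = Quotient.mk Δ (h b : X) :=
  (mem_of_mem_classes (hh _ (Γ.mem_classes b)) ⟨b, Γ.refl b, rfl⟩).1 ⟨a, hab, rfl⟩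

theorem FoliatedHomeomorphic.isCompact_image_glued {ρ : ℝ → ℝ} {Q : Set X}
    (h : FoliatedHomeomorphic (gluedFoliation ρ) Δ Q) : IsCompact (Quotient.mk Δ '' Q) := by
  obtain ⟨h, hh⟩ := h
  let c : Icc (-1 : ℝ) 1 → closedStrip := fun t => (stripHomeomorph _).symm (0, t)
  have hc : Continuous c := (stripHomeomorph _).symm.continuous.comp (by fun_prop)
  have hcc : Continuous fun t => Quotient.mk Δ (h (Quot.mk (glue ρ) (c t)) : X) :=
    continuous_quotient_mk'.comp
      (continuous_subtype_val.comp (h.continuous.comp (continuous_quot_mk.comp hc)))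
  convert isCompact_range hcc using 1
  refine Subset.antisymm ?_ (range_subset_iff.2 fun t => ⟨_, Subtype.coe_prop _, rfl⟩)
  rintro _ ⟨x, hx, rfl⟩
  obtain ⟨⟨p⟩, hp⟩ := h.surjective ⟨x, hx⟩
  refine ⟨⟨p.1.2, p.2.2⟩, ?_⟩
  have hline : gluedFoliation ρ (Quot.mk _ (c ⟨p.1.2, p.2.2⟩)) (Quot.mk _ p) :=
    .rel _ _ ⟨c _, p, (canonicalFoliation_prod_iff (J := Icc (-1) 1) _ p).2 rfl, rfl, rfl⟩
  exact (hh.mk_eq hline).trans (congrArg (fun q : Q => Quotient.mk Δ (q : X)) hp)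

theorem eq_univ_of_glued [ConnectedSpace X] {ρ : ℝ → ℝ} {Z : Set (Quotient Δ)} (hZo : IsOpen Z)
    (hZn : Z.Nonempty) (hZ : ∀ z ∈ Z, ¬ IsSpecialPoint z)
    (h : FoliatedHomeomorphic (gluedFoliation ρ) Δ (Quotient.mk Δ ⁻¹' Z)) :
    Quotient.mk Δ ⁻¹' Z = univ := by
  have hc := h.isCompact_image_glued
  rw [image_preimage_eq _ Quotient.mk_surjective] at hc
  exact IsClopen.eq_univ ⟨(isClosed_of_isCompact_not_special hc hZ).preimage
    continuous_quotient_mk', hZo.preimage continuous_quotient_mk'⟩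
    (hZn.preimage Quotient.mk_surjective)

theorem preimage_mk_subset_connectedComponentIn {C F : Set (Quotient Δ)} {x x₀ : X}
    (hx : x ∈ connectedComponentIn (Quotient.mk Δ ⁻¹' F) x₀) (hCF : C ⊆ F)
    (hC : IsPreconnected (Quotient.mk Δ ⁻¹' C)) (hxC : Quotient.mk Δ x ∈ C) :
    Quotient.mk Δ ⁻¹' C ⊆ connectedComponentIn (Quotient.mk Δ ⁻¹' F) x₀ := by
  rw [connectedComponentIn_eq hx]
  exact hC.subset_connectedComponentIn hxC (preimage_mono hCF)

theorem LocallyStrip.preimage_image_connectedComponentIn (h : LocallyStrip Δ)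
    (F : Set (Quotient Δ)) (x₀ : X) :
    Quotient.mk Δ ⁻¹' (Quotient.mk Δ '' connectedComponentIn (Quotient.mk Δ ⁻¹' F) x₀) =
      connectedComponentIn (Quotient.mk Δ ⁻¹' F) x₀ := by
  refine Subset.antisymm ?_ (subset_preimage_image _ _)
  rintro y ⟨x, hx, hxy⟩
  exact preimage_mk_subset_connectedComponentIn hx
    (singleton_subset_iff.2 (connectedComponentIn_subset (Quotient.mk Δ ⁻¹' F) _ hx))
    (h.isPreconnected_leaf _) rfl hxy.symm

theorem LocallyStrip.foliatedHomeomorphic_openStrip (h : LocallyStrip Δ)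
    {γ : ℝ → Quotient Δ} (hγ : IsOpenEmbedding γ) :
    FoliatedHomeomorphic (canonicalFoliation openStrip) Δ (Quotient.mk Δ ⁻¹' range γ) := by
  obtain ⟨e, he, her⟩ := h.exists_strip_of_isOpenEmbedding hγ
  obtain ⟨k, hk, hkr⟩ := exists_isOpenEmbedding_range_eq_Ioo (show (-1 : ℝ) < 1 by norm_num)
  let θ : Ioo (-1 : ℝ) 1 ≃ₜ ℝ :=
    (Homeomorph.setCongr hkr.symm).trans hk.isEmbedding.toHomeomorph.symm
  convert (he.comp θ.isOpenEmbedding).foliatedHomeomorphic using 1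
  rw [← her]
  exact (((Homeomorph.refl ℝ).prodCongr θ).surjective.range_comp e).symm

theorem t2Space_of_not_special {Z : Set (Quotient Δ)} (hZ : ∀ z ∈ Z, ¬ IsSpecialPoint z) :
    T2Space Z := by
  rw [t2Space_iff_disjoint_nhds]
  intro y z hyz
  rw [nhds_subtype_eq_comap, nhds_subtype_eq_comap]
  exact disjoint_comap
    (disjoint_nhds_of_not_special (hZ y y.2) fun h => hyz (Subtype.ext h))

variable [ChartedSpace (EuclideanHalfSpace 2) X]

theorem IsClassF.isOpen_image_connectedComponentIn (hΔ : IsClassF Δ)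
    (hfin : LocallyFinite (fun ω : specialLeaves Δ => (ω : Set X))) (x₀ : X) :
    IsOpen (Quotient.mk Δ '' connectedComponentIn (Quotient.mk Δ ⁻¹' regularLeaves Δ) x₀) := by
  rw [isOpen_iff_mem_nhds]
  rintro _ ⟨x, hx, rfl⟩
  have hxF := connectedComponentIn_subset _ _ hx
  obtain ⟨e, he, hxe, hsub⟩ := hΔ.exists_strip_regular hxF
    ((hΔ.isOpen_regularLeaves hfin).mem_nhds hxF)
  refine mem_of_superset (he.isOpenEmbedding_base.isOpen_range.mem_nhds hxe) fun z hz => ?_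
  obtain ⟨w, rfl⟩ := Quotient.exists_rep z
  refine ⟨w, preimage_mk_subset_connectedComponentIn hx hsub ?_ hxe hz, rfl⟩
  rw [← image_univ]
  exact he.isPreconnected_preimage isPreconnected_univ

theorem IsClassF.exists_image_component (hΔ : IsClassF Δ)
    (hfin : LocallyFinite (fun ω : specialLeaves Δ => (ω : Set X))) {Q : Set X}
    (hQ : IsComponentOf (⋃₀ specialLeaves Δ ∪ (𝓡∂ 2).boundary X)ᶜ Q) :
    ∃ Z : Set (Quotient Δ), Q = Quotient.mk Δ ⁻¹' Z ∧ IsOpen Z ∧ IsConnected Z ∧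
      Z ⊆ regularLeaves Δ ∧ ∀ C ⊆ regularLeaves Δ, IsPreconnected (Quotient.mk Δ ⁻¹' C) →
        (C ∩ Z).Nonempty → C ⊆ Z := by
  rw [← hΔ.preimage_regularLeaves] at hQ
  obtain ⟨x₀, hx₀, rfl⟩ := hQ
  refine ⟨Quotient.mk Δ '' connectedComponentIn _ x₀,
    (hΔ.locallyStrip.preimage_image_connectedComponentIn _ _).symm,
    hΔ.isOpen_image_connectedComponentIn hfin x₀,
    (isConnected_connectedComponentIn_iff.2 hx₀).image _ continuous_quotient_mk'.continuousOn,
    image_subset_iff.2 (connectedComponentIn_subset _ _), ?_⟩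
  rintro C hC hCp ⟨_, hxC, x, hx, rfl⟩ z hz
  obtain ⟨w, rfl⟩ := Quotient.exists_rep z
  exact ⟨w, preimage_mk_subset_connectedComponentIn hx hC hCp hxC hz, rfl⟩

theorem IsClassF.hasLineCharts (hΔ : IsClassF Δ) {Z : Set (Quotient Δ)} (hZo : IsOpen Z)
    (hZ : Z ⊆ regularLeaves Δ) : HasLineCharts Z := by
  intro z
  obtain ⟨e, he, ⟨v, hv⟩, hsub⟩ := hΔ.exists_strip_regular (hZ z.2) (hZo.mem_nhds z.2)
  exact ⟨fun t => ⟨IsStrip.base Δ e t, hsub ⟨t, rfl⟩⟩,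
    .of_comp _ hZo.isOpenEmbedding_subtypeVal he.isOpenEmbedding_base, v, Subtype.ext hv⟩

theorem IsClassF.foliatedHomeomorphic_component [SecondCountableTopology X] (hΔ : IsClassF Δ)
    {Z : Set (Quotient Δ)} (hZo : IsOpen Z) (hZc : IsConnected Z) (hZ : Z ⊆ regularLeaves Δ) :
    FoliatedHomeomorphic cylinderFoliation Δ (Quotient.mk Δ ⁻¹' Z) ∨
      FoliatedHomeomorphic mobiusFoliation Δ (Quotient.mk Δ ⁻¹' Z) ∨
      FoliatedHomeomorphic (canonicalFoliation openStrip) Δ (Quotient.mk Δ ⁻¹' Z) := by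
  have : SecondCountableTopology (Quotient Δ) :=
    isQuotientMap_quotient_mk'.secondCountableTopology hΔ.locallyStrip.isOpenMap
  have : ConnectedSpace Z := isConnected_iff_connectedSpace.1 hZc
  have : T2Space Z := t2Space_of_not_special fun z hz => (hZ hz).1
  rcases (hΔ.hasLineCharts hZo hZ).exists_line_or_loop with ⟨γ, hγ, hγr⟩ | ⟨γ, hγ⟩
  · have hrange : range (Subtype.val ∘ γ) = Z := by
      rw [range_comp, hγr, image_univ, Subtype.range_coe]
    exact .inr (.inr (hrange ▸ hΔ.locallyStrip.foliatedHomeomorphic_openStrip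
      (hZo.isOpenEmbedding_subtypeVal.comp hγ)))
  · exact or_assoc.1 (.inl (hΔ.locallyStrip.cylinder_or_mobius hγ.subtypeVal))

end Components

section Atlas

theorem neBot_nhdsLT_one : (𝓝[<] (1 : unitInterval)).NeBot :=
  nhdsLT_neBot_of_exists_lt ⟨0, zero_lt_one⟩

theorem injective_of_isOpenMap_of_dense {A B : Type*} [TopologicalSpace A] [TopologicalSpace B]
    [T2Space A] {Ψ : A → B} (hc : Continuous Ψ) (ho : IsOpenMap Ψ) {D : Set A} (hD : Dense D)
    (h : ∀ a ∈ D, ∀ a', Ψ a = Ψ a' → a = a') : Function.Injective Ψ := by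
  intro a a' haa
  by_contra hne
  obtain ⟨U, U', hU, hU', haU, haU', hd⟩ := t2_separation hne
  have hmem : Ψ '' U ∩ Ψ '' U' ∈ 𝓝 (Ψ a) :=
    inter_mem ((ho _ hU).mem_nhds ⟨a, haU, rfl⟩) ((ho _ hU').mem_nhds ⟨a', haU', haa.symm⟩)
  obtain ⟨z, ⟨⟨v, hv, hvz⟩, ⟨v', hv', hvz'⟩⟩, hz⟩ :=
    mem_closure_iff_nhds.1 (hD a) _ (hc.continuousAt hmem)
  exact hd.le_bot ⟨h z hz v hvz.symm ▸ hv, h z hz v' hvz'.symm ▸ hv'⟩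

/-- A partition of `A` into lines that is trivial over the sets where the functions `χ j` are
positive, with a common orientation below the level `1`. The lines below that level are determined
by their level; those at the level `1` are not, and need not be separated. -/
structure IsStripAtlas {A J : Type*} [TopologicalSpace A] (τ : A → unitInterval)
    (e : J → OpenPartialHomeomorph A (ℝ × unitInterval)) (χ : J → unitInterval → ℝ) (j₀ : J) :
    Prop where
  continuous : Continuous τ
  continuous_height : ∀ j, Continuous (χ j)
  height_nonneg : ∀ j b, 0 ≤ χ j b
  height_le_one : ∀ j b, χ j b ≤ 1
  target_eq : ∀ j, (e j).target = univ ×ˢ {b | 0 < χ j b}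
  snd_apply : ∀ j, ∀ a ∈ (e j).source, (e j a).2 = τ a
  mem_source : ∀ j a, τ a < 1 → 0 < χ j (τ a) → a ∈ (e j).source
  height_pos_iff : ∀ b, 0 < χ j₀ b ↔ b < 1
  exists_mem_source : ∀ a, ∃ j, a ∈ (e j).source
  strictMono : ∀ j b, b < 1 → 0 < χ j b → StrictMono fun u => (e j₀ ((e j).symm (u, b))).1

namespace IsStripAtlas

variable {A J : Type*} [TopologicalSpace A] {τ : A → unitInterval}
  {e : J → OpenPartialHomeomorph A (ℝ × unitInterval)} {χ : J → unitInterval → ℝ} {j₀ : J}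

theorem mem_target (h : IsStripAtlas τ e χ j₀) {j : J} (u : ℝ) {b : unitInterval}
    (hb : 0 < χ j b) : (u, b) ∈ (e j).target := by
  rw [h.target_eq]
  exact ⟨mem_univ _, hb⟩

theorem symm_mem (h : IsStripAtlas τ e χ j₀) {j : J} (u : ℝ) {b : unitInterval}
    (hb : 0 < χ j b) : (e j).symm (u, b) ∈ (e j).source :=
  (e j).map_target (h.mem_target u hb)

theorem apply_symm (h : IsStripAtlas τ e χ j₀) {j : J} (u : ℝ) {b : unitInterval}
    (hb : 0 < χ j b) : e j ((e j).symm (u, b)) = (u, b) :=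
  (e j).right_inv (h.mem_target u hb)

theorem level_symm (h : IsStripAtlas τ e χ j₀) {j : J} (u : ℝ) {b : unitInterval}
    (hb : 0 < χ j b) : τ ((e j).symm (u, b)) = b := by
  rw [← h.snd_apply j _ (h.symm_mem u hb), h.apply_symm u hb]

theorem symm_apply (h : IsStripAtlas τ e χ j₀) {j : J} {a : A} (ha : a ∈ (e j).source) :
    (e j).symm ((e j a).1, τ a) = a := by
  rw [← h.snd_apply j a ha]
  exact (e j).left_inv ha

theorem height_pos (h : IsStripAtlas τ e χ j₀) {j : J} {a : A} (ha : a ∈ (e j).source) :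
    0 < χ j (τ a) := by
  have h1 := (e j).map_source ha
  rw [h.target_eq] at h1
  rw [← h.snd_apply j a ha]
  exact h1.2

theorem mem_source_symm (h : IsStripAtlas τ e χ j₀) {i j : J} {b : unitInterval} (hb : b < 1)
    (hi : 0 < χ i b) (hj : 0 < χ j b) (u : ℝ) : (e i).symm (u, b) ∈ (e j).source :=
  h.mem_source _ _ (by rwa [h.level_symm u hi]) (by rwa [h.level_symm u hi])

theorem symm_transition (h : IsStripAtlas τ e χ j₀) {i j : J} {b : unitInterval} (hb : b < 1)
    (hi : 0 < χ i b) (hj : 0 < χ j b) (u : ℝ) :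
    (e j).symm ((e j ((e i).symm (u, b))).1, b) = (e i).symm (u, b) := by
  simpa only [h.level_symm u hi] using h.symm_apply (h.mem_source_symm hb hi hj u)

theorem transition_inverse (h : IsStripAtlas τ e χ j₀) {i j : J} {b : unitInterval} (hb : b < 1)
    (hi : 0 < χ i b) (hj : 0 < χ j b) (u : ℝ) :
    (e i ((e j).symm ((e j ((e i).symm (u, b))).1, b))).1 = u := by
  rw [h.symm_transition hb hi hj, h.apply_symm u hi]

theorem strictMono_transition (h : IsStripAtlas τ e χ j₀) {i j : J} {b : unitInterval}
    (hb : b < 1) (hi : 0 < χ i b) (hj : 0 < χ j b) :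
    StrictMono fun u => (e i ((e j).symm (u, b))).1 := by
  intro u v huv
  refine (h.strictMono i b hb hi).lt_iff_lt.1 ?_
  simp only [h.symm_transition hb hj hi]
  exact h.strictMono j b hb hj huv

theorem eventually_height_pos (h : IsStripAtlas τ e χ j₀) {j : J} {b : unitInterval}
    (hb : 0 < χ j b) : ∀ᶠ b' in 𝓝 b, 0 < χ j b' :=
  (h.continuous_height j).continuousAt.eventually_const_lt hb

theorem tendsto_symm (h : IsStripAtlas τ e χ j₀) {j : J} {b : unitInterval} (hb : 0 < χ j b)
    (u : ℝ) : Tendsto (fun b' => (e j).symm (u, b')) (𝓝 b) (𝓝 ((e j).symm (u, b))) :=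
  ((e j).continuousAt_symm (h.mem_target u hb)).tendsto.comp
    ((Continuous.prodMk_right u).tendsto b)

/-- The points below the top level `1`. -/
def below (τ : A → unitInterval) : Set A := {a | τ a < 1}

theorem dense_below (h : IsStripAtlas τ e χ j₀) : Dense (below τ) := by
  intro a
  rcases (unitInterval.le_one' (t := τ a)).lt_or_eq with ha | ha
  · exact subset_closure ha
  obtain ⟨j, hj⟩ := h.exists_mem_source a
  have hpos : 0 < χ j 1 := ha ▸ h.height_pos hj
  have hlim : Tendsto (fun b => (e j).symm ((e j a).1, b)) (𝓝[<] 1) (𝓝 a) := by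
    simpa only [← ha, h.symm_apply hj] using
      (h.tendsto_symm hpos (e j a).1).mono_left (nhdsWithin_le_nhds (s := Iio 1))
  have := neBot_nhdsLT_one
  refine mem_closure_of_tendsto hlim ?_
  filter_upwards [nhdsWithin_le_nhds (h.eventually_height_pos hpos), self_mem_nhdsWithin]
    with b hb hb1
  exact (h.level_symm _ hb).trans_lt hb1

/-- The first coordinate of the chart `e j`, transported from the line to `(0, χ j)` and extended
by `0` outside the chart. -/
noncomputable def coord (τ : A → unitInterval) (e : J → OpenPartialHomeomorph A (ℝ × unitInterval))
    (χ : J → unitInterval → ℝ) (j : J) : A → ℝ :=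
  (e j).source.indicator fun a => χ j (τ a) * Real.sigmoid (e j a).1

theorem coord_of_mem {j : J} {a : A} (ha : a ∈ (e j).source) :
    coord τ e χ j a = χ j (τ a) * Real.sigmoid (e j a).1 := indicator_of_mem ha _

theorem coord_nonneg (h : IsStripAtlas τ e χ j₀) (j : J) (a : A) : 0 ≤ coord τ e χ j a :=
  indicator_nonneg (fun _ _ => mul_nonneg (h.height_nonneg j _) (Real.sigmoid_nonneg _)) a

theorem coord_le (h : IsStripAtlas τ e χ j₀) (j : J) (a : A) : coord τ e χ j a ≤ χ j (τ a) :=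
  indicator_le' (fun _ _ => mul_le_of_le_one_right (h.height_nonneg j _) (Real.sigmoid_le_one _))
    (fun _ _ => h.height_nonneg j _) a

theorem continuousAt_coord (h : IsStripAtlas τ e χ j₀) {j : J} {a : A}
    (ha : a ∈ (e j).source ∨ χ j (τ a) = 0) : ContinuousAt (coord τ e χ j) a := by
  have hχc : Continuous fun a => χ j (τ a) := (h.continuous_height j).comp h.continuous
  rcases ha with ha | ha
  · have h1 : ContinuousAt (fun a => χ j (τ a) * Real.sigmoid (e j a).1) a :=
      hχc.continuousAt.mul (continuous_sigmoid.continuousAt.comp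
        (continuous_fst.continuousAt.comp ((e j).continuousAt ha)))
    refine h1.congr ?_
    filter_upwards [(e j).open_source.mem_nhds ha] with x hx
    exact (coord_of_mem hx).symm
  · have h0 : coord τ e χ j a = 0 :=
      le_antisymm ((h.coord_le j a).trans_eq ha) (h.coord_nonneg j a)
    have h2 : Tendsto (fun a => χ j (τ a)) (𝓝 a) (𝓝 0) := ha ▸ hχc.tendsto a
    rw [ContinuousAt, h0]
    exact squeeze_zero (h.coord_nonneg j) (h.coord_le j) h2

theorem exists_isPreconnected_mem_nhdsWithin_below (h : IsStripAtlas τ e χ j₀) {q : A}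
    (hq : τ q = 1) {N : Set A} (hN : N ∈ 𝓝 q) :
    ∃ D ⊆ N ∩ below τ, IsPreconnected D ∧ D ∈ 𝓝[below τ] q := by
  obtain ⟨i, hi⟩ := h.exists_mem_source q
  have hlevel : (e i q).2 = 1 := (h.snd_apply i q hi).trans hq
  have himage : e i '' (N ∩ (e i).source) ∈ 𝓝 (e i q) :=
    (e i).image_mem_nhds hi (inter_mem hN ((e i).open_source.mem_nhds hi))
  obtain ⟨U, hU, V, hV, hUV⟩ := mem_nhds_prod_iff.1 himage
  obtain ⟨x₁, x₂, hx, hxU⟩ := mem_nhds_iff_exists_Ioo_subset.1 hU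
  replace hV : V ∈ 𝓝 (e i q).2 := hV
  rw [hlevel] at hV
  obtain ⟨m, hm, hmV⟩ := (nhds_top_basis (α := unitInterval)).mem_iff.1 hV
  have hbox : ∀ p ∈ Ioo x₁ x₂ ×ˢ Ioi m, p ∈ (e i).target ∧ (e i).symm p ∈ N := by
    rintro ⟨u, b⟩ ⟨hu, hb⟩
    obtain ⟨a, ⟨ha, hai⟩, hap⟩ := hUV ⟨hxU hu, hmV hb⟩
    rw [← hap, (e i).left_inv hai]
    exact ⟨(e i).map_source hai, ha⟩
  refine ⟨(e i).symm '' (Ioo x₁ x₂ ×ˢ Ioo m 1), ?_, ?_, ?_⟩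
  · rintro _ ⟨⟨u, b⟩, ⟨hu, hb⟩, rfl⟩
    obtain ⟨ht, hmem⟩ := hbox (u, b) ⟨hu, hb.1⟩
    refine ⟨hmem, ?_⟩
    change τ _ < 1
    rw [← h.snd_apply i _ ((e i).map_target ht), (e i).right_inv ht]
    exact hb.2
  · refine (isPreconnected_Ioo.prod (isPreconnected_of_ordConnected_coe ordConnected_Icc
      ordConnected_Ioo)).image _ ((e i).continuousOn_symm.mono ?_)
    rintro ⟨u, b⟩ ⟨hu, hb⟩
    exact (hbox (u, b) ⟨hu, hb.1⟩).1
  · have hnear : ∀ᶠ a in 𝓝 q, e i a ∈ Ioo x₁ x₂ ×ˢ Ioi m :=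
      ((e i).continuousAt hi).eventually_mem
        ((isOpen_Ioo.prod isOpen_Ioi).mem_nhds ⟨hx, hlevel.symm ▸ hm⟩)
    filter_upwards [nhdsWithin_le_nhds hnear,
      nhdsWithin_le_nhds ((e i).open_source.mem_nhds hi), self_mem_nhdsWithin] with a ha hai ha1
    exact ⟨e i a, ⟨ha.1, ha.2, (h.snd_apply i a hai).trans_lt ha1⟩, (e i).left_inv hai⟩

theorem eventually_lt_abs (h : IsStripAtlas τ e χ j₀) [T2Space A] {j : J} {q : A} (hq : τ q = 1)
    (hqj : q ∉ (e j).source) (hχ : 0 < χ j 1) (R : ℝ) :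
    ∀ᶠ a in 𝓝 q, τ a < 1 → a ∈ (e j).source ∧ R < |(e j a).1| := by
  obtain ⟨l, hl1, hl⟩ : ∃ l < (1 : unitInterval), ∀ b, l ≤ b → 0 < χ j b := by
    obtain ⟨l, hl, hsub⟩ := (nhds_top_basis (α := unitInterval)).mem_iff.1
      (h.eventually_height_pos hχ)
    obtain ⟨m, hlm, hm⟩ := exists_between hl
    exact ⟨m, hm, fun b hb => hsub (hlm.trans_le hb)⟩
  set K : Set A := (e j).symm '' (Icc (-R) R ×ˢ Icc l 1)
  have hKc : IsCompact K := by
    refine (isCompact_Icc.prod isClosed_Icc.isCompact).image_of_continuousOn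
      ((e j).continuousOn_symm.mono ?_)
    rintro ⟨u, b⟩ ⟨-, hb⟩
    exact h.mem_target u (hl b hb.1)
  have hqK : q ∉ K := by
    rintro ⟨⟨u, b⟩, ⟨-, hb⟩, rfl⟩
    exact hqj (h.symm_mem u (hl b hb.1))
  filter_upwards [hKc.isClosed.isOpen_compl.mem_nhds hqK,
    h.continuous.continuousAt.eventually_const_lt (hq.symm ▸ hl1)] with a haK hla ha1
  have haj : a ∈ (e j).source := h.mem_source j a ha1 (hl _ hla.le)
  refine ⟨haj, not_le.1 fun hle => haK ⟨e j a, ⟨abs_le.1 hle, ?_⟩, (e j).left_inv haj⟩⟩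
  rw [h.snd_apply j a haj]
  exact ⟨hla.le, ha1.le⟩

/- By compactness the coordinate has large absolute value near `q`, and by connectedness its sign
cannot change there. -/
theorem eventually_lt_or_eventually_lt_neg (h : IsStripAtlas τ e χ j₀) [T2Space A] {j : J} {q : A}
    (hq : τ q = 1) (hqj : q ∉ (e j).source) (hχ : 0 < χ j 1) {R : ℝ} (hR : 0 < R) :
    (∀ᶠ a in 𝓝[below τ] q, R < (e j a).1) ∨ ∀ᶠ a in 𝓝[below τ] q, (e j a).1 < -R := by
  obtain ⟨D, hDN, hDc, hDq⟩ :=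
    h.exists_isPreconnected_mem_nhdsWithin_below hq (h.eventually_lt_abs hq hqj hχ R)
  have hD : ∀ a ∈ D, a ∈ (e j).source ∧ R < |(e j a).1| := fun a ha => (hDN ha).1 (hDN ha).2
  have hcont : ContinuousOn (fun a => (e j a).1) D :=
    continuous_fst.comp_continuousOn ((e j).continuousOn.mono fun a ha => (hD a ha).1)
  by_cases hpos : ∃ a ∈ D, R < (e j a).1
  · obtain ⟨a₀, ha₀, hRa₀⟩ := hpos
    refine .inl (mem_of_superset hDq fun a ha => ?_)
    refine (lt_abs.1 (hD a ha).2).resolve_right fun hneg => ?_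
    obtain ⟨z, hz, hz0⟩ := hDc.intermediate_value ha ha₀ hcont
      (show (0 : ℝ) ∈ Icc _ _ from ⟨by linarith, by linarith⟩)
    have habs := (hD z hz).2
    simp only at hz0
    rw [hz0, abs_zero] at habs
    exact hR.not_gt habs
  · exact .inr (mem_of_superset hDq fun a ha =>
      lt_neg.1 ((lt_abs.1 (hD a ha).2).resolve_left fun h' => hpos ⟨a, ha, h'⟩))

theorem exists_tendsto_sigmoid (h : IsStripAtlas τ e χ j₀) [T2Space A] {j : J} {q : A}
    (hq : τ q = 1) (hqj : q ∉ (e j).source) (hχ : 0 < χ j 1) :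
    ∃ y, Tendsto (fun a => Real.sigmoid (e j a).1) (𝓝[below τ] q) (𝓝 y) := by
  by_cases hall : ∀ R : ℝ, 0 < R → ∀ᶠ a in 𝓝[below τ] q, R < (e j a).1
  · refine ⟨1, Real.tendsto_sigmoid_atTop.comp (tendsto_atTop.2 fun R => ?_)⟩
    filter_upwards [hall (max R 1) (by positivity)] with a ha
    exact (le_max_left _ _).trans ha.le
  · simp only [not_forall] at hall
    obtain ⟨R₀, hR₀, hn⟩ := hall
    refine ⟨0, Real.tendsto_sigmoid_atBot.comp (tendsto_atBot.2 fun R => ?_)⟩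
    have hR : 0 < max R₀ (-R) := lt_max_of_lt_left hR₀
    rcases h.eventually_lt_or_eventually_lt_neg hq hqj hχ hR with hev | hev
    · exact absurd (hev.mono fun a ha => (le_max_left _ _).trans_lt ha) hn
    · filter_upwards [hev] with a ha
      linarith [le_max_right R₀ (-R)]

theorem exists_tendsto_coord (h : IsStripAtlas τ e χ j₀) [T2Space A] (j : J) (q : A) :
    ∃ y, Tendsto (coord τ e χ j) (𝓝[below τ] q) (𝓝 y) := by
  by_cases hq : q ∈ (e j).source ∨ χ j (τ q) = 0
  · exact ⟨_, (h.continuousAt_coord hq).continuousWithinAt⟩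
  push Not at hq
  obtain ⟨hqj, hne⟩ := hq
  have hpos : 0 < χ j (τ q) := (h.height_nonneg j _).lt_of_ne hne.symm
  have hq1 : τ q = 1 :=
    unitInterval.le_one'.eq_of_not_lt fun hlt => hqj (h.mem_source j q hlt hpos)
  have hχ : ContinuousAt (fun a => χ j (τ a)) q :=
    ((h.continuous_height j).comp h.continuous).continuousAt
  obtain ⟨y, hy⟩ := h.exists_tendsto_sigmoid hq1 hqj (hq1 ▸ hpos)
  refine ⟨_, (hχ.continuousWithinAt.tendsto.mul hy).congr' ?_⟩
  filter_upwards [nhdsWithin_le_nhds (hχ.eventually_const_lt hpos), self_mem_nhdsWithin]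
    with a ha ha1
  exact (coord_of_mem (h.mem_source j a ha1 ha)).symm

/-- The function `coord`, extended by continuity from the points below the top level. -/
noncomputable def extCoord (τ : A → unitInterval)
    (e : J → OpenPartialHomeomorph A (ℝ × unitInterval)) (χ : J → unitInterval → ℝ) (j : J) :
    A → ℝ :=
  extendFrom (below τ) (coord τ e χ j)

theorem continuous_extCoord [T2Space A] (h : IsStripAtlas τ e χ j₀) (j : J) :
    Continuous (extCoord τ e χ j) :=
  continuous_extendFrom h.dense_below (h.exists_tendsto_coord j)

theorem extCoord_eq (h : IsStripAtlas τ e χ j₀) {j : J} {a : A}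
    (ha : a ∈ (e j).source ∨ χ j (τ a) = 0) : extCoord τ e χ j a = coord τ e χ j a :=
  extendFrom_eq (h.dense_below a) (h.continuousAt_coord ha).continuousWithinAt

theorem extCoord_of_below (h : IsStripAtlas τ e χ j₀) (j : J) {a : A} (ha : τ a < 1) :
    extCoord τ e χ j a = coord τ e χ j a := by
  refine h.extCoord_eq (or_iff_not_imp_right.2 fun h0 => h.mem_source j a ha ?_)
  exact (h.height_nonneg j _).lt_of_ne' h0

theorem extCoord_nonneg [T2Space A] (h : IsStripAtlas τ e χ j₀) (j : J) (a : A) :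
    0 ≤ extCoord τ e χ j a :=
  (isClosed_le continuous_const (h.continuous_extCoord j)).closure_subset_iff.2
    (fun a ha => (h.coord_nonneg j a).trans_eq (h.extCoord_of_below j ha).symm) (h.dense_below a)

theorem extCoord_le [T2Space A] (h : IsStripAtlas τ e χ j₀) (j : J) (a : A) :
    extCoord τ e χ j a ≤ χ j (τ a) :=
  (isClosed_le (h.continuous_extCoord j)
    ((h.continuous_height j).comp h.continuous)).closure_subset_iff.2
    (fun a ha => (h.extCoord_of_below j ha).trans_le (h.coord_le j a)) (h.dense_below a)

theorem extCoord_symm_self (h : IsStripAtlas τ e χ j₀) {j : J} {b : unitInterval}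
    (hb : 0 < χ j b) (u : ℝ) :
    extCoord τ e χ j ((e j).symm (u, b)) = χ j b * Real.sigmoid u := by
  rw [h.extCoord_eq (Or.inl (h.symm_mem u hb)), coord_of_mem (h.symm_mem u hb), h.level_symm u hb,
    h.apply_symm u hb]

theorem extCoord_symm (h : IsStripAtlas τ e χ j₀) {i j : J} {b : unitInterval} (hb1 : b < 1)
    (hi : 0 < χ i b) (hj : 0 < χ j b) (u : ℝ) :
    extCoord τ e χ i ((e j).symm (u, b)) =
      χ i b * Real.sigmoid (e i ((e j).symm (u, b))).1 := by
  have hmem := h.mem_source_symm hb1 hj hi u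
  rw [h.extCoord_eq (Or.inl hmem), coord_of_mem hmem, h.level_symm u hj]

theorem extCoord_symm_of_height_eq_zero (h : IsStripAtlas τ e χ j₀) {i j : J} {b : unitInterval}
    (hi : χ i b = 0) (hj : 0 < χ j b) (u : ℝ) : extCoord τ e χ i ((e j).symm (u, b)) = 0 := by
  have hlevel : χ i (τ ((e j).symm (u, b))) = 0 := by rw [h.level_symm u hj, hi]
  rw [h.extCoord_eq (.inr hlevel)]
  exact le_antisymm ((h.coord_le i _).trans_eq hlevel) (h.coord_nonneg i _)

theorem strictMono_extCoord_self (h : IsStripAtlas τ e χ j₀) {j : J} {b : unitInterval}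
    (hb : 0 < χ j b) : StrictMono fun u => extCoord τ e χ j ((e j).symm (u, b)) := by
  simp only [h.extCoord_symm_self hb]
  exact Real.sigmoid_strictMono.const_mul hb

theorem monotone_extCoord_of_lt_one (h : IsStripAtlas τ e χ j₀) (i : J) {j : J}
    {b : unitInterval} (hb1 : b < 1) (hb : 0 < χ j b) :
    Monotone fun u => extCoord τ e χ i ((e j).symm (u, b)) := by
  rcases (h.height_nonneg i b).eq_or_lt with hi | hi
  · simp only [h.extCoord_symm_of_height_eq_zero hi.symm hb]
    exact monotone_const
  · simp only [h.extCoord_symm hb1 hi hb]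
    exact ((Real.sigmoid_strictMono.comp
      (h.strictMono_transition hb1 hi hb)).const_mul hi).monotone

theorem monotone_extCoord (h : IsStripAtlas τ e χ j₀) [T2Space A] (i : J) {j : J}
    {b : unitInterval} (hb : 0 < χ j b) :
    Monotone fun u => extCoord τ e χ i ((e j).symm (u, b)) := by
  rcases (unitInterval.le_one' (t := b)).lt_or_eq with hb1 | rfl
  · exact h.monotone_extCoord_of_lt_one i hb1 hb
  intro u v huv
  have hlim : ∀ w, Tendsto (fun b => extCoord τ e χ i ((e j).symm (w, b))) (𝓝[<] 1)
      (𝓝 (extCoord τ e χ i ((e j).symm (w, 1)))) := fun w =>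
    ((h.continuous_extCoord i).continuousAt.tendsto.comp (h.tendsto_symm hb w)).mono_left
      nhdsWithin_le_nhds
  have := neBot_nhdsLT_one
  refine le_of_tendsto_of_tendsto (hlim u) (hlim v) ?_
  filter_upwards [nhdsWithin_le_nhds (h.eventually_height_pos hb), self_mem_nhdsWithin]
    with b hb hb1
  exact h.monotone_extCoord_of_lt_one i hb1 hb huv

theorem tendsto_extCoord_atBot (h : IsStripAtlas τ e χ j₀) (i : J) {b : unitInterval}
    (hb : b < 1) : Tendsto (fun u => extCoord τ e χ i ((e j₀).symm (u, b))) atBot (𝓝 0) := by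
  have h₀ : 0 < χ j₀ b := (h.height_pos_iff b).2 hb
  rcases (h.height_nonneg i b).eq_or_lt with hi | hi
  · simp only [h.extCoord_symm_of_height_eq_zero hi.symm h₀]
    exact tendsto_const_nhds
  · simp only [h.extCoord_symm hb hi h₀]
    simpa using (Real.tendsto_sigmoid_atBot.comp (tendsto_atBot_of_strictMono_of_surjective
      (h.strictMono_transition hb hi h₀)
      fun u => ⟨_, h.transition_inverse hb hi h₀ u⟩)).const_mul (χ i b)

theorem tendsto_extCoord_atTop (h : IsStripAtlas τ e χ j₀) (i : J) {b : unitInterval}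
    (hb : b < 1) :
    Tendsto (fun u => extCoord τ e χ i ((e j₀).symm (u, b))) atTop (𝓝 (χ i b)) := by
  have h₀ : 0 < χ j₀ b := (h.height_pos_iff b).2 hb
  rcases (h.height_nonneg i b).eq_or_lt with hi | hi
  · simp only [h.extCoord_symm_of_height_eq_zero hi.symm h₀, ← hi]
    exact tendsto_const_nhds
  · simp only [h.extCoord_symm hb hi h₀]
    simpa using (Real.tendsto_sigmoid_atTop.comp (tendsto_atTop_of_strictMono_of_surjective
      (h.strictMono_transition hb hi h₀)
      fun u => ⟨_, h.transition_inverse hb hi h₀ u⟩)).const_mul (χ i b)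

theorem isFlatteningFamily_extCoord (h : IsStripAtlas τ e χ j₀) [T2Space A] :
    IsFlatteningFamily τ (extCoord τ e χ) χ where
  continuous_level := h.continuous
  continuous := h.continuous_extCoord
  continuous_bound := h.continuous_height
  nonneg := h.extCoord_nonneg
  le_bound := h.extCoord_le
  bound_mem j b := ⟨h.height_nonneg j b, h.height_le_one j b⟩
  exists_chart a := by
    obtain ⟨j, hj⟩ := h.exists_mem_source a
    exact ⟨e j, _, hj, h.target_eq j, h.snd_apply j, fun b hb =>
      ⟨fun i => h.monotone_extCoord i hb, j, h.strictMono_extCoord_self hb⟩⟩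

theorem eq_of_flattening_eq (h : IsStripAtlas τ e χ j₀) [T2Space A] {w : J → ℝ}
    (hw : ∀ j, 0 < w j) (hs : Summable w) {a a' : A} (ha : a ∈ below τ)
    (haa : flattening w τ (extCoord τ e χ) χ a = flattening w τ (extCoord τ e χ) χ a') :
    a = a' := by
  have hτ : τ a' = τ a := congrArg Prod.snd haa.symm
  have h₀ : 0 < χ j₀ (τ a) := (h.height_pos_iff _).2 ha
  have hmono := h.isFlatteningFamily_extCoord.strictMono_flattening hw hs
    (fun u => h.level_symm u h₀) (fun i => h.monotone_extCoord i h₀)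
    ⟨j₀, h.strictMono_extCoord_self h₀⟩
  have hsa := h.symm_apply (h.mem_source j₀ a ha h₀)
  have hsa' := h.symm_apply (h.mem_source j₀ a' (hτ ▸ ha) (hτ ▸ h₀))
  rw [hτ] at hsa'
  have hcoord : (e j₀ a).1 = (e j₀ a').1 := hmono.injective (by simp only [hsa, hsa', haa])
  rw [← hsa, ← hsa', hcoord]

theorem exists_isOpenEmbedding (h : IsStripAtlas τ e χ j₀) [T2Space A] [Countable J] :
    ∃ Ψ : A → ℝ × unitInterval, IsOpenEmbedding Ψ ∧ (∀ a, (Ψ a).2 = τ a) ∧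
      ∀ x b, b < 1 → (x, b) ∈ range Ψ := by
  have := Encodable.ofCountable J
  obtain ⟨w, hw, c, hc, -⟩ := posSumOfEncodable one_pos J
  have hs : Summable w := hc.summable
  have hflat := h.isFlatteningFamily_extCoord
  have hcont := hflat.continuous_flattening hw hs
  have hopen := hflat.isOpenMap_flattening hw hs
  refine ⟨flattening w τ (extCoord τ e χ) χ, .of_continuous_injective_isOpenMap hcont
    (injective_of_isOpenMap_of_dense hcont hopen h.dense_below fun a ha a' =>
      h.eq_of_flattening_eq hw hs ha) hopen, fun a => rfl, fun x b hb => ?_⟩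
  have h₀ : 0 < χ j₀ b := (h.height_pos_iff b).2 hb
  obtain ⟨u, hu⟩ := hflat.exists_flattening_eq hw hs
    ((e j₀).continuousOn_symm.comp_continuous (by fun_prop) fun u => h.mem_target u h₀)
    (fun u => h.level_symm u h₀) (h.tendsto_extCoord_atBot · hb)
    (h.tendsto_extCoord_atTop · hb) x
  exact ⟨_, hu⟩

end IsStripAtlas

end Atlas

section ModelStrip

variable {X : Type*} {Δ : Setoid X} {P : Set (Quotient Δ)}
  {Ψ : Quotient.mk Δ ⁻¹' P → ℝ × unitInterval}

/-- The trace of the leaf `y` on the line `ℝ × 1`. -/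
def topTrace (Ψ : Quotient.mk Δ ⁻¹' P → ℝ × unitInterval) (y : Quotient Δ) : Set ℝ :=
  {x | ∃ a : Quotient.mk Δ ⁻¹' P, Ψ a = (x, 1) ∧ Quotient.mk Δ (a : X) = y}

theorem fst_mem_topTrace {a : Quotient.mk Δ ⁻¹' P} (ha : (Ψ a).2 = 1) :
    (Ψ a).1 ∈ topTrace Ψ (Quotient.mk Δ (a : X)) :=
  ⟨a, Prod.ext rfl ha, rfl⟩

/-- The range of `Ψ`, as a subset of the plane. -/
def planeImage (Ψ : Quotient.mk Δ ⁻¹' P → ℝ × unitInterval) : Set (ℝ × ℝ) :=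
  range fun a => ((Ψ a).1, ((Ψ a).2 : ℝ))

theorem mem_planeImage {x : ℝ} {b : unitInterval} :
    (x, (b : ℝ)) ∈ planeImage Ψ ↔ (x, b) ∈ range Ψ := by
  simp only [planeImage, Set.mem_range, Prod.ext_iff, Subtype.ext_iff]

theorem mem_planeImage_one {x : ℝ} : (x, (1 : ℝ)) ∈ planeImage Ψ ↔ ∃ y, x ∈ topTrace Ψ y := by
  rw [← Set.Icc.coe_one, mem_planeImage]
  exact ⟨fun ⟨a, ha⟩ => ⟨_, a, ha, rfl⟩, fun ⟨_, a, ha, _⟩ => ⟨a, ha⟩⟩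

variable [TopologicalSpace X]

/-- An open embedding of the union of the leaves in `P` into `ℝ × [0, 1]` that maps the leaves into
horizontal lines. Below the level `1` it maps them onto these lines, and leaves at the level `1`
are isolated there. -/
structure IsStripEmbedding (Ψ : Quotient.mk Δ ⁻¹' P → ℝ × unitInterval) : Prop
    extends IsOpenEmbedding Ψ where
  mem_range : ∀ x b, b < 1 → (x, b) ∈ range Ψ
  level_eq : ∀ a a' : Quotient.mk Δ ⁻¹' P, Quotient.mk Δ (a : X) = Quotient.mk Δ (a' : X) →
    (Ψ a).2 = (Ψ a').2
  mk_eq : ∀ a a', (Ψ a).2 < 1 → (Ψ a).2 = (Ψ a').2 →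
    Quotient.mk Δ (a : X) = Quotient.mk Δ (a' : X)
  eventually_mk_eq : ∀ a, (Ψ a).2 = 1 → ∀ᶠ a' in 𝓝 a, (Ψ a').2 = 1 →
    Quotient.mk Δ (a' : X) = Quotient.mk Δ (a : X)

namespace IsStripEmbedding

theorem isOpen_topTrace (h : IsStripEmbedding Ψ) (y : Quotient Δ) : IsOpen (topTrace Ψ y) := by
  rw [isOpen_iff_mem_nhds]
  rintro x ⟨a, hax, hay⟩
  have himage := h.isOpenMap.image_mem_nhds (h.eventually_mk_eq a (by rw [hax]))
  rw [hax] at himage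
  filter_upwards [(Continuous.prodMk_left (1 : unitInterval)).continuousAt himage]
  rintro x' ⟨a', ha', ha'x⟩
  exact ⟨a', ha'x, (ha' (by rw [ha'x])).trans hay⟩

theorem eq_of_mem_topTrace (h : IsStripEmbedding Ψ) {y y' : Quotient Δ} {x : ℝ}
    (hx : x ∈ topTrace Ψ y) (hx' : x ∈ topTrace Ψ y') : y = y' := by
  obtain ⟨a, hax, rfl⟩ := hx
  obtain ⟨a', hax', rfl⟩ := hx'
  rw [h.injective (hax.trans hax'.symm)]

theorem mk_eq_of_fst_mem_topTrace (h : IsStripEmbedding Ψ) {a : Quotient.mk Δ ⁻¹' P}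
    {y : Quotient Δ} (ha : (Ψ a).2 = 1) (hy : (Ψ a).1 ∈ topTrace Ψ y) :
    Quotient.mk Δ (a : X) = y :=
  h.eq_of_mem_topTrace (fst_mem_topTrace ha) hy

theorem ordConnected_topTrace (h : IsStripEmbedding Ψ)
    (hleaf : ∀ y, IsPreconnected (Quotient.mk Δ ⁻¹' {y})) (y : Quotient Δ) :
    (topTrace Ψ y).OrdConnected := by
  rcases (topTrace Ψ y).eq_empty_or_nonempty with hy | ⟨x₀, a₀, ha₀, rfl⟩
  · rw [hy]
    exact ordConnected_empty
  have hpre : IsPreconnected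
      ((↑) ⁻¹' (Quotient.mk Δ ⁻¹' {Quotient.mk Δ (a₀ : X)}) : Set (Quotient.mk Δ ⁻¹' P)) := by
    have hmem : Quotient.mk Δ (a₀ : X) ∈ P := a₀.2
    rw [← IsInducing.subtypeVal.isPreconnected_image, Subtype.image_preimage_coe,
      ← preimage_inter, inter_eq_right.2 (singleton_subset_iff.2 hmem)]
    exact hleaf _
  have heq : topTrace Ψ (Quotient.mk Δ (a₀ : X)) =
      (fun a => (Ψ a).1) '' ((↑) ⁻¹' (Quotient.mk Δ ⁻¹' {Quotient.mk Δ (a₀ : X)})) := by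
    ext x
    constructor
    · rintro ⟨a, hax, hay⟩
      exact ⟨a, hay, congrArg Prod.fst hax⟩
    · rintro ⟨a, hay, rfl⟩
      exact ⟨a, Prod.ext rfl ((h.level_eq a a₀ hay).trans (by rw [ha₀])), hay⟩
  rw [heq]
  exact (hpre.image _ (continuous_fst.comp h.continuous).continuousOn).ordConnected

theorem isModelStrip_planeImage (h : IsStripEmbedding Ψ)
    (hleaf : ∀ y, IsPreconnected (Quotient.mk Δ ⁻¹' {y})) : IsModelStrip (planeImage Ψ) := by
  refine ⟨0, 1, zero_lt_one, ?_, ?_, ⟨{univ}, pairwiseDisjoint_singleton _ _, ?_, ?_⟩,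
    ⟨{K | K.Nonempty ∧ ∃ y, K = topTrace Ψ y}, ?_, ?_, ?_⟩⟩
  · rintro ⟨x, t⟩ ⟨-, ht⟩
    exact mem_planeImage.2 (h.mem_range x ⟨t, ht.1.le, ht.2.le⟩ (Subtype.mk_lt_mk.2 ht.2))
  · rintro _ ⟨a, rfl⟩
    exact ⟨mem_univ _, (Ψ a).2.2⟩
  · rintro _ rfl
    exact ⟨univ_nonempty, isOpen_univ, ordConnected_univ⟩
  · rw [sUnion_singleton]
    exact (eq_univ_of_forall fun x => mem_planeImage.2 (h.mem_range x 0 zero_lt_one)).symm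
  · rintro _ ⟨-, y, rfl⟩ _ ⟨-, y', rfl⟩ hne
    exact Set.disjoint_left.2 fun x hx hx' => hne (by rw [h.eq_of_mem_topTrace hx hx'])
  · rintro _ ⟨hn, y, rfl⟩
    exact ⟨hn, h.isOpen_topTrace y, h.ordConnected_topTrace hleaf y⟩
  · ext x
    rw [mem_ofPred_eq, mem_planeImage_one]
    exact ⟨fun ⟨_, ⟨_, y, hK⟩, hx⟩ => ⟨y, hK ▸ hx⟩, fun ⟨y, hy⟩ => ⟨_, ⟨⟨x, hy⟩, y, rfl⟩, hy⟩⟩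

theorem mk_eq_of_segment_subset (h : IsStripEmbedding Ψ) {a a' : Quotient.mk Δ ⁻¹' P}
    (ha : (Ψ a).2 = 1) (ha' : (Ψ a').2 = 1)
    (hseg : ∀ x ∈ uIcc (Ψ a).1 (Ψ a').1, (x, (1 : ℝ)) ∈ planeImage Ψ) :
    Quotient.mk Δ (a : X) = Quotient.mk Δ (a' : X) := by
  have hcover : uIcc (Ψ a).1 (Ψ a').1 ⊆ topTrace Ψ (Quotient.mk Δ (a : X)) ∪
      ⋃ y ∈ {y | y ≠ Quotient.mk Δ (a : X)}, topTrace Ψ y := by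
    intro x hx
    obtain ⟨y, hy⟩ := mem_planeImage_one.1 (hseg x hx)
    by_cases hya : y = Quotient.mk Δ (a : X)
    · exact .inl (hya ▸ hy)
    · exact .inr (mem_biUnion hya hy)
  have hdisj : Disjoint (topTrace Ψ (Quotient.mk Δ (a : X)))
      (⋃ y ∈ {y | y ≠ Quotient.mk Δ (a : X)}, topTrace Ψ y) := by
    simp only [disjoint_iUnion_right]
    exact fun y hy => Set.disjoint_left.2 fun x hx hx' => hy (h.eq_of_mem_topTrace hx' hx)
  have hsub := isPreconnected_uIcc.subset_left_of_subset_union (h.isOpen_topTrace _)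
    (isOpen_biUnion fun y _ => h.isOpen_topTrace y) hdisj hcover
    ⟨_, left_mem_uIcc, fst_mem_topTrace ha⟩
  exact (h.mk_eq_of_fst_mem_topTrace ha' (hsub right_mem_uIcc)).symm

theorem segment_iff_mk_eq (h : IsStripEmbedding Ψ)
    (hleaf : ∀ y, IsPreconnected (Quotient.mk Δ ⁻¹' {y})) (a a' : Quotient.mk Δ ⁻¹' P) :
    (((Ψ a).2 : ℝ) = (Ψ a').2 ∧
      ∀ x ∈ uIcc (Ψ a).1 (Ψ a').1, (x, ((Ψ a).2 : ℝ)) ∈ planeImage Ψ) ↔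
    Quotient.mk Δ (a : X) = Quotient.mk Δ (a' : X) := by
  have hcases := (unitInterval.le_one' (t := (Ψ a).2)).lt_or_eq
  constructor
  · rintro ⟨hlevel, hseg⟩
    replace hlevel : (Ψ a).2 = (Ψ a').2 := Subtype.ext hlevel
    rcases hcases with hlt | heq
    · exact h.mk_eq a a' hlt hlevel
    · rw [heq] at hseg
      exact h.mk_eq_of_segment_subset heq (hlevel ▸ heq) hseg
  · intro haa
    have hlevel := h.level_eq a a' haa
    refine ⟨congrArg Subtype.val hlevel, fun x hx => ?_⟩
    rcases hcases with hlt | heq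
    · exact mem_planeImage.2 (h.mem_range _ _ hlt)
    · rw [heq]
      exact mem_planeImage_one.2 ⟨_, (h.ordConnected_topTrace hleaf _).uIcc_subset
        (fst_mem_topTrace heq) (haa ▸ fst_mem_topTrace (hlevel ▸ heq)) hx⟩

theorem exists_modelStrip (h : IsStripEmbedding Ψ)
    (hleaf : ∀ y, IsPreconnected (Quotient.mk Δ ⁻¹' {y})) :
    ∃ S : Set (ℝ × ℝ), IsModelStrip S ∧
      FoliatedHomeomorphic (canonicalFoliation S) Δ (Quotient.mk Δ ⁻¹' P) := by
  have hemb : IsEmbedding fun a => ((Ψ a).1, ((Ψ a).2 : ℝ)) :=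
    (IsEmbedding.id.prodMap IsEmbedding.subtypeVal).comp h.isEmbedding
  let g : Quotient.mk Δ ⁻¹' P ≃ₜ planeImage Ψ := hemb.toHomeomorph
  refine ⟨planeImage Ψ, h.isModelStrip_planeImage hleaf, g.symm,
    isFoliated_of_iff (fun x hx y hxy => ?_) fun p q => ?_⟩
  · rwa [mem_preimage, hxy]
  · obtain ⟨a, rfl⟩ := g.surjective p
    obtain ⟨a', rfl⟩ := g.surjective q
    rw [g.symm_apply_apply, g.symm_apply_apply]
    exact h.segment_iff_mk_eq hleaf a a'

end IsStripEmbedding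

end ModelStrip

section Charts

theorem exists_chart_of_isOpenEmbedding {A B : Type*} [TopologicalSpace A] [TopologicalSpace B]
    {τ : A → B} {V : Set B} (hV : IsOpen V) (hVn : V.Nonempty) {κ : ℝ × V → A}
    (hκ : IsOpenEmbedding κ) (hτ : ∀ q, τ (κ q) = q.2) :
    ∃ E : OpenPartialHomeomorph A (ℝ × B),
      E.source = range κ ∧ E.target = univ ×ˢ V ∧ ∀ a ∈ E.source, (E a).2 = τ a := by
  have := hVn.to_subtype
  have hι : IsOpenEmbedding (Prod.map id Subtype.val : ℝ × V → ℝ × B) :=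
    .prodMap .id hV.isOpenEmbedding_subtypeVal
  let E := (hκ.toOpenPartialHomeomorph κ).symm.trans (hι.toOpenPartialHomeomorph _)
  have hsource : E.source = range κ := by simp [E]
  refine ⟨E, hsource, by simp [E, range_prodMap, univ_prod], ?_⟩
  rw [hsource]
  rintro _ ⟨q, rfl⟩
  have hinv : (hκ.toOpenPartialHomeomorph κ).symm (κ q) = q :=
    (hκ.toOpenPartialHomeomorph κ).left_inv (by simp)
  change ((hκ.toOpenPartialHomeomorph κ).symm (κ q)).2.1 = _
  rw [hinv, hτ]

theorem IsStrip.exists_chart {X T B : Type*} [TopologicalSpace X] [TopologicalSpace T]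
    [TopologicalSpace B] {Δ : Setoid X} {e : ℝ × T → X} (he : IsStrip Δ e)
    {P : Set (Quotient Δ)} {τ : Quotient.mk Δ ⁻¹' P → B} (hτ : Continuous τ) {V : Set B}
    (hV : IsOpen V) (hVn : V.Nonempty) {σ : B → Quotient Δ} (hσ : ContinuousOn σ V)
    (hσe : MapsTo σ V (range (base Δ e))) (hσP : MapsTo σ V P)
    (hτσ : ∀ b ∈ V, ∀ x : Quotient.mk Δ ⁻¹' P, Quotient.mk Δ (x : X) = σ b → τ x = b)
    (ho : IsOpen {x : Quotient.mk Δ ⁻¹' P | Quotient.mk Δ (x : X) ∈ σ '' V}) :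
    ∃ E : OpenPartialHomeomorph (Quotient.mk Δ ⁻¹' P) (ℝ × B),
      E.source = {x : Quotient.mk Δ ⁻¹' P | Quotient.mk Δ (x : X) ∈ σ '' V} ∧
      E.target = univ ×ˢ V ∧ ∀ x ∈ E.source, (E x).2 = τ x := by
  let β : V → T := fun b =>
    he.isOpenEmbedding_base.isEmbedding.toHomeomorph.symm ⟨σ b, hσe b.2⟩
  have hβ : ∀ b, base Δ e (β b) = σ b := fun b =>
    congrArg Subtype.val (he.isOpenEmbedding_base.isEmbedding.toHomeomorph.apply_symm_apply _)
  have hσc : Continuous fun b : V => σ b := continuousOn_iff_continuous_domRestrict.1 hσ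
  have hβc : Continuous β := (Homeomorph.continuous _).comp (hσc.subtype_mk _)
  have hmk : ∀ u b, Quotient.mk Δ (e (u, β b)) = σ b := fun u b => (he.mk_apply u _).trans (hβ b)
  let κ : ℝ × V → Quotient.mk Δ ⁻¹' P := fun q =>
    ⟨e (q.1, β q.2), mem_preimage.2 (hmk q.1 q.2 ▸ hσP q.2.2)⟩
  have hκτ : ∀ q, τ (κ q) = q.2 := fun q => hτσ q.2 q.2.2 _ (hmk q.1 q.2)
  have hec := he.isOpenEmbedding.continuous
  have hκc : Continuous κ := by fun_prop
  have hgraph : IsEmbedding fun q : ℝ × V => (q.2.1, (q.1, β q.2)) :=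
    .of_comp (by fun_prop) (g := fun p : B × ℝ × T => (p.2.1, p.1)) (by fun_prop)
      (IsEmbedding.id.prodMap .subtypeVal)
  have hκ : IsEmbedding κ := by
    refine .of_comp hκc (g := fun x => (τ x, (x : X))) (by fun_prop) ?_
    convert (IsEmbedding.id.prodMap he.isOpenEmbedding.isEmbedding).comp hgraph using 1
    exact funext fun q => Prod.ext (hκτ q) rfl
  have hrange : range κ = {x : Quotient.mk Δ ⁻¹' P | Quotient.mk Δ (x : X) ∈ σ '' V} := by
    refine Subset.antisymm (range_subset_iff.2 fun q => ⟨q.2, q.2.2, (hmk q.1 q.2).symm⟩) ?_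
    rintro x ⟨b, hb, hx⟩
    obtain ⟨u, hu⟩ := he.mk_eq_base (hx.symm.trans (hβ ⟨b, hb⟩).symm)
    exact ⟨(u, ⟨b, hb⟩), Subtype.ext hu⟩
  rw [← hrange]
  exact exists_chart_of_isOpenEmbedding hV hVn ⟨hκ, hrange ▸ ho⟩ hκτ

section Transition

variable {A B : Type*} [TopologicalSpace A] [TopologicalSpace B] {τ : A → B}
  {E₀ E : OpenPartialHomeomorph A (ℝ × B)} {K : Set B}

theorem continuousOn_transition (hK : univ ×ˢ K ⊆ E.target)
    (hKs : ∀ u, ∀ b ∈ K, E.symm (u, b) ∈ E₀.source) :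
    ContinuousOn (fun p : ℝ × B => (E₀ (E.symm p)).1) (univ ×ˢ K) :=
  continuous_fst.comp_continuousOn (E₀.continuousOn.comp (E.continuousOn_symm.mono hK)
    fun p hp => hKs p.1 p.2 hp.2)

theorem injective_transition (hE : ∀ a ∈ E.source, (E a).2 = τ a)
    (hE₀ : ∀ a ∈ E₀.source, (E₀ a).2 = τ a) (hK : univ ×ˢ K ⊆ E.target)
    (hKs : ∀ u, ∀ b ∈ K, E.symm (u, b) ∈ E₀.source) {b : B} (hb : b ∈ K) :
    Function.Injective fun u => (E₀ (E.symm (u, b))).1 := by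
  have htarget : ∀ u, (u, b) ∈ E.target := fun u => hK ⟨mem_univ u, hb⟩
  have hlevel : ∀ u, (E₀ (E.symm (u, b))).2 = b := fun u => by
    rw [hE₀ _ (hKs u b hb), ← hE _ (E.map_target (htarget u)), E.right_inv (htarget u)]
  intro u v huv
  have heq : E.symm (u, b) = E.symm (v, b) :=
    E₀.injOn (hKs u b hb) (hKs v b hb) (Prod.ext huv ((hlevel u).trans (hlevel v).symm))
  exact congrArg Prod.fst (E.symm.injOn (htarget u) (htarget v) heq)

theorem exists_oriented_chart {V : Set B} (hEt : E.target = univ ×ˢ V)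
    (hE : ∀ a ∈ E.source, (E a).2 = τ a) (hE₀ : ∀ a ∈ E₀.source, (E₀ a).2 = τ a)
    (hK : IsPreconnected K) (hKV : K ⊆ V) (hKs : ∀ u, ∀ b ∈ K, E.symm (u, b) ∈ E₀.source) :
    ∃ E' : OpenPartialHomeomorph A (ℝ × B), E'.source = E.source ∧ E'.target = univ ×ˢ V ∧
      (∀ a ∈ E'.source, (E' a).2 = τ a) ∧
      ∀ b ∈ K, StrictMono fun u => (E₀ (E'.symm (u, b))).1 := by
  rcases K.eq_empty_or_nonempty with rfl | ⟨b₀, hb₀⟩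
  · exact ⟨E, rfl, hEt, hE, fun b hb => absurd hb (notMem_empty b)⟩
  have hKt : univ ×ˢ K ⊆ E.target := hEt ▸ prod_mono_right hKV
  have hc := continuousOn_transition hKt hKs
  have hcb : ∀ u, ContinuousOn (fun b => (E₀ (E.symm (u, b))).1) K := fun u =>
    hc.comp (f := fun b => (u, b)) (by fun_prop) fun b hb => ⟨mem_univ _, hb⟩
  have hcu : ∀ b ∈ K, Continuous fun u => (E₀ (E.symm (u, b))).1 := fun b hb =>
    hc.comp_continuous (f := fun u => (u, b)) (by fun_prop) fun u => ⟨mem_univ _, hb⟩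
  have hinj : ∀ b ∈ K, Function.Injective fun u => (E₀ (E.symm (u, b))).1 := fun _ hb =>
    injective_transition hE hE₀ hKt hKs hb
  rcases (hcu b₀ hb₀).strictMono_of_inj (hinj b₀ hb₀) with hmono | hanti
  · exact ⟨E, rfl, hEt, hE, strictMono_of_isPreconnected (g := fun b u => (E₀ (E.symm (u, b))).1)
      hK hcb hcu hinj hb₀ hmono⟩
  · refine ⟨E.transHomeomorph ((Homeomorph.neg ℝ).prodCongr (.refl B)), rfl, ?_, hE, ?_⟩
    · simp only [OpenPartialHomeomorph.transHomeomorph_target, hEt]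
      rfl
    · exact strictMono_of_isPreconnected (g := fun b u => (E₀ (E.symm (-u, b))).1) hK
        (fun u => hcb (-u)) (fun b hb => (hcu b hb).comp continuous_neg)
        (fun b hb => (hinj b hb).comp neg_injective) hb₀ fun u v huv => hanti (neg_lt_neg huv)

end Transition

end Charts

section HalfCurve

theorem eventually_mem_of_frequently_mem_atTop {α : Type*} [Preorder α] [IsDirectedOrder α]
    [Nonempty α] {S : Set α} (hS : S.OrdConnected) (h : ∃ᶠ t in atTop, t ∈ S) :
    ∀ᶠ t in atTop, t ∈ S := by
  obtain ⟨t₀, ht₀⟩ := h.exists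
  filter_upwards [eventually_ge_atTop t₀] with t ht
  obtain ⟨s, hts, hs⟩ := frequently_atTop.1 h t
  exact hS.out ht₀ hs ⟨ht, hts⟩

variable {Y : Type*} {γ : Ioo (-1 : ℝ) 1 → Y} {y z : Y} {b : unitInterval}

/-- The half `γ '' [0, 1)` of a curve `γ` on `(-1, 1)`. -/
def posHalf (γ : Ioo (-1 : ℝ) 1 → Y) : Set Y := γ '' {t | 0 ≤ t.1}

/-- The parameter on the positive half of a curve, extended by the value `1`. -/
noncomputable def halfLevel (γ : Ioo (-1 : ℝ) 1 → Y) (y : Y) : unitInterval :=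
  open Classical in
  if h : y ∈ posHalf γ then ⟨h.choose.1, h.choose_spec.1, h.choose.2.2.le⟩ else 1

/-- The curve on `[0, 1]` that agrees with `γ` on `[0, 1)` and ends at `y`. -/
noncomputable def closedCurve (γ : Ioo (-1 : ℝ) 1 → Y) (y : Y) (b : unitInterval) : Y :=
  if h : b < 1 then γ ⟨b, neg_one_lt_zero.trans_le b.2.1, h⟩ else y

theorem closedCurve_of_lt (y : Y) (h : b < 1) :
    closedCurve γ y b = γ ⟨b, neg_one_lt_zero.trans_le b.2.1, h⟩ := dif_pos h

theorem closedCurve_one : closedCurve γ y 1 = y := dif_neg (lt_irrefl _)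

theorem closedCurve_mem_posHalf (y : Y) (h : b < 1) : closedCurve γ y b ∈ posHalf γ := by
  rw [closedCurve_of_lt y h]
  exact ⟨_, b.2.1, rfl⟩

theorem halfLevel_apply (hγ : Function.Injective γ) {t : Ioo (-1 : ℝ) 1} (ht : 0 ≤ t.1) :
    halfLevel γ (γ t) = ⟨t, ht, t.2.2.le⟩ := by
  have h : γ t ∈ posHalf γ := ⟨t, ht, rfl⟩
  rw [halfLevel, dif_pos h]
  exact Subtype.ext (congrArg (fun s : Ioo (-1 : ℝ) 1 => (s : ℝ)) (hγ h.choose_spec.2))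

theorem halfLevel_of_notMem (hy : y ∉ posHalf γ) : halfLevel γ y = 1 := dif_neg hy

theorem halfLevel_lt_one_iff : halfLevel γ y < 1 ↔ y ∈ posHalf γ := by
  refine ⟨fun h => not_imp_comm.1 halfLevel_of_notMem h.ne, fun h => ?_⟩
  rw [halfLevel, dif_pos h]
  exact Subtype.mk_lt_mk.2 h.choose.2.2

theorem closedCurve_halfLevel (hγ : Function.Injective γ) (y : Y) (h : halfLevel γ z < 1) :
    closedCurve γ y (halfLevel γ z) = z := by
  obtain ⟨t, ht, rfl⟩ := halfLevel_lt_one_iff.1 h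
  rw [halfLevel_apply hγ ht]
  exact closedCurve_of_lt y t.2.2

theorem halfLevel_closedCurve_of_lt (hγ : Function.Injective γ) (y : Y) (h : b < 1) :
    halfLevel γ (closedCurve γ y b) = b := by
  rw [closedCurve_of_lt y h, halfLevel_apply hγ b.2.1]

theorem halfLevel_closedCurve (hγ : Function.Injective γ) (hy : y ∉ posHalf γ)
    (b : unitInterval) : halfLevel γ (closedCurve γ y b) = b := by
  rcases (unitInterval.le_one' (t := b)).lt_or_eq with hb | rfl
  · exact halfLevel_closedCurve_of_lt hγ y hb
  · rw [closedCurve_one, halfLevel_of_notMem hy]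

theorem halfLevel_le_iff (hγ : Function.Injective γ) (hb : b < 1) :
    halfLevel γ y ≤ b ↔ y ∈ γ '' (Subtype.val ⁻¹' Icc 0 (b : ℝ)) := by
  constructor
  · intro hy
    have hlt := hy.trans_lt hb
    rw [← closedCurve_halfLevel hγ y hlt, closedCurve_of_lt y hlt]
    exact ⟨_, ⟨(halfLevel γ y).2.1, hy⟩, rfl⟩
  · rintro ⟨t, ⟨ht, htb⟩, rfl⟩
    rw [halfLevel_apply hγ ht]
    exact htb

theorem isCompact_preimage_val_Icc {r : ℝ} (hr : r < 1) :
    IsCompact (Subtype.val ⁻¹' Icc 0 r : Set (Ioo (-1 : ℝ) 1)) :=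
  IsInducing.subtypeVal.isCompact_preimage' isCompact_Icc fun _ ht => by
    rw [Subtype.range_coe]
    exact ⟨neg_one_lt_zero.trans_le ht.1, ht.2.trans_lt hr⟩

variable [TopologicalSpace Y]

theorem continuousOn_closedCurve (hγ : Continuous γ) (y : Y) :
    ContinuousOn (closedCurve γ y) (Iio 1) := by
  rw [continuousOn_iff_continuous_domRestrict]
  have hc : Continuous fun b : Iio (1 : unitInterval) =>
      γ ⟨b.1, neg_one_lt_zero.trans_le b.1.2.1, b.2⟩ :=
    hγ.comp (Continuous.subtype_mk (by fun_prop) _)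
  convert hc using 1
  funext b
  exact closedCurve_of_lt y b.2

theorem continuous_closedCurve (hγ : Continuous γ) (hy : Tendsto γ atTop (𝓝 y)) :
    Continuous (closedCurve γ y) := by
  refine continuous_iff_continuousAt.2 fun b => ?_
  rcases (unitInterval.le_one' (t := b)).lt_or_eq with hb | rfl
  · exact (continuousOn_closedCurve hγ y).continuousAt (isOpen_Iio.mem_nhds hb)
  · intro W hW
    have : Nonempty (Ioo (-1 : ℝ) 1) := nonempty_Ioo_subtype (by norm_num)
    rw [closedCurve_one] at hW
    obtain ⟨r, hr⟩ := mem_atTop_sets.1 (hy hW)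
    have hlate : {b : unitInterval | (r : ℝ) < b} ∈ 𝓝 1 :=
      (isOpen_lt continuous_const continuous_subtype_val).mem_nhds r.2.2
    change closedCurve γ y ⁻¹' W ∈ 𝓝 1
    filter_upwards [hlate] with b hb
    rcases (unitInterval.le_one' (t := b)).lt_or_eq with hb1 | rfl
    · rw [mem_preimage, closedCurve_of_lt y hb1]
      exact hr _ hb.le
    · rw [mem_preimage, closedCurve_one]
      exact mem_of_mem_nhds hW

/-- The points outside of the positive half of `γ` that adhere to it. -/
def ends (γ : Ioo (-1 : ℝ) 1 → Y) : Set Y := closure (posHalf γ) \ posHalf γ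

theorem closedCurve_mem_closure (hy : y ∈ ends γ) (b : unitInterval) :
    closedCurve γ y b ∈ closure (posHalf γ) := by
  rcases (unitInterval.le_one' (t := b)).lt_or_eq with hb | rfl
  · exact subset_closure (closedCurve_mem_posHalf y hb)
  · rw [closedCurve_one]
    exact hy.1

/-- An open arc, closed on every compact interval of parameters, that converges to each of the
points adhering to its positive half. These are the curves of leaves in the components of the
regular leaves; in a leaf space, which need not be Hausdorff, they may converge to many points. -/
structure ConvergesToEnds (γ : Ioo (-1 : ℝ) 1 → Y) : Prop extends IsOpenEmbedding γ where
  isClosed_image : ∀ K, IsCompact K → IsClosed (γ '' K)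
  tendsto : ∀ y ∈ ends γ, Tendsto γ atTop (𝓝 y)

namespace ConvergesToEnds

theorem nonneg_of_mem_closure (hγ : ConvergesToEnds γ) {t : Ioo (-1 : ℝ) 1}
    (ht : γ t ∈ closure (posHalf γ)) : 0 ≤ t.1 := by
  by_contra! hneg
  have hopen : IsOpen (γ '' {t | t.1 < 0}) :=
    hγ.isOpenMap _ (isOpen_Iio.preimage continuous_subtype_val)
  obtain ⟨_, ⟨s, hs, rfl⟩, s', hs', hss⟩ :=
    mem_closure_iff_nhds.1 ht _ (hopen.mem_nhds ⟨t, hneg, rfl⟩)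
  rw [hγ.injective hss] at hs'
  exact (show s.1 < 0 from hs).not_ge hs'

theorem continuousOn_halfLevel (hγ : ConvergesToEnds γ) :
    ContinuousOn (halfLevel γ) (closure (posHalf γ)) := by
  rw [continuousOn_iff_continuous_domRestrict, OrderTopology.continuous_iff]
  refine fun b => ⟨?_, ?_⟩
  · rcases (unitInterval.le_one' (t := b)).lt_or_eq with hb | rfl
    · have hclosed := hγ.isClosed_image _ (isCompact_preimage_val_Icc hb)
      convert hclosed.isOpen_compl.preimage continuous_subtype_val using 1
      ext y
      rw [mem_preimage, mem_preimage, mem_compl_iff, ← halfLevel_le_iff hγ.injective hb, not_le]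
      rfl
    · convert isOpen_empty
      exact eq_empty_of_forall_notMem fun y => unitInterval.le_one'.not_gt
  · have hopen : IsOpen (γ '' {t | t.1 < b}) :=
      hγ.isOpenMap _ (isOpen_Iio.preimage continuous_subtype_val)
    convert hopen.preimage continuous_subtype_val using 1
    ext ⟨y, hy⟩
    constructor
    · intro (hyb : halfLevel γ y < b)
      have hlt := hyb.trans_le unitInterval.le_one'
      change y ∈ γ '' _
      rw [← closedCurve_halfLevel hγ.injective y hlt, closedCurve_of_lt y hlt]
      exact ⟨_, hyb, rfl⟩
    · rintro ⟨t, ht, rfl⟩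
      change halfLevel γ (γ t) < b
      rw [halfLevel_apply hγ.injective (hγ.nonneg_of_mem_closure hy)]
      exact ht

theorem eq_of_mem_range (hγ : ConvergesToEnds γ) {T : Type*} [TopologicalSpace T] [T2Space T]
    {α : T → Y} (hα : IsOpenEmbedding α) (hy : y ∈ ends γ) (hz : z ∈ ends γ) (hyα : y ∈ range α)
    (hzα : z ∈ range α) : y = z := by
  obtain ⟨s, rfl⟩ := hyα
  obtain ⟨s', rfl⟩ := hzα
  by_contra hne
  have : Nonempty (Ioo (-1 : ℝ) 1) := nonempty_Ioo_subtype (by norm_num)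
  have hdisjoint : Disjoint (𝓝 (α s)) (𝓝 (α s')) := by
    rw [← hα.map_nhds_eq, ← hα.map_nhds_eq, disjoint_map hα.injective]
    exact disjoint_nhds_nhds.2 fun h => hne (congrArg α h)
  exact (hγ.tendsto _ hy).not_tendsto hdisjoint (hγ.tendsto _ hz)

end ConvergesToEnds

end HalfCurve

section HalfClosure

variable {X : Type*} [TopologicalSpace X] {Δ : Setoid X} {e : ℝ × Ioo (-1 : ℝ) 1 → X}

theorem LocallyStrip.closure_image_half (h : LocallyStrip Δ) (he : IsStrip Δ e) :
    closure (e '' {q | 0 ≤ q.2.1}) = Quotient.mk Δ ⁻¹' closure (posHalf (IsStrip.base Δ e)) := by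
  rw [h.isOpenMap.preimage_closure_eq_closure_preimage continuous_quotient_mk', posHalf,
    he.preimage_image_base]
  congr 2
  ext q
  simp

theorem LocallyStrip.eventually_eq_of_mem_ends (h : LocallyStrip Δ)
    {γ : Ioo (-1 : ℝ) 1 → Quotient Δ} (hγ : ConvergesToEnds γ) {y : Quotient Δ} (hy : y ∈ ends γ) :
    ∀ᶠ z in 𝓝 y, z ∈ ends γ → z = y := by
  obtain ⟨x, rfl⟩ := Quotient.exists_rep y
  obtain ⟨J, e, he, ⟨u, t⟩, rfl⟩ := h x
  have hα := he.isOpenEmbedding_base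
  have hyα : Quotient.mk Δ (e (u, t)) ∈ range (IsStrip.base Δ e) := ⟨t, (he.mk_apply u t).symm⟩
  filter_upwards [hα.isOpen_range.mem_nhds hyα] with z hzα hz
  exact hγ.eq_of_mem_range hα hz hy hzα hyα

theorem LocallyStrip.countable_ends [SecondCountableTopology X] (h : LocallyStrip Δ)
    {γ : Ioo (-1 : ℝ) 1 → Quotient Δ} (hγ : ConvergesToEnds γ) : Countable (ends γ) := by
  have : SecondCountableTopology (Quotient Δ) :=
    isQuotientMap_quotient_mk'.secondCountableTopology h.isOpenMap
  have : DiscreteTopology (ends γ) := by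
    refine discreteTopology_iff_singleton_mem_nhds.2 fun y => ?_
    filter_upwards [continuous_subtype_val.continuousAt.eventually
      (h.eventually_eq_of_mem_ends hγ y.2)] with z hz
    exact Subtype.ext (hz z.2)
  exact TopologicalSpace.separableSpace_iff_countable.1 inferInstance

/-- The level of a point in the closure of the positive half of a family of leaves. -/
noncomputable def closureLevel {γ : Ioo (-1 : ℝ) 1 → Quotient Δ}
    (a : Quotient.mk Δ ⁻¹' closure (posHalf γ)) : unitInterval :=
  halfLevel γ (Quotient.mk Δ (a : X))

section Level

variable {γ : Ioo (-1 : ℝ) 1 → Quotient Δ} {a : Quotient.mk Δ ⁻¹' closure (posHalf γ)}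

theorem continuous_closureLevel (hγ : ConvergesToEnds γ) : Continuous (closureLevel (γ := γ)) :=
  hγ.continuousOn_halfLevel.comp_continuous (continuous_quotient_mk'.comp continuous_subtype_val)
    fun a => a.2

theorem closedCurve_closureLevel (hγ : ConvergesToEnds γ) (y : Quotient Δ)
    (ha : closureLevel a < 1) :
    closedCurve γ y (closureLevel a) = Quotient.mk Δ (a : X) :=
  closedCurve_halfLevel hγ.injective y ha

theorem mk_mem_ends (ha : closureLevel a = 1) : Quotient.mk Δ (a : X) ∈ ends γ :=
  ⟨a.2, fun h => (halfLevel_lt_one_iff.2 h).ne ha⟩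

end Level

theorem IsStrip.exists_chart_below (he : IsStrip Δ e) (hγ : ConvergesToEnds (base Δ e)) :
    ∃ E : OpenPartialHomeomorph (Quotient.mk Δ ⁻¹' closure (posHalf (base Δ e)))
        (ℝ × unitInterval),
      E.source = {a | closureLevel a < 1} ∧ E.target = univ ×ˢ Iio 1 ∧
      ∀ a ∈ E.source, (E a).2 = closureLevel a := by
  let σ := closedCurve (base Δ e) (base Δ e ⟨0, by norm_num, by norm_num⟩)
  have hσ : ∀ b < 1, σ b ∈ posHalf (base Δ e) := fun b => closedCurve_mem_posHalf _
  have hlevel : ∀ b < 1, halfLevel (base Δ e) (σ b) = b := fun b =>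
    halfLevel_closedCurve_of_lt hγ.injective _
  have hsource : {a : Quotient.mk Δ ⁻¹' closure (posHalf (base Δ e)) |
      Quotient.mk Δ (a : X) ∈ σ '' Iio 1} = {a | closureLevel a < 1} := by
    refine Set.ext fun a => ⟨?_, fun ha => ⟨_, ha, closedCurve_closureLevel hγ _ ha⟩⟩
    rintro ⟨b, hb, hba⟩
    rw [mem_ofPred_eq, closureLevel, ← hba, hlevel b hb]
    exact hb
  rw [← hsource]
  refine he.exists_chart (continuous_closureLevel hγ) isOpen_Iio ⟨0, mem_Iio.2 zero_lt_one⟩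
    (continuousOn_closedCurve hγ.continuous _)
    (fun b hb => image_subset_range _ _ (hσ b hb)) (fun b hb => subset_closure (hσ b hb))
    (fun b hb a ha => ?_) ?_
  · rw [closureLevel, ha, hlevel b hb]
  · rw [hsource]
    exact isOpen_lt (continuous_closureLevel hγ) continuous_const

theorem ConvergesToEnds.setOf_mk_mem_image_closedCurve {γ : Ioo (-1 : ℝ) 1 → Quotient Δ}
    (hγ : ConvergesToEnds γ) {T : Type*} [TopologicalSpace T] [T2Space T] {α : T → Quotient Δ}
    (hα : IsOpenEmbedding α) {y : Quotient Δ} (hy : y ∈ ends γ) (hyα : y ∈ range α)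
    {c : unitInterval} (hσα : MapsTo (closedCurve γ y) (Ioi c) (range α)) :
    {a : Quotient.mk Δ ⁻¹' closure (posHalf γ) |
        Quotient.mk Δ (a : X) ∈ closedCurve γ y '' Ioi c} =
      {a : Quotient.mk Δ ⁻¹' closure (posHalf γ) |
        Quotient.mk Δ (a : X) ∈ range α ∧ c < closureLevel a} := by
  refine Set.ext fun a => ⟨?_, fun ⟨haα, hac⟩ => ⟨_, hac, ?_⟩⟩
  · rintro ⟨b, hb, hba⟩
    rw [mem_ofPred_eq, closureLevel, ← hba, halfLevel_closedCurve hγ.injective hy.2]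
    exact ⟨hσα hb, hb⟩
  · rcases (unitInterval.le_one' (t := closureLevel a)).lt_or_eq with ha | ha
    · exact closedCurve_closureLevel hγ y ha
    · rw [ha, closedCurve_one]
      exact hγ.eq_of_mem_range hα hy (mk_mem_ends ha) hyα haα

theorem LocallyStrip.exists_chart_at_end (h : LocallyStrip Δ) {γ : Ioo (-1 : ℝ) 1 → Quotient Δ}
    (hγ : ConvergesToEnds γ) {y : Quotient Δ} (hy : y ∈ ends γ) :
    ∃ (c : unitInterval)
      (E : OpenPartialHomeomorph (Quotient.mk Δ ⁻¹' closure (posHalf γ)) (ℝ × unitInterval)),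
      c < 1 ∧
      E.source = {a : Quotient.mk Δ ⁻¹' closure (posHalf γ) |
        Quotient.mk Δ (a : X) ∈ closedCurve γ y '' Ioi c} ∧
      E.target = univ ×ˢ Ioi c ∧ ∀ a ∈ E.source, (E a).2 = closureLevel a := by
  obtain ⟨x, rfl⟩ := Quotient.exists_rep y
  obtain ⟨J, e, he, ⟨u, t⟩, rfl⟩ := h x
  set y := Quotient.mk Δ (e (u, t))
  have hα := he.isOpenEmbedding_base
  have hyα : y ∈ range (IsStrip.base Δ e) := ⟨t, (he.mk_apply u t).symm⟩
  have hσ := continuous_closedCurve hγ.continuous (hγ.tendsto y hy)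
  have hnhds : closedCurve γ y ⁻¹' range (IsStrip.base Δ e) ∈ 𝓝 1 :=
    hσ.continuousAt (hα.isOpen_range.mem_nhds (by rwa [closedCurve_one]))
  obtain ⟨c, hc1, hc⟩ := exists_Ioc_subset_of_mem_nhds hnhds ⟨0, zero_lt_one⟩
  have hσα : MapsTo (closedCurve γ y) (Ioi c) (range (IsStrip.base Δ e)) := fun b hb =>
    hc ⟨hb, unitInterval.le_one'⟩
  have hmk : Continuous fun a : Quotient.mk Δ ⁻¹' closure (posHalf γ) => Quotient.mk Δ (a : X) :=
    continuous_quotient_mk'.comp continuous_subtype_val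
  have hopen := (hα.isOpen_range.preimage hmk).inter
    (isOpen_lt continuous_const (continuous_closureLevel hγ) : IsOpen {a | c < closureLevel a})
  obtain ⟨E, hE⟩ := he.exists_chart (continuous_closureLevel hγ) isOpen_Ioi ⟨1, hc1⟩
    hσ.continuousOn hσα (fun b _ => closedCurve_mem_closure hy b)
    (fun b _ a ha => by rw [closureLevel, ha, halfLevel_closedCurve hγ.injective hy.2])
    (hγ.setOf_mk_mem_image_closedCurve hα hy hyα hσα ▸ hopen)
  exact ⟨c, E, hc1, hE⟩

theorem LocallyStrip.exists_oriented_chart_at_end (h : LocallyStrip Δ)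
    {γ : Ioo (-1 : ℝ) 1 → Quotient Δ} (hγ : ConvergesToEnds γ)
    {E₀ : OpenPartialHomeomorph (Quotient.mk Δ ⁻¹' closure (posHalf γ)) (ℝ × unitInterval)}
    (hE₀s : E₀.source = {a | closureLevel a < 1})
    (hE₀ : ∀ a ∈ E₀.source, (E₀ a).2 = closureLevel a) {y : Quotient Δ} (hy : y ∈ ends γ) :
    ∃ (c : unitInterval)
      (E : OpenPartialHomeomorph (Quotient.mk Δ ⁻¹' closure (posHalf γ)) (ℝ × unitInterval)),
      c < 1 ∧
      E.source = {a : Quotient.mk Δ ⁻¹' closure (posHalf γ) |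
        Quotient.mk Δ (a : X) ∈ closedCurve γ y '' Ioi c} ∧
      E.target = univ ×ˢ Ioi c ∧ (∀ a ∈ E.source, (E a).2 = closureLevel a) ∧
      ∀ b ∈ Ioo c 1, StrictMono fun u => (E₀ (E.symm (u, b))).1 := by
  obtain ⟨c, E, hc, hEs, hEt, hE⟩ := h.exists_chart_at_end hγ hy
  have htransition : ∀ u, ∀ b ∈ Ioo c 1, E.symm (u, b) ∈ E₀.source := fun u b hb => by
    have htarget : (u, b) ∈ E.target := hEt ▸ ⟨mem_univ u, hb.1⟩
    rw [hE₀s, mem_ofPred_eq, ← hE _ (E.map_target htarget), E.right_inv htarget]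
    exact hb.2
  obtain ⟨E', hE's, hE't, hE', hmono⟩ := exists_oriented_chart hEt hE hE₀
    (isPreconnected_of_ordConnected_coe ordConnected_Icc ordConnected_Ioo) Ioo_subset_Ioi_self
    htransition
  exact ⟨c, E', hc, hE's.trans hEs, hE't, hE', hmono⟩

/-- The heights of the charts of a half: the chart below the top level is used on `[0, 1)`, the one
at the end `j` on `(c j, 1]`. -/
noncomputable def endHeight {J : Type*} (c : J → unitInterval) :
    Option J → unitInterval → ℝ
  | none, b => 1 - b
  | some j, b => max 0 (b - c j)

theorem isStripAtlas_option {A J : Type*} [TopologicalSpace A] {τ : A → unitInterval}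
    (hτ : Continuous τ) {E₀ : OpenPartialHomeomorph A (ℝ × unitInterval)}
    (hE₀s : E₀.source = {a | τ a < 1}) (hE₀t : E₀.target = univ ×ˢ Iio 1)
    (hE₀ : ∀ a ∈ E₀.source, (E₀ a).2 = τ a) {c : J → unitInterval}
    {E : J → OpenPartialHomeomorph A (ℝ × unitInterval)}
    (hEt : ∀ j, (E j).target = univ ×ˢ Ioi (c j)) (hE : ∀ j, ∀ a ∈ (E j).source, (E j a).2 = τ a)
    (hEs : ∀ j a, τ a < 1 → c j < τ a → a ∈ (E j).source)
    (htop : ∀ a, τ a = 1 → ∃ j, a ∈ (E j).source)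
    (hmono : ∀ j, ∀ b ∈ Ioo (c j) 1, StrictMono fun u => (E₀ ((E j).symm (u, b))).1) :
    IsStripAtlas τ (fun j : Option J => j.elim E₀ E) (endHeight c) none where
  continuous := hτ
  continuous_height := by
    rintro (_ | j)
    · exact continuous_const.sub continuous_subtype_val
    · exact continuous_const.max (continuous_subtype_val.sub continuous_const)
  height_nonneg := by
    rintro (_ | j) b
    · exact sub_nonneg.2 b.2.2
    · exact le_max_left _ _
  height_le_one := by
    rintro (_ | j) b
    · exact sub_le_self _ b.2.1
    · exact max_le zero_le_one ((sub_le_self _ (c j).2.1).trans b.2.2)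
  target_eq := by
    rintro (_ | j)
    · refine hE₀t.trans (congrArg _ (Set.ext fun b => ?_))
      exact (sub_pos (a := (1 : ℝ)) (b := b)).symm
    · refine (hEt j).trans (congrArg _ (Set.ext fun b => ?_))
      simp [endHeight]
  snd_apply := by
    rintro (_ | j)
    exacts [hE₀, hE j]
  mem_source := by
    rintro (_ | j) a ha hpos
    · exact hE₀s ▸ ha
    · exact hEs j a ha (by simpa [endHeight] using hpos)
  height_pos_iff b := sub_pos
  exists_mem_source a := by
    rcases (unitInterval.le_one' (t := τ a)).lt_or_eq with ha | ha
    · exact ⟨none, hE₀s ▸ ha⟩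
    · obtain ⟨j, hj⟩ := htop a ha
      exact ⟨some j, hj⟩
  strictMono := by
    rintro (_ | j) b hb hpos
    · have hinv : ∀ u, E₀ (E₀.symm (u, b)) = (u, b) := fun u =>
        E₀.right_inv (hE₀t ▸ ⟨mem_univ u, hb⟩)
      simp only [Option.elim_none, hinv]
      exact strictMono_id
    · exact hmono j b ⟨by simpa [endHeight] using hpos, hb⟩

theorem LocallyStrip.exists_modelStrip_closure [T2Space X] [SecondCountableTopology X]
    (h : LocallyStrip Δ) (he : IsStrip Δ e) (hγ : ConvergesToEnds (IsStrip.base Δ e)) :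
    ∃ S : Set (ℝ × ℝ), IsModelStrip S ∧
      FoliatedHomeomorphic (canonicalFoliation S) Δ (closure (e '' {q | 0 ≤ q.2.1})) := by
  have := h.countable_ends hγ
  obtain ⟨E₀, hE₀s, hE₀t, hE₀⟩ := he.exists_chart_below hγ
  choose c E hc hEs hEt hE hmono using fun y : ends (IsStrip.base Δ e) =>
    h.exists_oriented_chart_at_end hγ hE₀s hE₀ y.2
  have hatlas := isStripAtlas_option (continuous_closureLevel hγ) hE₀s hE₀t hE₀ hEt hE
    (fun y a ha hca => hEs y ▸ ⟨_, hca, closedCurve_closureLevel hγ _ ha⟩)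
    (fun a ha => ⟨⟨_, mk_mem_ends ha⟩, hEs _ ▸ ⟨1, hc _, closedCurve_one⟩⟩) hmono
  obtain ⟨Ψ, hΨ, hlevel, hfull⟩ := hatlas.exists_isOpenEmbedding
  have hΨe : IsStripEmbedding Ψ := by
    refine ⟨hΨ, hfull, fun a a' haa => ?_, fun a a' ha haa => ?_, fun a ha => ?_⟩
    · rw [hlevel, hlevel, closureLevel, closureLevel, haa]
    · rw [hlevel] at ha haa
      rw [hlevel] at haa
      rw [← closedCurve_closureLevel hγ (Quotient.mk Δ (a : X)) ha, haa,
        closedCurve_closureLevel hγ _ (haa ▸ ha)]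
    · rw [hlevel] at ha
      have hmk : Continuous fun a : Quotient.mk Δ ⁻¹' closure (posHalf (IsStrip.base Δ e)) =>
        Quotient.mk Δ (a : X) := continuous_quotient_mk'.comp continuous_subtype_val
      filter_upwards [hmk.continuousAt.eventually (h.eventually_eq_of_mem_ends hγ (mk_mem_ends ha))]
        with a' ha' ha'1
      exact ha' (mk_mem_ends (hlevel a' ▸ ha'1))
  rw [h.closure_image_half he]
  exact hΨe.exists_modelStrip h.isPreconnected_leaf

end HalfClosure

section Halves

variable {X : Type*} [TopologicalSpace X] {Δ : Setoid X}

section ClassF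

variable [ChartedSpace (EuclideanHalfSpace 2) X] {e : ℝ × Ioo (-1 : ℝ) 1 → X}

theorem IsStrip.isClosed_image_base (he : IsStrip Δ e)
    (hreg : range (base Δ e) ⊆ regularLeaves Δ) {K : Set (Ioo (-1 : ℝ) 1)} (hK : IsCompact K) :
    IsClosed (base Δ e '' K) :=
  isClosed_of_isCompact_not_special (hK.image he.isOpenEmbedding_base.continuous) fun _ hy =>
    (hreg (image_subset_range _ _ hy)).1

theorem IsStrip.frequently_mem_of_mem_closure (he : IsStrip Δ e)
    (hreg : range (base Δ e) ⊆ regularLeaves Δ) {C : Set (Quotient Δ)} {y : Quotient Δ}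
    (hy : y ∉ posHalf (base Δ e)) (hyC : y ∈ closure (C ∩ posHalf (base Δ e))) :
    ∃ᶠ t in atTop, base Δ e t ∈ C := by
  have : Nonempty (Ioo (-1 : ℝ) 1) := nonempty_Ioo_subtype (by norm_num)
  refine frequently_atTop.2 fun r => ?_
  have hopen := (he.isClosed_image_base hreg (isCompact_preimage_val_Icc r.2.2)).isOpen_compl
  obtain ⟨_, ht', htC, t, ht, rfl⟩ := mem_closure_iff_nhds.1 hyC _
    (hopen.mem_nhds fun h => hy (image_mono (fun t ht => ht.1) h))
  refine ⟨t, le_of_not_ge fun htr => ht' ⟨t, ⟨ht, htr⟩, rfl⟩, htC⟩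

theorem IsClassF.tendsto_of_mem_ends (hΔ : IsClassF Δ)
    (hfin : LocallyFinite (fun ω : specialLeaves Δ => (ω : Set X))) (he : IsStrip Δ e)
    (hreg : range (IsStrip.base Δ e) ⊆ regularLeaves Δ)
    (habs : ∀ C ⊆ regularLeaves Δ, IsPreconnected (Quotient.mk Δ ⁻¹' C) →
      (C ∩ range (IsStrip.base Δ e)).Nonempty → C ⊆ range (IsStrip.base Δ e))
    {y : Quotient Δ} (hy : y ∈ ends (IsStrip.base Δ e)) :
    Tendsto (IsStrip.base Δ e) atTop (𝓝 y) := by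
  set γ := IsStrip.base Δ e
  have hγ : IsOpenEmbedding γ := he.isOpenEmbedding_base
  have : Nonempty (Ioo (-1 : ℝ) 1) := nonempty_Ioo_subtype (by norm_num)
  intro W hW
  obtain ⟨C₁, C₂, hC₁, hC₂, hW₁, hW₂, hN⟩ := hΔ.exists_sides hfin y hW
  have hside : ∀ C, IsPreconnected (Quotient.mk Δ ⁻¹' C) → C ⊆ W ∩ regularLeaves Δ →
      y ∈ closure (C ∩ posHalf γ) → ∀ᶠ t in atTop, γ t ∈ W := by
    intro C hC hCW hyC
    have hfreq := he.frequently_mem_of_mem_closure hreg hy.2 hyC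
    obtain ⟨t₀, ht₀⟩ := hfreq.exists
    have hCγ : C ⊆ range γ := habs C (hCW.trans inter_subset_right) hC ⟨_, ht₀, t₀, rfl⟩
    have hCc : IsPreconnected C := by
      rw [← image_preimage_eq C (Quotient.mk_surjective (s := Δ))]
      exact hC.image _ continuous_quotient_mk'.continuousOn
    have hpre := hCc.preimage_of_isOpenMap hγ.injective hγ.isOpenMap hCγ
    exact (eventually_mem_of_frequently_mem_atTop hpre.ordConnected hfreq).mono fun t ht =>
      (hCW ht).1
  have hclosure : y ∈ closure (C₁ ∩ posHalf γ ∪ C₂ ∩ posHalf γ) := by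
    refine mem_closure_iff_nhds.2 fun U hU => ?_
    obtain ⟨z, ⟨hzU, rfl | hz⟩, hzH⟩ := mem_closure_iff_nhds.1 hy.1 _ (inter_mem hU hN)
    · exact absurd hzH hy.2
    · exact ⟨z, hzU, union_inter_distrib_right C₁ C₂ _ ▸ ⟨hz, hzH⟩⟩
  rw [closure_union] at hclosure
  exact hclosure.elim (hside C₁ hC₁ hW₁) (hside C₂ hC₂ hW₂)

theorem IsClassF.convergesToEnds (hΔ : IsClassF Δ)
    (hfin : LocallyFinite (fun ω : specialLeaves Δ => (ω : Set X))) (he : IsStrip Δ e)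
    (hreg : range (IsStrip.base Δ e) ⊆ regularLeaves Δ)
    (habs : ∀ C ⊆ regularLeaves Δ, IsPreconnected (Quotient.mk Δ ⁻¹' C) →
      (C ∩ range (IsStrip.base Δ e)).Nonempty → C ⊆ range (IsStrip.base Δ e)) :
    ConvergesToEnds (IsStrip.base Δ e) :=
  ⟨he.isOpenEmbedding_base, fun _ => he.isClosed_image_base hreg, fun _ =>
    hΔ.tendsto_of_mem_ends hfin he hreg habs⟩

end ClassF

/-- The reflection of the interval `(-1, 1)`. -/
def reflectIoo : Ioo (-1 : ℝ) 1 ≃ₜ Ioo (-1 : ℝ) 1 where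
  toFun t := ⟨-t, neg_lt_neg t.2.2, neg_lt.1 t.2.1⟩
  invFun t := ⟨-t, neg_lt_neg t.2.2, neg_lt.1 t.2.1⟩
  left_inv t := Subtype.ext (neg_neg _)
  right_inv t := Subtype.ext (neg_neg _)
  continuous_toFun := by fun_prop
  continuous_invFun := by fun_prop

section Pieces

variable {A : Set X} (φ : openStrip ≃ₜ A)

theorem image_strip_nonneg : (fun q : ℝ × Ioo (-1 : ℝ) 1 =>
      (φ ((stripHomeomorph _).symm q) : X)) '' {q | 0 ≤ q.2.1} =
    (fun p : openStrip => (φ p : X)) '' {p | 0 ≤ p.1.2} := by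
  refine (image_comp (fun p : openStrip => (φ p : X)) (stripHomeomorph (Ioo (-1) 1)).symm _).trans
    (congrArg _ ?_)
  exact (stripHomeomorph (Ioo (-1) 1)).symm.toEquiv.image_eq_preimage_symm _

theorem image_strip_reflect_nonneg : (fun q : ℝ × Ioo (-1 : ℝ) 1 =>
      (φ ((stripHomeomorph _).symm (q.1, reflectIoo q.2)) : X)) '' {q | 0 ≤ q.2.1} =
    (fun p : openStrip => (φ p : X)) '' {p | p.1.2 ≤ 0} := by
  let f := ((Homeomorph.refl ℝ).prodCongr reflectIoo).trans (stripHomeomorph (Ioo (-1) 1)).symm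
  refine (image_comp (fun p : openStrip => (φ p : X)) f _).trans (congrArg _ ?_)
  refine (f.toEquiv.image_eq_preimage_symm _).trans (Set.ext fun p => ?_)
  exact neg_nonneg (a := p.1.2)

theorem IsFoliated.range_base {Z : Set (Quotient Δ)} (hZ : IsOpen Z)
    {φ : openStrip ≃ₜ Quotient.mk Δ ⁻¹' Z} (hφ : IsFoliated (canonicalFoliation openStrip) Δ φ) :
    range (IsStrip.base Δ fun q : ℝ × Ioo (-1 : ℝ) 1 =>
      (φ ((stripHomeomorph _).symm q) : X)) = Z := by
  refine Quotient.mk_surjective.preimage_injective ?_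
  rw [(hφ.isStrip (hZ.preimage continuous_quotient_mk')).preimage_range_base]
  have hsurj := φ.surjective.comp (stripHomeomorph (Ioo (-1) 1)).symm.surjective
  exact (hsurj.range_comp Subtype.val).trans Subtype.range_coe

end Pieces

theorem IsClassF.exists_modelStrip_closure_halves [ChartedSpace (EuclideanHalfSpace 2) X]
    [T2Space X] [SecondCountableTopology X] (hΔ : IsClassF Δ)
    (hfin : LocallyFinite (fun ω : specialLeaves Δ => (ω : Set X)))
    {Z : Set (Quotient Δ)} (hZo : IsOpen Z) (hZ : Z ⊆ regularLeaves Δ)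
    (habs : ∀ C ⊆ regularLeaves Δ, IsPreconnected (Quotient.mk Δ ⁻¹' C) →
      (C ∩ Z).Nonempty → C ⊆ Z)
    {φ : openStrip ≃ₜ Quotient.mk Δ ⁻¹' Z} (hφ : IsFoliated (canonicalFoliation openStrip) Δ φ) :
    (∃ S : Set (ℝ × ℝ), IsModelStrip S ∧ FoliatedHomeomorphic (canonicalFoliation S) Δ
      (closure ((fun p : openStrip => (φ p : X)) '' {p | p.1.2 ≤ 0}))) ∧
    (∃ S : Set (ℝ × ℝ), IsModelStrip S ∧ FoliatedHomeomorphic (canonicalFoliation S) Δ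
      (closure ((fun p : openStrip => (φ p : X)) '' {p | 0 ≤ p.1.2}))) := by
  have he := hφ.isStrip (hZo.preimage continuous_quotient_mk')
  have hrange := hφ.range_base hZo
  have hhalf : ∀ e : ℝ × Ioo (-1 : ℝ) 1 → X, IsStrip Δ e → range (IsStrip.base Δ e) = Z →
      ∃ S : Set (ℝ × ℝ), IsModelStrip S ∧
        FoliatedHomeomorphic (canonicalFoliation S) Δ (closure (e '' {q | 0 ≤ q.2.1})) := by
    rintro e he' rfl
    exact hΔ.locallyStrip.exists_modelStrip_closure he' (hΔ.convergesToEnds hfin he' hZ habs)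
  rw [← image_strip_nonneg, ← image_strip_reflect_nonneg]
  exact ⟨hhalf _ (he.comp reflectIoo.isOpenEmbedding)
    ((reflectIoo.surjective.range_comp _).trans hrange), hhalf _ he hrange⟩

end Halves

end StripFoliation

open StripFoliation in
theorem theorem1 {X : Type*} [TopologicalSpace X] [T2Space X] [SecondCountableTopology X]
    [ChartedSpace (EuclideanHalfSpace 2) X] [ConnectedSpace X]
    (Δ : Setoid X) (hΔ : IsClassF Δ)
    (hfin : LocallyFinite (fun ω : specialLeaves Δ => (ω : Set X)))
    (Q : Set X) (hQ : IsComponentOf (⋃₀ specialLeaves Δ ∪ (𝓡∂ 2).boundary X)ᶜ Q) :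
    ((FoliatedHomeomorphic cylinderFoliation Δ Q ∨
        FoliatedHomeomorphic mobiusFoliation Δ Q ∨
        FoliatedHomeomorphic (canonicalFoliation openStrip) Δ Q) ∧
      (FoliatedHomeomorphic cylinderFoliation Δ Q ∨
        FoliatedHomeomorphic mobiusFoliation Δ Q → Q = Set.univ)) ∧
    ∀ φ : openStrip ≃ₜ Q, IsFoliated (canonicalFoliation openStrip) Δ φ →
      (∃ S : Set (ℝ × ℝ), IsModelStrip S ∧
        FoliatedHomeomorphic (canonicalFoliation S) Δ
          (closure ((fun p : openStrip => (φ p : X)) '' {p | p.1.2 ≤ 0}))) ∧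
      (∃ S : Set (ℝ × ℝ), IsModelStrip S ∧
        FoliatedHomeomorphic (canonicalFoliation S) Δ
          (closure ((fun p : openStrip => (φ p : X)) '' {p | 0 ≤ p.1.2}))) := by
  obtain ⟨Z, rfl, hZo, hZc, hZ, habs⟩ := hΔ.exists_image_component hfin hQ
  refine ⟨⟨hΔ.foliatedHomeomorphic_component hZo hZc hZ, ?_⟩, fun φ hφ =>
    hΔ.exists_modelStrip_closure_halves hfin hZo hZ habs hφ⟩
  rintro (h | h)
  · exact eq_univ_of_glued hZo hZc.nonempty (fun z hz => (hZ hz).1) h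
  · exact eq_univ_of_glued hZo hZc.nonempty (fun z hz => (hZ hz).1) h
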